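/- **Lemma 6.1 (dynamic Gauss formula, three dimensions).** Let $c>0$ and let $S^-\subset\mathbb R^3$ be a bounded open set whose boundary $S$ is a Lyapunov surface: near each of its points, $S$ is, in suitable orthonormal coordinates, the graph of a $C^1$ function with Hölder continuous gradient, with $S^-$ lying on exactly one side of it. Let $n(y)$ be the external unit normal at $y\in S$, let $dS$ be surface area, and let $H_S^-$ be the characteristic function of $S^-$ with value $\tfrac12$ on $S$ (so $1$ in $S^-$ and $0$ outside $S^-\cup S$); let $H$ be the Heaviside function with $H(0)=\tfrac12$. For $x\in\mathbb R^3$ and $t\in\mathbb R$ put $r=\|x-y\|$ and $S_t(x)=\{y\in S: r<ct\}$; the set $\{r=ct\}$ is the sphere of radius $ct$ about $x$ (empty for $t<0$). Then for every $x\in\mathbb R^3$ (including $x\in S$) the functions $\frac{\partial r^{-1}}{\partial n(y)}$ and $\frac{\partial\ln r}{\partial n(y)}$ are integrable over $S$, $H_S^-(y)/r$ is integrable over $\{r=ct\}$ for every $t$, and $$-\int_{S_t(x)}\frac{\partial r^{-1}}{\partial n(y)}\,dS(y)+\frac1c\frac{\partial}{\partial t}\left\{\int_{r=ct}\frac{H_S^-(y)}{r}\,dS(y)+\int_{S_t(x)}\frac{\partial\ln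 r}{\partial n(y)}\,dS(y)\right\}=4\pi H_S^-(x)H(t).$$ Here the integral over $S_t(x)$ of $\partial r^{-1}/\partial n$ and the expression in braces are locally integrable functions of $t\in\mathbb R$, and the identity holds * in the sense of distributions in $t\in\mathbb R$; * with the classical derivative (which exists) for almost every $t\in\mathbb R$; * with the classical derivative (which exists) at every $t\ne0$ such that, for all $s$ near $t$, the sphere $\{r=cs\}$ meets $S$ in a set of zero area. For $t>t^*(x):=\max_{y\in S}\|x-y\|/c$ one has $S_t(x)=S$, the $t$-derivative of the expression in braces exists and is zero, and the identity becomes the classical Gauss formula $$-\int_S\frac{\partial}{\partial n(y)}\left(\frac1r\right)dS(y)=4\pi H_S^-(x).$$ -/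

import Mathlib

open MeasureTheory Metric Set Filter Topology Asymptotics
open scoped NNReal ContDiff RealInnerProductSpace

/-- Three-dimensional Euclidean space. -/
abbrev E3 : Type := EuclideanSpace ℝ (Fin 3)

/-- A bounded open set of `ℝ³` whose boundary is a Lyapunov surface, that is, a surface whose
unit normal is locally Hölder continuous: near each boundary point, after an orthogonal change of
coordinates, the set is the part below the graph of a `C¹` function with Hölder continuous
gradient (so the boundary is, near that point, the graph itself). -/
structure IsLyapunovDomain (Ω : Set E3) : Prop where
  isOpen : IsOpen Ω
  isBounded : Bornology.IsBounded Ω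
  exists_graph : ∀ p ∈ frontier Ω,
    ∃ (e : E3 ≃ₗᵢ[ℝ] E3) (g : EuclideanSpace ℝ (Fin 2) → ℝ) (C α : ℝ≥0) (ε : ℝ),
      ContDiff ℝ 1 g ∧ 0 < α ∧ α ≤ 1 ∧ HolderWith C α (fderiv ℝ g) ∧ 0 < ε ∧
        ∀ y ∈ ball p ε, (y ∈ Ω ↔ e y 2 < g !₂[e y 0, e y 1])

/-- `ν` is the external unit normal at the boundary point `y` of `Ω`: it has length one, it is
orthogonal to the surface `frontier Ω` at `y`, and it points out of `Ω`. -/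
structure IsExternalNormal (Ω : Set E3) (y ν : E3) : Prop where
  norm_eq_one : ‖ν‖ = 1
  orthogonal : (fun z : E3 => ⟪z - y, ν⟫) =o[𝓝[frontier Ω] y] (fun z : E3 => z - y)
  external : ∀ᶠ s in 𝓝[>] (0 : ℝ), y + s • ν ∉ closure Ω ∧ y - s • ν ∈ Ω

open Classical in
/-- The external unit normal `n(y)` (and `0` where there is none). -/
noncomputable def externalNormal (Ω : Set E3) (y : E3) : E3 :=
  if h : ∃ ν, IsExternalNormal Ω y ν then h.choose else 0

/-- The normal derivative `∂f/∂n(y)`. -/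
noncomputable def normalDeriv (Ω : Set E3) (f : E3 → ℝ) (y : E3) : ℝ :=
  fderiv ℝ f y (externalNormal Ω y)

open Classical in
/-- The characteristic function `H_S⁻` of `Ω`, equal to `1/2` on the boundary. -/
noncomputable def charS (Ω : Set E3) (x : E3) : ℝ :=
  if x ∈ Ω then 1 else if x ∈ frontier Ω then 1 / 2 else 0

/-- The Heaviside function, equal to `1/2` at `0`. -/
noncomputable def heaviside (t : ℝ) : ℝ :=
  if 0 < t then 1 else if t = 0 then 1 / 2 else 0

/-- The part `S_t(x) = {y ∈ S : ‖x - y‖ < c t}` of the boundary. -/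
def surfacePart (Ω : Set E3) (c : ℝ) (x : E3) (t : ℝ) : Set E3 :=
  {y ∈ frontier Ω | ‖x - y‖ < c * t}

/-- `∂(1/r)/∂n(y)`, where `r = ‖x - y‖`. -/
noncomputable def normalDerivInv (Ω : Set E3) (x y : E3) : ℝ :=
  normalDeriv Ω (fun z => ‖x - z‖⁻¹) y

/-- `∂(ln r)/∂n(y)`, where `r = ‖x - y‖`. -/
noncomputable def normalDerivLog (Ω : Set E3) (x y : E3) : ℝ :=
  normalDeriv Ω (fun z => Real.log ‖x - z‖) y

/-- `∫_{S_t(x)} ∂(1/r)/∂n(y) dS(y)`. Here `μHE[2]` is the surface area: two-dimensional Hausdorff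
measure, normalized to agree with Lebesgue measure on planes. -/
noncomputable def doubleLayer (Ω : Set E3) (c : ℝ) (x : E3) (t : ℝ) : ℝ :=
  ∫ y in surfacePart Ω c x t, normalDerivInv Ω x y ∂μHE[2]

/-- `∫_{r = ct} H_S⁻(y)/r dS(y) + ∫_{S_t(x)} ∂(ln r)/∂n(y) dS(y)`. The sphere `r = ct` is empty
for `t < 0`. -/
noncomputable def frontTerm (Ω : Set E3) (c : ℝ) (x : E3) (t : ℝ) : ℝ :=
  (∫ y in sphere x (c * t), charS Ω y / ‖x - y‖ ∂μHE[2]) +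
    ∫ y in surfacePart Ω c x t, normalDerivLog Ω x y ∂μHE[2]

/-- `t*(x) = max_{y ∈ S} ‖x - y‖ / c`. -/
noncomputable def arrivalTime (Ω : Set E3) (c : ℝ) (x : E3) : ℝ :=
  sSup ((fun y => ‖x - y‖ / c) '' frontier Ω)

/-! Let σ(R) be the integral of `charS Ω (x + R θ)` over unit vectors θ (`sphereIntegral`), and K(R)
the integral of ⟨y - x, n(y)⟩ / r³ over the part of S in the open ball of radius R about x
(`kernelIntegral`). The heart of the matter is the Gauss formula for the part of the domain in a
ball: σ(R) + K(R) = 4π `charS Ω x` for almost every R > 0 (`ae_sphereIntegral_add_kernelIntegral`).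
It is obtained weakly in R. For a test function ξ supported in (0, ∞), the field ξ(r) r⁻³ (y - x)
has divergence ξ'(r) r⁻². In polar coordinates the divergence theorem for this field says ∫ ξ' (σ +
K) = 0, so σ + K is almost everywhere constant. The constant is read off as R → 0: K(R) → 0 because
the Hölder condition makes the kernel integrable, and σ(R) tends to 4π, 0 or, when x lies on S and
the domain looks like a half-space, 2π.

Now put R = ct. The double layer integral is -K(R), and the expression in braces is R σ(R) + L(R),
with L(R) the integral of ∂(ln r)/∂n (`logIntegral`). By Fubini the integral of K over (0, R) is R
K(R) - L(R). Hence for R > 0 the braces equal the primitive of 4π `charS Ω x` - K plus the defect R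
(σ + K - 4π `charS Ω x`) (`frontTerm_eq`), and differentiating the primitive gives the asserted
identity.

It remains to control the defect. It is at most R⁻¹ times the area of S on the sphere of radius R
(`mul_abs_gaussDefect_le`), so it vanishes off a countable set of radii and distributions do not see
it. The classical derivative almost everywhere needs more: these areas are the atoms of a finite
measure on the line, and by a Borel-Cantelli argument such atoms are o(s - t) at almost every t
(`ae_isLittleO_measureReal_singleton`), so the defect has derivative zero there.

The geometry underneath is built from Hausdorff measure: the area formula for C¹ graphs, polar
coordinates, uniqueness of the external normal, and the gradient theorem on Lyapunov domains. -/

/-- The Euclidean plane. -/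
abbrev E2 : Type := EuclideanSpace ℝ (Fin 2)

/-! ### Local comparison of measures and the area formula for graphs. -/

theorem measure_le_mul_of_locally_le {X : Type*} [TopologicalSpace X] [SecondCountableTopology X]
    [MeasurableSpace X] [OpensMeasurableSpace X] {μ ν : Measure X} {U : Set X} {t : ENNReal}
    (h : ∀ p ∈ U, ∃ V ∈ 𝓝 p, ∀ A ⊆ V, MeasurableSet A → μ A ≤ t * ν A)
    {A : Set X} (hAU : A ⊆ U) (hA : MeasurableSet A) : μ A ≤ t * ν A := by
  have h' : ∀ p : U, ∃ V : Set X, IsOpen V ∧ p.1 ∈ V ∧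
      ∀ A ⊆ V, MeasurableSet A → μ A ≤ t * ν A := by
    intro p
    obtain ⟨V, hV, hVA⟩ := h p.1 p.2
    obtain ⟨W, hWV, hW, hpW⟩ := mem_nhds_iff.1 hV
    exact ⟨W, hW, hpW, fun A hA => hVA A (hA.trans hWV)⟩
  choose V hVo hpV hV using h'
  obtain ⟨T, hT, hTe⟩ := TopologicalSpace.isOpen_iUnion_countable V hVo
  have hAT : A ⊆ ⋃ i ∈ T, V i := by
    rw [hTe]
    exact fun a ha => mem_iUnion.2 ⟨⟨a, hAU ha⟩, hpV _⟩
  rcases T.eq_empty_or_nonempty with hT0 | hT0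
  · have : A = ∅ := by simpa [hT0] using hAT
    simp [this]
  obtain ⟨q, rfl⟩ := hT.exists_eq_range hT0
  -- Countably many of the neighbourhoods suffice (Lindelöf). They are made disjoint so that the
  -- local inequalities can be added.
  have hAu : A = ⋃ n, A ∩ disjointed (fun n => V (q n)) n := by
    rw [← inter_iUnion, iUnion_disjointed, eq_comm, inter_eq_left]
    simpa using hAT
  have hm : ∀ n, MeasurableSet (A ∩ disjointed (fun n => V (q n)) n) := fun n =>
    hA.inter (MeasurableSet.disjointed (fun n => (hVo (q n)).measurableSet) n)
  have hd : Pairwise (Function.onFun Disjoint fun n => A ∩ disjointed (fun n => V (q n)) n) :=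
    fun i j hij => (disjoint_disjointed (fun n => V (q n)) hij).mono inter_subset_right
      inter_subset_right
  rw [hAu, measure_iUnion hd hm, measure_iUnion hd hm, ← ENNReal.tsum_mul_left]
  exact ENNReal.tsum_le_tsum fun n =>
    hV (q n) _ (inter_subset_right.trans (disjointed_subset _ _)) (hm n)

theorem measure_le_of_locally_le {X : Type*} [TopologicalSpace X] [SecondCountableTopology X]
    [MeasurableSpace X] [OpensMeasurableSpace X] {μ ν : Measure X} {U : Set X}
    (h : ∀ t : ℝ≥0, 1 < t → ∀ p ∈ U, ∃ V ∈ 𝓝 p, ∀ A ⊆ V, MeasurableSet A → μ A ≤ t * ν A)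
    {A : Set X} (hAU : A ⊆ U) (hA : MeasurableSet A) : μ A ≤ ν A := by
  have key : ∀ t : ℝ≥0, 1 < t → μ A ≤ t * ν A := fun t ht =>
    measure_le_mul_of_locally_le (h t ht) hAU hA
  have hlim : Tendsto (fun t : ℝ≥0 => (t : ENNReal) * ν A) (𝓝[>] 1) (𝓝 (1 * ν A)) := by
    refine ENNReal.Tendsto.mul_const ?_ (Or.inl one_ne_zero)
    exact (ENNReal.tendsto_coe.2 tendsto_id).mono_left nhdsWithin_le_nhds
  rw [one_mul] at hlim
  exact ge_of_tendsto hlim (eventually_nhdsWithin_of_forall fun t ht => key t ht)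

theorem LipschitzOnWith.euclideanHausdorffMeasure_image_le {X Y : Type*} [EMetricSpace X]
    [EMetricSpace Y] [MeasurableSpace X] [BorelSpace X] [MeasurableSpace Y] [BorelSpace Y]
    {K : ℝ≥0} {f : X → Y} {s : Set X} (h : LipschitzOnWith K f s) (d : ℕ) :
    μHE[d] (f '' s) ≤ (K : ENNReal) ^ d * μHE[d] s := by
  simp only [Measure.euclideanHausdorffMeasure_def, Measure.smul_apply]
  have := h.hausdorffMeasure_image_le (d := d) (by positivity)
  rw [ENNReal.rpow_natCast] at this
  rw [ENNReal.smul_def, ENNReal.smul_def, smul_eq_mul, smul_eq_mul, mul_left_comm]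
  gcongr

/-- Space as the product of the horizontal plane and the vertical axis. -/
noncomputable def glue : (E2 × ℝ) ≃L[ℝ] E3 :=
  LinearEquiv.toContinuousLinearEquiv
  { toFun := fun p => !₂[p.1 0, p.1 1, p.2]
    invFun := fun y => (!₂[y 0, y 1], y 2)
    map_add' := by intro p q; ext i; fin_cases i <;> simp
    map_smul' := by intro c p; ext i; fin_cases i <;> simp
    left_inv := by
      intro p
      refine Prod.ext ?_ ?_
      · ext i; fin_cases i <;> simp
      · simp
    right_inv := by intro y; ext i; fin_cases i <;> simp }

theorem glue_apply (p : E2 × ℝ) : glue p = !₂[p.1 0, p.1 1, p.2] := rfl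
@[simp] theorem glue_apply_two (p : E2 × ℝ) : glue p 2 = p.2 := rfl

theorem inner_glue (p q : E2 × ℝ) : ⟪glue p, glue q⟫ = ⟪p.1, q.1⟫ + p.2 * q.2 := by
  simp [glue_apply, PiLp.inner_apply, Fin.sum_univ_three, Fin.sum_univ_two]
  ring

theorem norm_glue_sq (p : E2 × ℝ) : ‖glue p‖ ^ 2 = ‖p.1‖ ^ 2 + p.2 ^ 2 := by
  rw [← real_inner_self_eq_norm_sq, inner_glue, real_inner_self_eq_norm_sq]
  ring

theorem norm_fst_le_norm_glue (p : E2 × ℝ) : ‖p.1‖ ≤ ‖glue p‖ := by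
  refine le_of_sq_le_sq ?_ (norm_nonneg _)
  rw [norm_glue_sq]
  nlinarith [sq_nonneg p.2]

theorem norm_glue_zero (z : ℝ) : ‖glue (0, z)‖ = |z| := by
  have := norm_glue_sq (0, z)
  simp only [norm_zero] at this
  rw [← abs_of_nonneg (norm_nonneg (glue (0, z)))]
  exact (sq_eq_sq_iff_abs_eq_abs _ _).1 (by linarith)

theorem measurePreserving_glue : MeasurePreserving glue := by
  have h1 := (volume_preserving_piFinSuccAbove (fun _ : Fin 3 => ℝ) 2).symm
  have h2 := PiLp.volume_preserving_ofLp (Fin 2)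
  have h3 := PiLp.volume_preserving_toLp (Fin 3)
  have h4 : MeasurePreserving (Prod.swap : E2 × ℝ → ℝ × E2) := Measure.measurePreserving_swap
  have h5 : MeasurePreserving (Prod.map id WithLp.ofLp : ℝ × E2 → ℝ × (Fin 2 → ℝ)) :=
    (MeasurePreserving.id _).prod h2
  have := h3.comp (h1.comp (h5.comp h4))
  convert this using 1
  ext p i
  fin_cases i <;> simp [glue_apply, MeasurableEquiv.piFinSuccAbove, Fin.insertNthEquiv] <;> rfl

theorem measurableEmbedding_glue : MeasurableEmbedding glue :=
  glue.toHomeomorph.measurableEmbedding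

/-- The parametrization of the graph of a function of two variables. -/
noncomputable def graphMap (g : E2 → ℝ) (u : E2) : E3 := glue (u, g u)

/-- The surface element of a graph. -/
noncomputable def graphJacobian (g : E2 → ℝ) (u : E2) : ℝ := √(1 + ‖fderiv ℝ g u‖ ^ 2)

theorem one_le_graphJacobian (g : E2 → ℝ) (u : E2) : 1 ≤ graphJacobian g u := by
  rw [graphJacobian, Real.one_le_sqrt]
  nlinarith [sq_nonneg ‖fderiv ℝ g u‖]

theorem measurable_graphJacobian (g : E2 → ℝ) : Measurable (graphJacobian g) := by
  unfold graphJacobian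
  have := measurable_fderiv ℝ g
  fun_prop

theorem graphMap_fst (g : E2 → ℝ) (u : E2) : (glue.symm (graphMap g u)).1 = u := by
  simp [graphMap]

theorem isClosedEmbedding_graphMap {g : E2 → ℝ} (hg : Continuous g) :
    IsClosedEmbedding (graphMap g) := by
  refine glue.toHomeomorph.isClosedEmbedding.comp (f := fun u => (u, g u)) ?_
  refine IsClosedEmbedding.of_continuous_injective_isClosedMap (by fun_prop)
    (fun a b h => congrArg Prod.fst h) ?_
  intro s hs
  have : (fun u => (u, g u)) '' s = {p : E2 × ℝ | p.1 ∈ s ∧ g p.1 = p.2} := by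
    ext ⟨a, b⟩
    simp
  rw [this]
  exact (hs.preimage continuous_fst).inter (isClosed_eq (hg.comp continuous_fst) continuous_snd)

/-- The graph of a linear form, as a linear map. -/
noncomputable def graphLinear (a : E2 →L[ℝ] ℝ) : E2 →L[ℝ] E3 :=
  (glue : (E2 × ℝ) →L[ℝ] E3).comp ((ContinuousLinearMap.id ℝ E2).prod a)

theorem graphLinear_apply (a : E2 →L[ℝ] ℝ) (u : E2) : graphLinear a u = glue (u, a u) := rfl

/-- With a = ⟨v, ·⟩ the Gram determinant of the images of the basis is (1 + v₀²)(1 + v₁²) - v₀² v₁²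
= 1 + |v|². -/
theorem normDet_graphLinear (a : E2 →L[ℝ] ℝ) :
    (graphLinear a : E2 →ₗ[ℝ] E3).normDet = √(1 + ‖a‖ ^ 2) := by
  have h := LinearMap.normDet_sq_eq_det_gram (graphLinear a : E2 →ₗ[ℝ] E3)
    (EuclideanSpace.basisFun (Fin 2) ℝ)
  obtain ⟨v, rfl⟩ := (InnerProductSpace.toDual ℝ E2).surjective a
  rw [Matrix.det_fin_two] at h
  simp only [Matrix.gram_apply, ContinuousLinearMap.coe_coe, graphLinear_apply, inner_glue,
    InnerProductSpace.toDual_apply_apply] at h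
  rw [LinearIsometryEquiv.norm_map]
  have hv : ‖v‖ ^ 2 = v 0 ^ 2 + v 1 ^ 2 := by
    rw [EuclideanSpace.norm_sq_eq]; simp [Fin.sum_univ_two]
  rw [← Real.sqrt_sq (LinearMap.normDet_nonneg _)]
  congr 1
  rw [hv]
  simp [PiLp.inner_apply] at h
  rw [h]
  ring

theorem euclideanHausdorffMeasure_graphLinear_image (a : E2 →L[ℝ] ℝ) (s : Set E2) :
    μHE[2] (graphLinear a '' s) = ENNReal.ofReal √(1 + ‖a‖ ^ 2) * volume s := by
  have := LinearMap.euclideanHausdorffMeasure_image (graphLinear a : E2 →ₗ[ℝ] E3) s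
  rw [normDet_graphLinear] at this
  simpa [EuclideanSpace.euclideanHausdorffMeasure_eq_volume] using this

/-- Both parametrizations are inverted by the projection to the plane, which does not increase
distances. Their increments differ by at most η |u - v|, so passing from either surface to the other
over the same base point is (1 + η)-Lipschitz. -/
theorem graphMap_comparison {g : E2 → ℝ} {a : E2 →L[ℝ] ℝ} {V A : Set E2} {η : ℝ≥0}
    (h : ApproximatesLinearOn g a V η) (hA : A ⊆ V) :
    μHE[2] (graphMap g '' A) ≤ ((1 + η : ℝ≥0) : ENNReal) ^ 2 * μHE[2] (graphLinear a '' A) ∧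
    μHE[2] (graphLinear a '' A) ≤ ((1 + η : ℝ≥0) : ENNReal) ^ 2 * μHE[2] (graphMap g '' A) := by
  have hdiff : ∀ u ∈ A, ∀ v ∈ A,
      ‖(graphMap g u - graphMap g v) - (graphLinear a u - graphLinear a v)‖ ≤ η * ‖u - v‖ := by
    intro u hu v hv
    have h1 : (graphMap g u - graphMap g v) - (graphLinear a u - graphLinear a v) =
        glue (0, g u - g v - a (u - v)) := by
      simp only [graphMap, graphLinear_apply, ← map_sub]
      congr 1
      simp
    rw [h1, norm_glue_zero, ← Real.norm_eq_abs]
    exact h u (hA hu) v (hA hv)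
  have hL : ∀ u v, ‖u - v‖ ≤ ‖graphLinear a u - graphLinear a v‖ := by
    intro u v
    rw [← map_sub]
    exact norm_fst_le_norm_glue (u - v, a (u - v))
  have hM : ∀ u v, ‖u - v‖ ≤ ‖graphMap g u - graphMap g v‖ := by
    intro u v
    rw [graphMap, graphMap, ← map_sub]
    exact norm_fst_le_norm_glue ((u, g u) - (v, g v))
  have hfst : ∀ u, (glue.symm (graphLinear a u)).1 = u := by
    intro u; simp [graphLinear_apply]
  constructor
  · have : graphMap g '' A =
        (fun y => graphMap g (glue.symm y).1) '' (graphLinear a '' A) := by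
      rw [image_image]; simp [hfst]
    rw [this]
    refine LipschitzOnWith.euclideanHausdorffMeasure_image_le ?_ 2
    refine LipschitzOnWith.of_dist_le_mul ?_
    rintro _ ⟨u, hu, rfl⟩ _ ⟨v, hv, rfl⟩
    simp only [hfst, dist_eq_norm]
    push_cast
    have h1 := hdiff u hu v hv
    have h2 := hL u v
    have h3 := norm_sub_norm_le (graphMap g u - graphMap g v) (graphLinear a u - graphLinear a v)
    nlinarith [η.2, mul_le_mul_of_nonneg_left h2 η.2]
  · have : graphLinear a '' A =
        (fun y => graphLinear a (glue.symm y).1) '' (graphMap g '' A) := by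
      rw [image_image]; simp [graphMap_fst]
    rw [this]
    refine LipschitzOnWith.euclideanHausdorffMeasure_image_le ?_ 2
    refine LipschitzOnWith.of_dist_le_mul ?_
    rintro _ ⟨u, hu, rfl⟩ _ ⟨v, hv, rfl⟩
    simp only [graphMap_fst, dist_eq_norm]
    push_cast
    have h1 := hdiff u hu v hv
    have h2 := hM u v
    have h3 := norm_sub_norm_le (graphLinear a u - graphLinear a v) (graphMap g u - graphMap g v)
    have h4 : ‖graphMap g u - graphMap g v - (graphLinear a u - graphLinear a v)‖ =
      ‖graphLinear a u - graphLinear a v - (graphMap g u - graphMap g v)‖ := norm_sub_rev _ _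
    nlinarith [η.2, mul_le_mul_of_nonneg_left h2 η.2]

theorem exists_sq_one_add_lt {t : ℝ≥0} (ht : 1 < t) : ∃ η : ℝ≥0, 0 < η ∧ (1 + η) ^ 2 < t := by
  have : Tendsto (fun η : ℝ≥0 => (1 + η) ^ 2) (𝓝[>] 0) (𝓝 ((1 + 0) ^ 2)) :=
    (Continuous.tendsto (by fun_prop) 0).mono_left nhdsWithin_le_nhds
  have h2 := this.eventually (gt_mem_nhds (by simpa using ht))
  obtain ⟨η, h1, h2⟩ := (h2.and self_mem_nhdsWithin).exists
  exact ⟨η, h2, h1⟩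

/-- **Area formula for graphs.** -/
theorem euclideanHausdorffMeasure_graphMap_image {g : E2 → ℝ} (hg : Continuous g) {U : Set E2}
    (hU : IsOpen U) (hgU : ContDiffOn ℝ 1 g U) {A : Set E2} (hAU : A ⊆ U) (hA : MeasurableSet A) :
    μHE[2] (graphMap g '' A) = ∫⁻ u in A, ENNReal.ofReal (graphJacobian g u) := by
  have hemb := (isClosedEmbedding_graphMap hg).measurableEmbedding
  have hJm : Measurable fun u => ENNReal.ofReal (graphJacobian g u) :=
    (measurable_graphJacobian g).ennreal_ofReal
  have hJc : ContinuousOn (graphJacobian g) U := by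
    have := hgU.continuousOn_fderiv_of_isOpen hU le_rfl
    unfold graphJacobian
    fun_prop
  have key : Measure.comap (graphMap g) μHE[2] A =
      (volume.withDensity fun u => ENNReal.ofReal (graphJacobian g u)) A := by
    -- Near p the graph is compared with its tangent plane at p. Choosing η with (1 + η)² < t leaves
    -- room between (1 + η)² and t for the oscillation of the continuous Jacobian.
    have aux : ∀ t : ℝ≥0, 1 < t → ∀ p ∈ U, ∃ V ∈ 𝓝 p, ∀ A ⊆ V, MeasurableSet A →
        Measure.comap (graphMap g) μHE[2] A ≤
          t * (volume.withDensity fun u => ENNReal.ofReal (graphJacobian g u)) A ∧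
        (volume.withDensity fun u => ENNReal.ofReal (graphJacobian g u)) A ≤
          t * Measure.comap (graphMap g) μHE[2] A := by
      intro t ht p hp
      obtain ⟨η, hη, hηt⟩ := exists_sq_one_add_lt ht
      obtain ⟨V, hV, hVa⟩ := ((hgU.contDiffAt (hU.mem_nhds hp)).hasStrictFDerivAt
        one_ne_zero).approximates_deriv_on_nhds (Or.inr hη)
      have hJp : 0 < graphJacobian g p := zero_lt_one.trans_le (one_le_graphJacobian g p)
      have hηt' : ((1 + η) ^ 2 : ℝ) < t := by exact_mod_cast hηt
      have hcont := (hJc.continuousAt (hU.mem_nhds hp))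
      have e1 : ∀ᶠ u in 𝓝 p, (1 + η) ^ 2 * graphJacobian g p < t * graphJacobian g u :=
        (continuousAt_const.mul hcont).eventually
          (lt_mem_nhds (mul_lt_mul_of_pos_right hηt' hJp))
      have e2 : ∀ᶠ u in 𝓝 p, (1 + η) ^ 2 * graphJacobian g u < t * graphJacobian g p :=
        (continuousAt_const.mul hcont).eventually
          (gt_mem_nhds (mul_lt_mul_of_pos_right hηt' hJp))
      refine ⟨V ∩ {u | (1 + η) ^ 2 * graphJacobian g p < t * graphJacobian g u ∧
        (1 + η) ^ 2 * graphJacobian g u < t * graphJacobian g p},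
        inter_mem hV (e1.and e2), fun A hAV hA => ?_⟩
      have hηe : ((1 + η : ℝ≥0) : ENNReal) ^ 2 = ENNReal.ofReal ((1 + η) ^ 2) := by
        rw [ENNReal.ofReal_pow (by positivity)]
        congr 1
        rw [← ENNReal.ofReal_coe_nnreal]; simp
      have hte : (t : ENNReal) = ENNReal.ofReal t := (ENNReal.ofReal_coe_nnreal).symm
      obtain ⟨c1, c2⟩ := graphMap_comparison hVa (fun u hu => (hAV hu).1)
      rw [euclideanHausdorffMeasure_graphLinear_image] at c1 c2
      change _ ≤ _ * (ENNReal.ofReal (graphJacobian g p) * _) at c1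
      change ENNReal.ofReal (graphJacobian g p) * _ ≤ _ at c2
      rw [hemb.comap_apply, withDensity_apply _ hA]
      have hη0 : ENNReal.ofReal ((1 + η) ^ 2 : ℝ) ≠ 0 := by
        simp only [ne_eq, ENNReal.ofReal_eq_zero, not_le]; positivity
      constructor
      · refine c1.trans ?_
        rw [hηe, hte, ← mul_assoc, ← ENNReal.ofReal_mul (by positivity),
          ← lintegral_const_mul _ hJm, ← setLIntegral_const]
        refine setLIntegral_mono (by fun_prop) fun u hu => ?_
        rw [← ENNReal.ofReal_mul (by positivity)]
        exact ENNReal.ofReal_le_ofReal (hAV hu).2.1.le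
      · rw [hηe] at c2
        have : ENNReal.ofReal ((1 + η) ^ 2) * ∫⁻ u in A, ENNReal.ofReal (graphJacobian g u) ≤
            ENNReal.ofReal ((1 + η) ^ 2) * (t * μHE[2] (graphMap g '' A)) := by
          rw [mul_left_comm]
          refine le_trans ?_ (mul_le_mul_right c2 (t : ENNReal))
          rw [hte, ← mul_assoc, ← ENNReal.ofReal_mul (by positivity),
            ← lintegral_const_mul _ hJm, ← setLIntegral_const]
          refine setLIntegral_mono (by fun_prop) fun u hu => ?_
          rw [← ENNReal.ofReal_mul (by positivity)]
          exact ENNReal.ofReal_le_ofReal (hAV hu).2.2.le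
        exact (ENNReal.mul_le_mul_iff_right hη0 ENNReal.ofReal_ne_top).1 this
    refine le_antisymm (measure_le_of_locally_le (fun t ht p hp => ?_) hAU hA)
      (measure_le_of_locally_le (fun t ht p hp => ?_) hAU hA)
    · obtain ⟨V, hV, h⟩ := aux t ht p hp
      exact ⟨V, hV, fun A h1 h2 => (h A h1 h2).1⟩
    · obtain ⟨V, hV, h⟩ := aux t ht p hp
      exact ⟨V, hV, fun A h1 h2 => (h A h1 h2).2⟩
  rwa [hemb.comap_apply, withDensity_apply _ hA] at key

theorem restrict_image_graphMap {g : E2 → ℝ} (hg : Continuous g) {U : Set E2}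
    (hU : IsOpen U) (hgU : ContDiffOn ℝ 1 g U) :
    μHE[2].restrict (graphMap g '' U) = Measure.map (graphMap g)
      ((volume.restrict U).withDensity fun u => ENNReal.ofReal (graphJacobian g u)) := by
  have hemb := (isClosedEmbedding_graphMap hg).measurableEmbedding
  ext B hB
  rw [Measure.restrict_apply hB, hemb.map_apply,
    withDensity_apply _ (hemb.measurable hB), Measure.restrict_restrict (hemb.measurable hB),
    inter_comm B, ← image_inter_preimage, inter_comm,
    euclideanHausdorffMeasure_graphMap_image hg hU hgU inter_subset_right
      ((hemb.measurable hB).inter hU.measurableSet)]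

theorem setLIntegral_image_graphMap {g : E2 → ℝ} (hg : Continuous g) {U : Set E2}
    (hU : IsOpen U) (hgU : ContDiffOn ℝ 1 g U) (f : E3 → ENNReal) (hf : Measurable f) :
    ∫⁻ y in graphMap g '' U, f y ∂μHE[2] =
      ∫⁻ u in U, ENNReal.ofReal (graphJacobian g u) * f (graphMap g u) := by
  have hemb := (isClosedEmbedding_graphMap hg).measurableEmbedding
  rw [restrict_image_graphMap hg hU hgU, hemb.lintegral_map]
  exact lintegral_withDensity_eq_lintegral_mul _ (measurable_graphJacobian g).ennreal_ofReal
    (hf.comp hemb.measurable)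

/-! ### Polar coordinates and surface measure on spheres. -/

/-- On the vertical line at horizontal distance N from the origin, the height z is traded for the
distance R to the origin, z² = R² - N². -/
theorem lintegral_Ioi_eq_lintegral_sqrt {N : ℝ} (hN : 0 ≤ N) (h : ℝ → ENNReal) :
    ∫⁻ z in Ioi 0, h z =
      ∫⁻ R in Ioi N, ENNReal.ofReal (R / √(R ^ 2 - N ^ 2)) * h √(R ^ 2 - N ^ 2) := by
  have hpos : ∀ R ∈ Ioi N, 0 < R ^ 2 - N ^ 2 := by
    intro R hR
    have : N < R := hR
    nlinarith
  have himg : (fun R : ℝ => √(R ^ 2 - N ^ 2)) '' Ioi N = Ioi 0 := by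
    ext z
    constructor
    · rintro ⟨R, hR, rfl⟩
      exact Real.sqrt_pos.2 (hpos R hR)
    · intro hz
      have hz : 0 < z := hz
      refine ⟨√(z ^ 2 + N ^ 2), ?_, ?_⟩
      · exact Real.lt_sqrt_of_sq_lt (by nlinarith)
      · change √(√(z ^ 2 + N ^ 2) ^ 2 - N ^ 2) = z
        rw [Real.sq_sqrt (by positivity), add_sub_cancel_right, Real.sqrt_sq hz.le]
  rw [← himg, lintegral_image_eq_lintegral_abs_deriv_mul measurableSet_Ioi
    (f' := fun R => R / √(R ^ 2 - N ^ 2))]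
  · refine setLIntegral_congr_fun measurableSet_Ioi fun R hR => ?_
    have : N < R := hR
    rw [abs_of_nonneg (div_nonneg (hN.trans this.le) (Real.sqrt_nonneg _))]
  · intro R hR
    have h1 : HasDerivAt (fun R : ℝ => R ^ 2 - N ^ 2) (2 * R) R := by
      simpa using (hasDerivAt_pow 2 R).sub_const (N ^ 2)
    have h2 := (h1.sqrt (hpos R hR).ne').hasDerivWithinAt (s := Ioi N)
    rwa [mul_div_mul_left _ _ two_ne_zero] at h2
  · intro R hR S hS hRS
    have h0 : R ^ 2 - N ^ 2 = S ^ 2 - N ^ 2 :=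
      (Real.sqrt_inj (hpos R hR).le (hpos S hS).le).1 hRS
    have h1 : N < R := hR
    have h2 : N < S := hS
    nlinarith

theorem setLIntegral_ball_eq_smul {R : ℝ} (hR : 0 < R) (F : E2 → ENNReal) :
    ∫⁻ u in ball (0 : E2) R, F u = ENNReal.ofReal (R ^ 2) * ∫⁻ v in ball (0 : E2) 1, F (R • v) := by
  have hmap := Measure.map_addHaar_smul (volume : Measure E2) hR.ne'
  have hemb : MeasurableEmbedding fun x : E2 => R • x :=
    (Homeomorph.smulOfNeZero R hR.ne').measurableEmbedding
  have hpre : (fun x : E2 => R • x) ⁻¹' ball 0 R = ball 0 1 := by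
    ext x
    simp [norm_smul, abs_of_pos hR, mul_lt_iff_lt_one_right hR]
  have h1 : ∫⁻ v in ball (0 : E2) 1, F (R • v) =
      ∫⁻ u in ball 0 R, F u ∂(Measure.map (fun x : E2 => R • x) volume) := by
    rw [hemb.restrict_map, hemb.lintegral_map, hpre]
  rw [h1, hmap, Measure.restrict_smul, lintegral_smul_measure, smul_eq_mul, ← mul_assoc,
    ← ENNReal.ofReal_mul (by positivity)]
  have : R ^ 2 * |(R ^ Module.finrank ℝ E2)⁻¹| = 1 := by
    simp only [finrank_euclideanSpace, Fintype.card_fin]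
    rw [abs_of_pos (by positivity)]
    exact mul_inv_cancel₀ (by positivity)
  rw [this]
  simp

/-- The function whose graph over the unit disc is the open upper unit hemisphere. -/
noncomputable def hemi (u : E2) : ℝ := √(1 - ‖u‖ ^ 2)

theorem continuous_hemi : Continuous hemi := by unfold hemi; fun_prop

theorem one_sub_norm_sq_pos {u : E2} (hu : u ∈ ball (0 : E2) 1) : 0 < 1 - ‖u‖ ^ 2 := by
  have : ‖u‖ < 1 := by simpa using hu
  nlinarith [norm_nonneg u]

theorem contDiffOn_hemi : ContDiffOn ℝ 1 hemi (ball 0 1) :=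
  (contDiff_const.sub (contDiff_norm_sq ℝ)).contDiffOn.sqrt
    fun _ hu => (one_sub_norm_sq_pos hu).ne'

theorem graphJacobian_hemi {u : E2} (hu : u ∈ ball (0 : E2) 1) :
    graphJacobian hemi u = 1 / √(1 - ‖u‖ ^ 2) := by
  have hpos := one_sub_norm_sq_pos hu
  have h1 : HasFDerivAt (fun u : E2 => 1 - ‖u‖ ^ 2) (-(2 • innerSL ℝ u)) u := by
    have := ((hasFDerivAt_id (𝕜 := ℝ) u).norm_sq).const_sub 1
    simpa using this
  have h2 := (h1.sqrt hpos.ne').fderiv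
  have h3 : ‖fderiv ℝ hemi u‖ ^ 2 = ‖u‖ ^ 2 / (1 - ‖u‖ ^ 2) := by
    change fderiv ℝ hemi u = _ at h2
    rw [h2, norm_smul, norm_neg, ← Nat.cast_smul_eq_nsmul ℝ, norm_smul, innerSL_apply_norm, mul_pow,
      mul_pow, Real.norm_eq_abs, sq_abs, div_pow, mul_pow, Real.sq_sqrt hpos.le]
    simp
    field_simp
  rw [graphJacobian, h3, ← Real.sqrt_one, ← Real.sqrt_div zero_le_one]
  simp only [Real.sqrt_one]
  congr 1
  field_simp
  ring

/-- The open upper unit hemisphere. -/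
def upperHemisphere : Set E3 := {θ | ‖θ‖ = 1 ∧ 0 < θ 2}

theorem image_graphMap_hemi : graphMap hemi '' ball 0 1 = upperHemisphere := by
  ext θ
  constructor
  · rintro ⟨u, hu, rfl⟩
    have hpos := one_sub_norm_sq_pos hu
    refine ⟨?_, ?_⟩
    · have := norm_glue_sq (u, hemi u)
      rw [hemi, Real.sq_sqrt hpos.le] at this
      rw [graphMap, hemi]
      have h1 : ‖glue (u, √(1 - ‖u‖ ^ 2))‖ ^ 2 = 1 := by linarith
      exact (pow_eq_one_iff_of_nonneg (norm_nonneg _) two_ne_zero).1 h1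
    · rw [graphMap, glue_apply_two]
      exact Real.sqrt_pos.2 hpos
  · rintro ⟨h1, h2⟩
    obtain ⟨⟨u, z⟩, rfl⟩ := glue.surjective θ
    have hz : 0 < z := h2
    have h := norm_glue_sq (u, z)
    rw [h1] at h
    simp only at h
    refine ⟨u, ?_, ?_⟩
    · rw [mem_ball_zero_iff]
      nlinarith [norm_nonneg u]
    · rw [graphMap, hemi]
      congr 2
      rw [show 1 - ‖u‖ ^ 2 = z ^ 2 by linarith, Real.sqrt_sq hz.le]

/-- Fubini along vertical lines, the height replaced by the radius, then the order of integration
exchanged. Rescaling the disc of radius R to the unit disc produces R², and the factor R / √(R² -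
‖u‖²) turns into the surface element 1 / √(1 - ‖v‖²) of the hemisphere. -/
theorem lintegral_upperHalfSpace {f : E3 → ENNReal} (hf : Measurable f) :
    ∫⁻ y in {y : E3 | 0 < y 2}, f y =
      ∫⁻ R in Ioi (0 : ℝ), ENNReal.ofReal (R ^ 2) *
        ∫⁻ θ in upperHemisphere, f (R • θ) ∂μHE[2] := by
  have hpre : glue ⁻¹' {y : E3 | 0 < y 2} = univ ×ˢ Ioi (0 : ℝ) := by
    ext p; simp
  have hfg : Measurable fun p => f (glue p) := hf.comp glue.continuous.measurable
  rw [← measurePreserving_glue.setLIntegral_comp_preimage_emb measurableEmbedding_glue, hpre,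
    Measure.volume_eq_prod, ← Measure.prod_restrict, Measure.restrict_univ,
    lintegral_prod _ hfg.aemeasurable]
  have step : ∀ u : E2, ∫⁻ z in Ioi (0 : ℝ), f (glue (u, z)) =
      ∫⁻ R in Ioi (0 : ℝ), (ball (0 : E2) R).indicator
        (fun u => ENNReal.ofReal (R / √(R ^ 2 - ‖u‖ ^ 2)) * f (glue (u, √(R ^ 2 - ‖u‖ ^ 2)))) u := by
    intro u
    rw [lintegral_Ioi_eq_lintegral_sqrt (norm_nonneg u)]
    have : Ioi ‖u‖ = Ioi ‖u‖ ∩ Ioi 0 := by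
      rw [Ioi_inter_Ioi, sup_of_le_left (norm_nonneg u)]
    rw [this, ← setLIntegral_indicator measurableSet_Ioi]
    refine lintegral_congr fun R => ?_
    by_cases h : ‖u‖ < R
    · rw [indicator_of_mem (show R ∈ Ioi ‖u‖ from h),
        indicator_of_mem (show u ∈ ball (0 : E2) R by simpa using h)]
    · rw [indicator_of_notMem (show R ∉ Ioi ‖u‖ from h),
        indicator_of_notMem (show u ∉ ball (0 : E2) R by simpa using h)]
  simp_rw [step]
  rw [lintegral_lintegral_swap]
  · refine setLIntegral_congr_fun measurableSet_Ioi fun R hR => ?_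
    have hR : 0 < R := hR
    rw [lintegral_indicator measurableSet_ball, setLIntegral_ball_eq_smul hR,
      ← image_graphMap_hemi, setLIntegral_image_graphMap continuous_hemi isOpen_ball
        contDiffOn_hemi (fun y => f (R • y)) (hf.comp (by fun_prop))]
    congr 1
    refine setLIntegral_congr_fun measurableSet_ball fun v hv => ?_
    have h1 : √(R ^ 2 - ‖R • v‖ ^ 2) = R * √(1 - ‖v‖ ^ 2) := by
      rw [norm_smul, mul_pow, Real.norm_eq_abs, sq_abs,
        show R ^ 2 - R ^ 2 * ‖v‖ ^ 2 = R ^ 2 * (1 - ‖v‖ ^ 2) by ring,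
        Real.sqrt_mul (by positivity), Real.sqrt_sq hR.le]
    have h2 : (R • v, R * √(1 - ‖v‖ ^ 2)) = R • (v, hemi v) := rfl
    rw [h1, h2, map_smul, graphJacobian_hemi hv, graphMap]
    congr 2
    rw [div_mul_eq_div_div, div_self hR.ne']
  · apply Measurable.aemeasurable
    have : (Function.uncurry fun (u : E2) (R : ℝ) => (ball (0 : E2) R).indicator
        (fun u => ENNReal.ofReal (R / √(R ^ 2 - ‖u‖ ^ 2)) *
          f (glue (u, √(R ^ 2 - ‖u‖ ^ 2)))) u) =
        {p : E2 × ℝ | ‖p.1‖ < p.2}.indicator fun p =>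
          ENNReal.ofReal (p.2 / √(p.2 ^ 2 - ‖p.1‖ ^ 2)) *
            f (glue (p.1, √(p.2 ^ 2 - ‖p.1‖ ^ 2))) := by
      ext ⟨u, R⟩
      simp only [Function.uncurry_apply_pair, indicator, mem_ball_zero_iff, mem_ofPred_eq]
    rw [this]
    refine Measurable.indicator ?_ (measurableSet_lt (by fun_prop) (by fun_prop))
    refine Measurable.mul (by fun_prop) (hfg.comp (by fun_prop))

/-- The equator lies in the range of a C¹ curve, whose Hausdorff dimension is at most one. -/
theorem euclideanHausdorffMeasure_equator :
    μHE[2] {θ : E3 | ‖θ‖ = 1 ∧ θ 2 = 0} = 0 := by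
  have hcd : ContDiff ℝ 1 (fun t : ℝ => (!₂[Real.cos t, Real.sin t, 0] : E3)) := by
    rw [contDiff_euclidean]
    intro i
    fin_cases i
    · exact Real.contDiff_cos
    · exact Real.contDiff_sin
    · exact contDiff_const
  have hsub : {θ : E3 | ‖θ‖ = 1 ∧ θ 2 = 0} ⊆
      range (fun t : ℝ => (!₂[Real.cos t, Real.sin t, 0] : E3)) := by
    rintro θ ⟨h1, h2⟩
    have h3 : θ 0 ^ 2 + θ 1 ^ 2 = 1 := by
      have := EuclideanSpace.norm_sq_eq θ
      rw [h1, Fin.sum_univ_three, h2] at this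
      simp at this
      linarith
    have h4 : ‖(⟨θ 0, θ 1⟩ : ℂ)‖ = 1 := by
      rw [Complex.norm_def, Complex.normSq_mk, ← sq, ← sq, h3, Real.sqrt_one]
    obtain ⟨t, ht⟩ := (Complex.norm_eq_one_iff _).1 h4
    refine ⟨t, ?_⟩
    have hre := congrArg Complex.re ht
    have him := congrArg Complex.im ht
    rw [Complex.exp_ofReal_mul_I_re] at hre
    rw [Complex.exp_ofReal_mul_I_im] at him
    ext i
    fin_cases i
    · simpa using hre
    · simpa using him
    · simpa using h2.symm
  have hd : dimH (range (fun t : ℝ => (!₂[Real.cos t, Real.sin t, 0] : E3))) < (2 : ℝ≥0) := by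
    refine hcd.dimH_range_le.trans_lt ?_
    simp
  have := measure_mono_null hsub (hausdorffMeasure_of_dimH_lt hd)
  rw [Measure.euclideanHausdorffMeasure_def, Measure.smul_apply]
  simp only [NNReal.coe_ofNat] at this
  simp [this]

theorem measurableSet_upperHemisphere : MeasurableSet upperHemisphere := by
  have h1 : MeasurableSet {θ : E3 | ‖θ‖ = 1} := measurableSet_eq_fun (by fun_prop) (by fun_prop)
  have h2 : MeasurableSet {θ : E3 | 0 < θ 2} := measurableSet_lt (by fun_prop) (by fun_prop)
  exact h1.inter h2

theorem lintegral_unitSphere (h : E3 → ENNReal) :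
    ∫⁻ θ in sphere (0 : E3) 1, h θ ∂μHE[2] =
      (∫⁻ θ in upperHemisphere, h θ ∂μHE[2]) + ∫⁻ θ in upperHemisphere, h (-θ) ∂μHE[2] := by
  have hneg : MeasurePreserving (fun y : E3 => -y) μHE[2] μHE[2] :=
    (IsometryEquiv.neg E3).measurePreserving_euclideanHausdorffMeasure 2
  have hemb : MeasurableEmbedding fun y : E3 => -y := (Homeomorph.neg E3).measurableEmbedding
  have h1 := hneg.setLIntegral_comp_emb hemb h upperHemisphere
  rw [h1, ← lintegral_union]
  · have hsub : sphere (0 : E3) 1 =ᵐ[μHE[2]]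
        (upperHemisphere ∪ (fun y => -y) '' upperHemisphere : Set E3) := by
      refine (ae_eq_set.2 ⟨?_, ?_⟩)
      · refine measure_mono_null ?_ euclideanHausdorffMeasure_equator
        rintro θ ⟨hθ, hn⟩
        simp only [upperHemisphere, mem_union, mem_ofPred_eq, image_neg_eq_neg, Set.mem_neg, norm_neg,
          PiLp.neg_apply, not_or, mem_sphere_zero_iff_norm] at hθ hn
        refine ⟨hθ, ?_⟩
        have h1 := hn.1
        have h2 := hn.2
        simp only [hθ, true_and, not_lt] at h1 h2
        linarith
      · convert measure_empty
        · rw [sdiff_eq_empty]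
          rintro θ (h | h)
          · simpa using h.1
          · simp only [image_neg_eq_neg, Set.mem_neg] at h
            simpa using h.1
        · infer_instance
    exact setLIntegral_congr hsub
  · exact hemb.measurableSet_image.2 measurableSet_upperHemisphere
  · rw [Set.disjoint_left]
    rintro θ h1 h2
    simp only [image_neg_eq_neg, Set.mem_neg] at h2
    have := h1.2
    have := h2.2
    simp only [PiLp.neg_apply] at this
    linarith

/-- **Integration in polar coordinates.** -/
theorem lintegral_polar {f : E3 → ENNReal} (hf : Measurable f) :
    ∫⁻ y, f y = ∫⁻ R in Ioi (0 : ℝ), ENNReal.ofReal (R ^ 2) *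
        ∫⁻ θ in sphere (0 : E3) 1, f (R • θ) ∂μHE[2] := by
  have hfn : Measurable fun y => f (-y) := hf.comp measurable_neg
  have hU : MeasurableSet {y : E3 | 0 < y 2} := measurableSet_lt (by fun_prop) (by fun_prop)
  have hL : MeasurableSet {y : E3 | y 2 < 0} := measurableSet_lt (by fun_prop) (by fun_prop)
  have hnull : volume {y : E3 | y 2 = 0} = 0 := by
    have h1 : glue ⁻¹' {y : E3 | y 2 = 0} = univ ×ˢ {(0 : ℝ)} := by ext p; simp
    rw [← measurePreserving_glue.measure_preimage_emb measurableEmbedding_glue, h1,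
      Measure.volume_eq_prod, Measure.prod_prod]
    simp
  have hall : (univ : Set E3) =ᵐ[volume] ({y : E3 | 0 < y 2} ∪ {y : E3 | y 2 < 0} : Set E3) := by
    refine ae_eq_set.2 ⟨measure_mono_null ?_ hnull, by simp⟩
    rintro y ⟨-, hy⟩
    simp only [mem_union, mem_ofPred_eq, not_or, not_lt] at hy ⊢
    linarith [hy.1, hy.2]
  have hdisj : Disjoint {y : E3 | 0 < y 2} {y : E3 | y 2 < 0} := by
    rw [Set.disjoint_left]
    intro y h1 h2
    exact lt_asymm (show 0 < y 2 from h1) h2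
  have hlow : ∫⁻ y in {y : E3 | y 2 < 0}, f y = ∫⁻ y in {y : E3 | 0 < y 2}, f (-y) := by
    have := (Measure.measurePreserving_neg (volume : Measure E3)).setLIntegral_comp_preimage_emb
      (Homeomorph.neg E3).measurableEmbedding f {y : E3 | y 2 < 0}
    rw [← this]
    congr 2
    ext y
    simp
  rw [← setLIntegral_univ f, setLIntegral_congr hall, lintegral_union hL hdisj, hlow,
    lintegral_upperHalfSpace hf, lintegral_upperHalfSpace hfn, ← lintegral_add_left]
  · refine lintegral_congr fun R => ?_
    rw [lintegral_unitSphere, mul_add]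
    simp only [smul_neg]
  · refine Measurable.mul (by fun_prop) ?_
    simp_rw [← image_graphMap_hemi]
    have : ∀ R : ℝ, ∫⁻ θ in graphMap hemi '' ball 0 1, f (R • θ) ∂μHE[2] =
        ∫⁻ u in ball (0 : E2) 1, ENNReal.ofReal (graphJacobian hemi u) *
          f (R • graphMap hemi u) := fun R =>
      setLIntegral_image_graphMap continuous_hemi isOpen_ball contDiffOn_hemi
        (fun y => f (R • y)) (hf.comp (by fun_prop))
    simp_rw [this]
    refine Measurable.lintegral_prod_right' (f := fun p : ℝ × E2 =>
      ENNReal.ofReal (graphJacobian hemi p.2) * f (p.1 • graphMap hemi p.2)) ?_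
    have h1 := (measurable_graphJacobian hemi).ennreal_ofReal
    have h2 := (isClosedEmbedding_graphMap continuous_hemi).continuous
    refine Measurable.mul (h1.comp measurable_snd) (hf.comp ?_)
    fun_prop

/-- Surface measure on the unit sphere. -/
noncomputable abbrev unitSphereMeasure : Measure E3 := μHE[2].restrict (sphere (0 : E3) 1)

/-- Polar coordinates give the volume of the unit ball as one third of the area of the sphere, and
that volume is 4π/3. -/
theorem unitSphereMeasure_univ : unitSphereMeasure univ = ENNReal.ofReal (4 * Real.pi) := by
  have h := lintegral_polar (f := (ball (0 : E3) 1).indicator 1)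
    (measurable_one.indicator measurableSet_ball)
  rw [lintegral_indicator_one measurableSet_ball, EuclideanSpace.volume_ball_fin_three] at h
  have h2 : ∀ R ∈ Ioi (0 : ℝ), ENNReal.ofReal (R ^ 2) *
        ∫⁻ θ in sphere (0 : E3) 1, (ball (0 : E3) 1).indicator 1 (R • θ) ∂μHE[2] =
      (Iio (1 : ℝ)).indicator (fun R => ENNReal.ofReal (R ^ 2)) R * unitSphereMeasure univ := by
    intro R hR
    have hR : 0 < R := hR
    have : ∀ θ ∈ sphere (0 : E3) 1, (ball (0 : E3) 1).indicator 1 (R • θ) =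
        (Iio (1 : ℝ)).indicator (1 : ℝ → ENNReal) R := by
      intro θ hθ
      have hθ : ‖θ‖ = 1 := by simpa using hθ
      by_cases h : R < 1
      · rw [indicator_of_mem (show R ∈ Iio 1 from h), indicator_of_mem]
        · rfl
        · simpa [norm_smul, hθ, abs_of_pos hR] using h
      · rw [indicator_of_notMem (show R ∉ Iio 1 from h), indicator_of_notMem]
        simpa [norm_smul, hθ, abs_of_pos hR] using h
    rw [setLIntegral_congr_fun isClosed_sphere.measurableSet this]
    by_cases h : R < 1
    · simp [indicator_of_mem (show R ∈ Iio 1 from h)]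
    · simp [indicator_of_notMem (show R ∉ Iio 1 from h)]
  rw [setLIntegral_congr_fun measurableSet_Ioi h2, lintegral_mul_const _ (by measurability),
    setLIntegral_indicator measurableSet_Iio, Iio_inter_Ioi] at h
  have h3 : ∫⁻ R in Ioo (0 : ℝ) 1, ENNReal.ofReal (R ^ 2) = ENNReal.ofReal (1 / 3) := by
    rw [← ofReal_integral_eq_lintegral_ofReal]
    · congr 1
      rw [← integral_Ioc_eq_integral_Ioo, ← intervalIntegral.integral_of_le zero_le_one,
        integral_pow]
      norm_num
    · exact (Continuous.integrableOn_Icc (by fun_prop)).mono_set Ioo_subset_Icc_self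
    · exact ae_of_all _ fun R => sq_nonneg R
  rw [h3] at h
  have h4 : ENNReal.ofReal (1 / 3) * unitSphereMeasure univ =
      ENNReal.ofReal (1 / 3) * ENNReal.ofReal (4 * Real.pi) := by
    rw [← h, ← ENNReal.ofReal_mul (by norm_num)]
    simp only [ENNReal.ofReal_one, one_pow, one_mul]
    congr 1
    ring
  exact (ENNReal.mul_right_inj (by simp) ENNReal.ofReal_ne_top).1 h4

instance : IsFiniteMeasure unitSphereMeasure :=
  ⟨by rw [unitSphereMeasure_univ]; exact ENNReal.ofReal_lt_top⟩

/-- Stating polar coordinates as an equality of measures carries them from nonnegative to integrable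
functions. -/
theorem map_polar (x : E3) :
    Measure.map (fun p : ℝ × E3 => x + p.1 • p.2)
      (((volume.restrict (Ioi (0 : ℝ))).withDensity fun R => ENNReal.ofReal (R ^ 2)).prod
        unitSphereMeasure) = volume := by
  ext B hB
  have hm : Measurable fun p : ℝ × E3 => x + p.1 • p.2 := by fun_prop
  rw [Measure.map_apply hm hB, Measure.prod_apply (hm hB),
    lintegral_withDensity_eq_lintegral_mul _ (by fun_prop) (measurable_measure_prodMk_left (hm hB))]
  have hB' : MeasurableSet ((fun y => x + y) ⁻¹' B) := (measurable_const_add x) hB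
  have h := lintegral_polar (f := ((fun y => x + y) ⁻¹' B).indicator 1)
    (measurable_one.indicator hB')
  rw [lintegral_indicator_one hB', measure_preimage_add] at h
  rw [h]
  refine lintegral_congr fun R => ?_
  simp only [Pi.mul_apply]
  congr 1
  have hR : MeasurableSet (Prod.mk R ⁻¹' ((fun p : ℝ × E3 => x + p.1 • p.2) ⁻¹' B)) :=
    measurable_prodMk_left (hm hB)
  rw [← lintegral_indicator_one hR]
  rfl

theorem integral_polar (x : E3) {f : E3 → ℝ} (hf : Integrable f) :
    ∫ y, f y = ∫ R in Ioi (0 : ℝ), R ^ 2 * ∫ θ, f (x + R • θ) ∂unitSphereMeasure := by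
  have hm : Measurable fun p : ℝ × E3 => x + p.1 • p.2 := by fun_prop
  have hf' := hf
  rw [← map_polar x] at hf'
  conv_lhs => rw [← map_polar x]
  rw [integral_map hm.aemeasurable hf'.1]
  refine (integral_prod _ ((integrable_map_measure hf'.1
    hm.aemeasurable).1 hf')).trans ?_
  rw [integral_withDensity_eq_integral_toReal_smul (by fun_prop)
    (ae_of_all _ fun _ => ENNReal.ofReal_lt_top)]
  refine integral_congr_ae (ae_of_all _ fun R => ?_)
  simp only [smul_eq_mul]
  rw [ENNReal.toReal_ofReal (sq_nonneg R)]
  rfl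

theorem restrict_sphere_eq_map (x : E3) {R : ℝ} (hR : 0 < R) :
    μHE[2].restrict (sphere x R) =
      ENNReal.ofReal (R ^ 2) • Measure.map (fun θ : E3 => x + R • θ) unitSphereMeasure := by
  have hemb : MeasurableEmbedding fun θ : E3 => x + R • θ :=
    ((Homeomorph.smulOfNeZero R hR.ne').trans (Homeomorph.addLeft x)).measurableEmbedding
  have hpre : (fun θ : E3 => x + R • θ) ⁻¹' sphere x R = sphere 0 1 := by
    ext θ
    simp only [mem_preimage, mem_sphere_iff_norm, add_sub_cancel_left, norm_smul, Real.norm_eq_abs,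
      abs_of_pos hR, sub_zero]
    constructor
    · intro h
      field_simp at h
      exact h
    · intro h
      rw [h, mul_one]
  have hsurj : Function.Surjective fun θ : E3 => x + R • θ :=
    ((Homeomorph.smulOfNeZero R hR.ne').trans (Homeomorph.addLeft x)).surjective
  have himg : ∀ s : Set E3, μHE[2] ((fun θ : E3 => x + R • θ) '' s) =
      ENNReal.ofReal (R ^ 2) * μHE[2] s := by
    intro s
    have h1 : (fun θ : E3 => x + R • θ) '' s = (fun y => x + y) '' ((fun θ => R • θ) '' s) := by
      rw [image_image]
    rw [h1, (isometry_add_left x).euclideanHausdorffMeasure_image]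
    have h2 := Measure.euclideanHausdorffMeasure_smul₀ (E := E3) 2 hR.ne' s
    rw [← image_smul] at h2
    rw [h2, ENNReal.smul_def, smul_eq_mul]
    congr 1
    rw [ENNReal.ofReal_pow hR.le]
    push_cast
    congr 1
    rw [← enorm_eq_nnnorm, Real.enorm_of_nonneg hR.le]
  ext B hB
  rw [Measure.restrict_apply hB, Measure.smul_apply, hemb.map_apply, smul_eq_mul,
    Measure.restrict_apply (hemb.measurable hB), ← hpre, ← preimage_inter, ← himg,
    image_preimage_eq _ hsurj]

theorem setIntegral_sphere (x : E3) {R : ℝ} (hR : 0 < R) (f : E3 → ℝ) :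
    ∫ y in sphere x R, f y ∂μHE[2] = R ^ 2 * ∫ θ, f (x + R • θ) ∂unitSphereMeasure := by
  have hemb : MeasurableEmbedding fun θ : E3 => x + R • θ :=
    ((Homeomorph.smulOfNeZero R hR.ne').trans (Homeomorph.addLeft x)).measurableEmbedding
  rw [restrict_sphere_eq_map x hR, integral_smul_measure, hemb.integral_map,
    ENNReal.toReal_ofReal (sq_nonneg R), smul_eq_mul]

theorem euclideanHausdorffMeasure_inter_sphere (x : E3) {R : ℝ} (hR : 0 < R) {B : Set E3}
    (hB : MeasurableSet B) : μHE[2] (B ∩ sphere x R) =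
      ENNReal.ofReal (R ^ 2) * unitSphereMeasure ((fun θ => x + R • θ) ⁻¹' B) := by
  rw [← Measure.restrict_apply hB, restrict_sphere_eq_map x hR, Measure.smul_apply,
    Measure.map_apply (by fun_prop) hB, smul_eq_mul]

/-! ### Local subgraphs and their external normal. -/

/-- The projection of space onto the horizontal plane. -/
noncomputable def flat : E3 →L[ℝ] E2 :=
  (ContinuousLinearMap.fst ℝ E2 ℝ).comp (glue.symm : E3 →L[ℝ] (E2 × ℝ))

@[simp] theorem flat_glue (p : E2 × ℝ) : flat (glue p) = p.1 := by
  change (glue.symm (glue p)).1 = p.1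
  simp

theorem glue_flat (y : E3) : glue (flat y, y 2) = y := glue.apply_symm_apply y

theorem norm_flat_le (y : E3) : ‖flat y‖ ≤ ‖y‖ := by
  conv_rhs => rw [← glue_flat y]
  exact norm_fst_le_norm_glue (flat y, y 2)

/-- In the coordinates `e`, the set `Ω` is near `p` the part below the graph of `g`. -/
structure IsLocalSubgraph (Ω : Set E3) (p : E3) (e : E3 ≃ₗᵢ[ℝ] E3) (g : E2 → ℝ) (ε : ℝ) :
    Prop where
  isOpen : IsOpen Ω
  contDiff : ContDiff ℝ 1 g
  mem_iff : ∀ y ∈ ball p ε, (y ∈ Ω ↔ e y 2 < g (flat (e y)))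

/-- The signed vertical distance to the graph of `g` in the coordinates `e`. -/
noncomputable def graphHeight (e : E3 ≃ₗᵢ[ℝ] E3) (g : E2 → ℝ) (y : E3) : ℝ := e y 2 - g (flat (e y))

/-- The gradient of `graphHeight`. -/
noncomputable def graphConormal (e : E3 ≃ₗᵢ[ℝ] E3) (g : E2 → ℝ) (y : E3) : E3 :=
  e.symm (glue (-gradient g (flat (e y)), 1))

/-- The upward unit normal of the graph of `g` in the coordinates `e`. -/
noncomputable def graphNormal (e : E3 ≃ₗᵢ[ℝ] E3) (g : E2 → ℝ) (y : E3) : E3 :=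
  (graphJacobian g (flat (e y)))⁻¹ • graphConormal e g y

/-- The vertical unit vector in the coordinates `e`. -/
noncomputable def vertical (e : E3 ≃ₗᵢ[ℝ] E3) : E3 := e.symm (glue (0, 1))

section

variable {Ω : Set E3} {p : E3} {e : E3 ≃ₗᵢ[ℝ] E3} {g : E2 → ℝ} {ε : ℝ}

theorem graphJacobian_pos (g : E2 → ℝ) (u : E2) : 0 < graphJacobian g u :=
  zero_lt_one.trans_le (one_le_graphJacobian g u)

theorem inner_graphConormal (y v : E3) :
    ⟪graphConormal e g y, v⟫ = e v 2 - fderiv ℝ g (flat (e y)) (flat (e v)) := by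
  have h1 : ⟪graphConormal e g y, v⟫ = ⟪glue (-gradient g (flat (e y)), 1), e v⟫ := by
    rw [graphConormal, ← e.inner_map_map, e.apply_symm_apply]
  rw [h1]
  conv_lhs => rw [← glue_flat (e v)]
  rw [inner_glue]
  simp only [inner_neg_left, one_mul, inner_gradient_left]
  ring

theorem norm_graphConormal (y : E3) : ‖graphConormal e g y‖ = graphJacobian g (flat (e y)) := by
  rw [graphConormal, LinearIsometryEquiv.norm_map, graphJacobian,
    ← Real.sqrt_sq (norm_nonneg (glue _)), norm_glue_sq]
  simp only [norm_neg, gradient, LinearIsometryEquiv.norm_map]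
  congr 1
  ring

theorem norm_graphNormal (y : E3) : ‖graphNormal e g y‖ = 1 := by
  rw [graphNormal, norm_smul, norm_graphConormal, norm_inv,
    Real.norm_of_nonneg (graphJacobian_pos _ _).le, inv_mul_cancel₀ (graphJacobian_pos _ _).ne']

theorem graphHeight_add_vertical (y : E3) (s : ℝ) :
    graphHeight e g (y + s • vertical e) = graphHeight e g y + s := by
  simp [graphHeight, vertical]
  ring

theorem continuous_graphHeight (hg : Continuous g) : Continuous (graphHeight e g) := by
  unfold graphHeight
  fun_prop

theorem hasFDerivAt_graphHeight (hg : ContDiff ℝ 1 g) (y : E3) :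
    HasFDerivAt (graphHeight e g) (innerSL ℝ (graphConormal e g y)) y := by
  have hd : DifferentiableAt ℝ g (flat (e y)) := hg.differentiable one_ne_zero _
  have he : HasFDerivAt (fun y => e y) (e.toContinuousLinearEquiv : E3 →L[ℝ] E3) y :=
    (e.toContinuousLinearEquiv : E3 →L[ℝ] E3).hasFDerivAt
  have h1 : HasFDerivAt (fun y => e y 2)
      ((EuclideanSpace.proj (2 : Fin 3) : E3 →L[ℝ] ℝ).comp
        (e.toContinuousLinearEquiv : E3 →L[ℝ] E3)) y :=
    (EuclideanSpace.proj (2 : Fin 3) : E3 →L[ℝ] ℝ).hasFDerivAt.comp y he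
  have h2 := hd.hasFDerivAt.comp y (flat.hasFDerivAt.comp y he)
  have := h1.sub h2
  have heq : innerSL ℝ (graphConormal e g y) =
      (EuclideanSpace.proj (2 : Fin 3) : E3 →L[ℝ] ℝ).comp
        (e.toContinuousLinearEquiv : E3 →L[ℝ] E3) - (fderiv ℝ g (flat (e y))).comp
          (flat.comp (e.toContinuousLinearEquiv : E3 →L[ℝ] E3)) := by
    refine ContinuousLinearMap.ext fun v => ?_
    rw [innerSL_apply_apply, inner_graphConormal]
    rfl
  rw [heq]
  exact this

theorem continuous_graphConormal (hg : ContDiff ℝ 1 g) : Continuous (graphConormal e g) := by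
  have h1 : Continuous (gradient g) :=
    (InnerProductSpace.toDual ℝ E2).symm.continuous.comp (hg.continuous_fderiv one_ne_zero)
  unfold graphConormal
  fun_prop

theorem continuous_graphJacobian (hg : ContDiff ℝ 1 g) : Continuous (graphJacobian g) := by
  have := hg.continuous_fderiv one_ne_zero
  unfold graphJacobian
  fun_prop

theorem continuous_graphNormal (hg : ContDiff ℝ 1 g) : Continuous (graphNormal e g) := by
  unfold graphNormal
  refine Continuous.smul (Continuous.inv₀ ?_ fun y => (graphJacobian_pos _ _).ne')
    (continuous_graphConormal hg)
  exact (continuous_graphJacobian hg).comp (by fun_prop)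

namespace IsLocalSubgraph

theorem mem_iff_graphHeight (h : IsLocalSubgraph Ω p e g ε) {y : E3} (hy : y ∈ ball p ε) :
    y ∈ Ω ↔ graphHeight e g y < 0 := by
  rw [h.mem_iff y hy, graphHeight, sub_neg]

theorem notMem_closure (h : IsLocalSubgraph Ω p e g ε) {y : E3} (hy : y ∈ ball p ε)
    (hpos : 0 < graphHeight e g y) : y ∉ closure Ω := by
  have hopen : IsOpen (ball p ε ∩ {z | 0 < graphHeight e g z}) :=
    isOpen_ball.inter (isOpen_lt continuous_const (continuous_graphHeight h.contDiff.continuous))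
  intro hcl
  obtain ⟨z, hz, hzΩ⟩ := mem_closure_iff.1 hcl _ hopen ⟨hy, hpos⟩
  exact lt_asymm hz.2 ((h.mem_iff_graphHeight hz.1).1 hzΩ)

theorem mem_frontier_iff (h : IsLocalSubgraph Ω p e g ε) {y : E3} (hy : y ∈ ball p ε) :
    y ∈ frontier Ω ↔ graphHeight e g y = 0 := by
  rw [frontier, h.isOpen.interior_eq]
  constructor
  · rintro ⟨hcl, hn⟩
    refine le_antisymm ?_ ?_
    · by_contra! hpos
      exact h.notMem_closure hy hpos hcl
    · by_contra! hneg
      exact hn ((h.mem_iff_graphHeight hy).2 hneg)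
  · intro h0
    refine ⟨?_, fun hn => ((h.mem_iff_graphHeight hy).1 hn).ne h0⟩
    have hlim : Tendsto (fun s : ℝ => y + s • vertical e) (𝓝[<] 0) (𝓝 y) := by
      have : Tendsto (fun s : ℝ => y + s • vertical e) (𝓝 0) (𝓝 (y + (0 : ℝ) • vertical e)) :=
        Continuous.tendsto (by fun_prop) 0
      rw [zero_smul, add_zero] at this
      exact this.mono_left nhdsWithin_le_nhds
    refine mem_closure_of_tendsto hlim ?_
    filter_upwards [hlim (isOpen_ball.mem_nhds hy), self_mem_nhdsWithin] with s hs hs0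
    rw [h.mem_iff_graphHeight hs, graphHeight_add_vertical, h0, zero_add]
    exact hs0

/-- `graphHeight` is differentiable with gradient `graphConormal`. It vanishes on the boundary,
which gives orthogonality to first order, and it grows along the normal with slope the Jacobian,
which gives the two sides. -/
theorem isExternalNormal (h : IsLocalSubgraph Ω p e g ε) {y : E3} (hy : y ∈ ball p ε)
    (hyS : y ∈ frontier Ω) : IsExternalNormal Ω y (graphNormal e g y) := by
  have h0 := (h.mem_frontier_iff hy).1 hyS
  have hd := hasFDerivAt_graphHeight (e := e) h.contDiff y
  have hJ := graphJacobian_pos g (flat (e y))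
  refine ⟨norm_graphNormal y, ?_, ?_⟩
  · have h1 := (hd.isLittleO.mono (nhdsWithin_le_nhds (s := frontier Ω)))
    have h2 : (fun z : E3 => ⟪z - y, graphNormal e g y⟫) =ᶠ[𝓝[frontier Ω] y] fun z =>
        -(graphJacobian g (flat (e y)))⁻¹ *
          (graphHeight e g z - graphHeight e g y - innerSL ℝ (graphConormal e g y) (z - y)) := by
      filter_upwards [nhdsWithin_le_nhds (isOpen_ball.mem_nhds hy), self_mem_nhdsWithin]
        with z hz hzS
      rw [(h.mem_frontier_iff hz).1 hzS, h0, innerSL_apply_apply, graphNormal, inner_smul_right,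
        real_inner_comm]
      ring
    exact h2.trans_isLittleO (h1.const_mul_left _)
  · have h1 := hd.isLittleO.def (half_pos hJ)
    have hlim : ∀ σ : ℝ, Tendsto (fun s : ℝ => y + (σ * s) • graphNormal e g y) (𝓝[>] 0) (𝓝 y) := by
      intro σ
      have : Tendsto (fun s : ℝ => y + (σ * s) • graphNormal e g y) (𝓝 0)
          (𝓝 (y + (σ * 0) • graphNormal e g y)) := Continuous.tendsto (by fun_prop) 0
      rw [mul_zero, zero_smul, add_zero] at this
      exact this.mono_left nhdsWithin_le_nhds
    have hin : ⟪graphConormal e g y, graphNormal e g y⟫ = graphJacobian g (flat (e y)) := by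
      rw [graphNormal, inner_smul_right, real_inner_self_eq_norm_sq, norm_graphConormal]
      field_simp
    have key : ∀ σ : ℝ, ∀ᶠ s in 𝓝[>] (0 : ℝ), y + (σ * s) • graphNormal e g y ∈ ball p ε ∧
        |graphHeight e g (y + (σ * s) • graphNormal e g y) -
          σ * s * graphJacobian g (flat (e y))| ≤ graphJacobian g (flat (e y)) / 2 * |σ * s| := by
      intro σ
      filter_upwards [hlim σ (isOpen_ball.mem_nhds hy), hlim σ h1] with s hs1 hs2
      refine ⟨hs1, ?_⟩
      simp only [mem_preimage, mem_ofPred_eq, h0, sub_zero, add_sub_cancel_left, innerSL_apply_apply,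
        inner_smul_right, hin, norm_smul, norm_graphNormal, mul_one, Real.norm_eq_abs] at hs2
      exact hs2
    -- The error is at most half of the linear term, so the sign of the height is that of the linear
    -- term.
    filter_upwards [key 1, key (-1), self_mem_nhdsWithin] with s hs1 hs2 hs
    have hs : 0 < s := hs
    simp only [one_mul, neg_mul, neg_smul, ← sub_eq_add_neg, abs_neg, abs_of_pos hs] at hs1 hs2
    refine ⟨h.notMem_closure hs1.1 ?_, (h.mem_iff_graphHeight hs2.1).2 ?_⟩
    · nlinarith [(abs_le.1 hs1.2).1, mul_pos hs hJ]
    · nlinarith [(abs_le.1 hs2.2).2, mul_pos hs hJ]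

/-- `IsExternalNormal` speaks only of points of the boundary, so a tangent direction has to be
realized by a curve inside it. -/
theorem inner_eq_zero_of_tangent (h : IsLocalSubgraph Ω p e g ε) {y : E3} (hy : y ∈ ball p ε)
    (hyS : y ∈ frontier Ω) {ν τ : E3} (hν : IsExternalNormal Ω y ν)
    (hτ : ⟪graphConormal e g y, τ⟫ = 0) : ⟪τ, ν⟫ = 0 := by
  have h0 := (h.mem_frontier_iff hy).1 hyS
  have hd := hasFDerivAt_graphHeight (e := e) h.contDiff y
  have hlin : Tendsto (fun s : ℝ => y + s • τ) (𝓝 0) (𝓝 y) := by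
    have : Tendsto (fun s : ℝ => y + s • τ) (𝓝 0) (𝓝 (y + (0 : ℝ) • τ)) :=
      Continuous.tendsto (by fun_prop) 0
    rwa [zero_smul, add_zero] at this
  have hh : (fun s : ℝ => graphHeight e g (y + s • τ)) =o[𝓝 0] fun s : ℝ => s := by
    have h1 := hd.isLittleO.comp_tendsto hlin
    have h2 : ((fun z => graphHeight e g z - graphHeight e g y -
        innerSL ℝ (graphConormal e g y) (z - y)) ∘ fun s : ℝ => y + s • τ) =
        fun s : ℝ => graphHeight e g (y + s • τ) := by
      ext s
      simp [h0, inner_smul_right, hτ]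
    rw [h2] at h1
    refine h1.trans_isBigO ?_
    refine IsBigO.of_bound ‖τ‖ (Eventually.of_forall fun s => ?_)
    simp [norm_smul, mul_comm]
  -- The tangent line is pushed vertically back onto the graph. The correction is o(s), so the curve
  -- has velocity τ at y.
  set z : ℝ → E3 := fun s => y + s • τ + (-graphHeight e g (y + s • τ)) • vertical e with hz
  have hzy : (fun s => z s - y) =O[𝓝 0] fun s : ℝ => s := by
    have : (fun s => z s - y) = fun s : ℝ => s • τ + (-graphHeight e g (y + s • τ)) • vertical e := by
      ext1 s
      rw [hz]
      module
    rw [this]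
    refine IsBigO.add ?_ ?_
    · refine IsBigO.of_bound ‖τ‖ (Eventually.of_forall fun s => ?_)
      simp [norm_smul, mul_comm]
    · refine IsBigO.trans (IsBigO.of_bound ‖vertical e‖ (Eventually.of_forall fun s => ?_)) hh.isBigO
      simp [norm_smul, mul_comm]
  have hzlim : Tendsto z (𝓝 0) (𝓝 y) := by
    have := hzy.trans_tendsto tendsto_id
    simpa using this.add_const y
  have hzS : Tendsto z (𝓝 0) (𝓝[frontier Ω] y) := by
    refine tendsto_nhdsWithin_iff.2 ⟨hzlim, ?_⟩
    filter_upwards [hzlim (isOpen_ball.mem_nhds hy)] with s hs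
    rw [h.mem_frontier_iff hs, hz, graphHeight_add_vertical, add_neg_cancel]
  have h3 : (fun s => ⟪z s - y, ν⟫) =o[𝓝 0] fun s : ℝ => s :=
    (hν.orthogonal.comp_tendsto hzS).trans_isBigO hzy
  have h4 : (fun s : ℝ => s * ⟪τ, ν⟫) =o[𝓝 0] fun s : ℝ => s := by
    have h5 : (fun s : ℝ => graphHeight e g (y + s • τ) * ⟪vertical e, ν⟫) =o[𝓝 0]
        fun s : ℝ => s := by
      simpa [mul_comm] using hh.const_mul_left ⟪vertical e, ν⟫
    refine (h3.add h5).congr_left fun s => ?_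
    rw [hz]
    simp only [add_sub_assoc, inner_add_left, inner_smul_left, inner_sub_left,
      conj_trivial]
    ring
  have h5 : (fun s : ℝ => ⟪τ, ν⟫ * s) =o[𝓝 0] fun s : ℝ => s := by simpa [mul_comm] using h4
  by_contra hne
  have h6 := (isLittleO_const_mul_left_iff hne).1 h5
  have h7 : ∀ᶠ s in 𝓝 (0 : ℝ), s = 0 := by
    filter_upwards [h6.def (one_half_pos (α := ℝ))] with s hs
    have := norm_nonneg s
    exact norm_le_zero_iff.1 (by linarith)
  have h8 : ∀ᶠ s in 𝓝[≠] (0 : ℝ), False := by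
    filter_upwards [nhdsWithin_le_nhds h7, self_mem_nhdsWithin] with s h1 h2 using h2 h1
  exact h8.exists.choose_spec

/-- Uniqueness is needed because `externalNormal` is picked by choice. The component of ν orthogonal
to N is tangent, hence orthogonal to ν, so ⟨N, ν⟩² = 1. The value -1 would put points y - sν both in
Ω and outside its closure. -/
theorem eq_graphNormal (h : IsLocalSubgraph Ω p e g ε) {y : E3} (hy : y ∈ ball p ε)
    (hyS : y ∈ frontier Ω) {ν : E3} (hν : IsExternalNormal Ω y ν) : ν = graphNormal e g y := by
  have hN := h.isExternalNormal hy hyS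
  set N := graphNormal e g y with hNdef
  have hJ := graphJacobian_pos g (flat (e y))
  have hcon : graphConormal e g y = graphJacobian g (flat (e y)) • N := by
    rw [hNdef, graphNormal, smul_smul, mul_inv_cancel₀ hJ.ne', one_smul]
  have h1 : ⟪graphConormal e g y, ν - ⟪N, ν⟫ • N⟫ = 0 := by
    rw [hcon, inner_smul_left, inner_sub_right, inner_smul_right, real_inner_self_eq_norm_sq,
      hN.norm_eq_one]
    simp
  have h2 := h.inner_eq_zero_of_tangent hy hyS hν h1
  rw [inner_sub_left, inner_smul_left, real_inner_self_eq_norm_sq, hν.norm_eq_one] at h2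
  simp only [conj_trivial] at h2
  have h3 : ⟪N, ν⟫ = 1 ∨ ⟪N, ν⟫ = -1 := by
    have : (⟪N, ν⟫ - 1) * (⟪N, ν⟫ + 1) = 0 := by linarith
    rcases mul_eq_zero.1 this with h | h
    · exact Or.inl (by linarith)
    · exact Or.inr (by linarith)
  rcases h3 with h3 | h3
  · exact ((inner_eq_one_iff_of_norm_eq_one hN.norm_eq_one hν.norm_eq_one).1 h3).symm
  · exfalso
    have h4 : N = -ν := by
      refine (inner_eq_one_iff_of_norm_eq_one (𝕜 := ℝ) hN.norm_eq_one
        (by rw [norm_neg, hν.norm_eq_one])).1 ?_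
      rw [inner_neg_right, h3, neg_neg]
    have hN' := hN.external
    rw [h4] at hN'
    obtain ⟨s, hs1, hs2⟩ := (hN'.and hν.external).exists
    apply hs1.1
    rw [smul_neg, ← sub_eq_add_neg]
    exact subset_closure hs2.2

theorem externalNormal_eq (h : IsLocalSubgraph Ω p e g ε) {y : E3} (hy : y ∈ ball p ε)
    (hyS : y ∈ frontier Ω) : externalNormal Ω y = graphNormal e g y := by
  have hex : ∃ ν, IsExternalNormal Ω y ν := ⟨_, h.isExternalNormal hy hyS⟩
  rw [externalNormal, dif_pos hex]
  exact h.eq_graphNormal hy hyS hex.choose_spec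

end IsLocalSubgraph

end

namespace IsLyapunovDomain

variable {Ω : Set E3}

theorem exists_isLocalSubgraph (hΩ : IsLyapunovDomain Ω) {p : E3} (hp : p ∈ frontier Ω) :
    ∃ (e : E3 ≃ₗᵢ[ℝ] E3) (g : E2 → ℝ) (C α : ℝ≥0) (ε : ℝ), 0 < α ∧
      HolderWith C α (fderiv ℝ g) ∧ 0 < ε ∧ IsLocalSubgraph Ω p e g ε := by
  obtain ⟨e, g, C, α, ε, hg, hα, -, hH, hε, hmem⟩ := hΩ.exists_graph p hp
  exact ⟨e, g, C, α, ε, hα, hH, hε, hΩ.isOpen, hg, hmem⟩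

theorem isCompact_frontier (hΩ : IsLyapunovDomain Ω) : IsCompact (frontier Ω) :=
  hΩ.isBounded.isCompact_closure.of_isClosed_subset isClosed_frontier frontier_subset_closure

theorem continuousOn_externalNormal (hΩ : IsLyapunovDomain Ω) :
    ContinuousOn (externalNormal Ω) (frontier Ω) := by
  intro p hp
  obtain ⟨e, g, C, α, ε, -, -, hε, h⟩ := hΩ.exists_isLocalSubgraph hp
  refine ((continuous_graphNormal (e := e) h.contDiff).continuousWithinAt).congr_of_eventuallyEq ?_
    (h.externalNormal_eq (mem_ball_self hε) hp)
  filter_upwards [nhdsWithin_le_nhds (ball_mem_nhds p hε), self_mem_nhdsWithin] with y hy hyS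
  exact h.externalNormal_eq hy hyS

end IsLyapunovDomain

/-! ### Normal derivatives of functions of the distance. -/

theorem hasFDerivAt_norm_sub {x y : E3} (h : y ≠ x) :
    HasFDerivAt (fun z => ‖x - z‖) (‖x - y‖⁻¹ • innerSL ℝ (y - x)) y := by
  have h0 : x - y ≠ 0 := sub_ne_zero.2 h.symm
  have h1 : HasFDerivAt (fun z : E3 => x - z) (-ContinuousLinearMap.id ℝ E3) y :=
    (hasFDerivAt_id y).const_sub x
  have h2 := (h1.norm_sq).sqrt (by positivity)
  simp only [Real.sqrt_sq (norm_nonneg _)] at h2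
  have heq : ‖x - y‖⁻¹ • innerSL ℝ (y - x) = (1 / (2 * ‖x - y‖)) •
      (2 • (innerSL ℝ (x - y)).comp (-ContinuousLinearMap.id ℝ E3)) := by
    refine ContinuousLinearMap.ext fun v => ?_
    simp
    ring
  rw [heq]
  exact h2

theorem normalDerivInv_eq (Ω : Set E3) {x y : E3} (h : y ≠ x) :
    normalDerivInv Ω x y = -(⟪y - x, externalNormal Ω y⟫ / ‖y - x‖ ^ 3) := by
  have h0 : 0 < ‖y - x‖ := norm_pos_iff.2 (sub_ne_zero.2 h)
  have h1 := (hasDerivAt_inv (norm_pos_iff.2 (sub_ne_zero.2 h.symm)).ne').comp_hasFDerivAt y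
    (hasFDerivAt_norm_sub h)
  have h2 : fderiv ℝ (fun z => ‖x - z‖⁻¹) y = _ := h1.fderiv
  rw [normalDerivInv, normalDeriv, h2]
  simp only [norm_sub_rev x y, smul_apply, innerSL_apply_apply, smul_eq_mul]
  field_simp

theorem normalDerivLog_eq (Ω : Set E3) {x y : E3} (h : y ≠ x) :
    normalDerivLog Ω x y = ⟪y - x, externalNormal Ω y⟫ / ‖y - x‖ ^ 2 := by
  have h0 : 0 < ‖y - x‖ := norm_pos_iff.2 (sub_ne_zero.2 h)
  have h1 := (hasFDerivAt_norm_sub h).log (norm_pos_iff.2 (sub_ne_zero.2 h.symm)).ne'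
  rw [normalDerivLog, normalDeriv, h1.fderiv]
  simp only [norm_sub_rev x y, smul_apply, innerSL_apply_apply, smul_eq_mul]
  field_simp

theorem euclideanHausdorffMeasure_two_singleton (x : E3) : μHE[2] ({x} : Set E3) = 0 := by
  have := Measure.nullSingletonClass_hausdorff E3 (d := ((2 : ℕ) : ℝ)) (by norm_num)
  rw [Measure.euclideanHausdorffMeasure_def, Measure.smul_apply, measure_singleton, smul_zero]

/-! ### Charts and the gradient theorem. -/

/-- The parametrization of the graph of `g` in the coordinates `e`. -/
noncomputable def graphChart (e : E3 ≃ₗᵢ[ℝ] E3) (g : E2 → ℝ) (u : E2) : E3 := e.symm (graphMap g u)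

theorem continuous_graphChart (e : E3 ≃ₗᵢ[ℝ] E3) {g : E2 → ℝ} (hg : Continuous g) :
    Continuous (graphChart e g) := e.symm.continuous.comp (isClosedEmbedding_graphMap hg).continuous

theorem measurableEmbedding_graphChart (e : E3 ≃ₗᵢ[ℝ] E3) {g : E2 → ℝ} (hg : Continuous g) :
    MeasurableEmbedding (graphChart e g) :=
  e.symm.toHomeomorph.measurableEmbedding.comp (isClosedEmbedding_graphMap hg).measurableEmbedding

@[simp] theorem flat_graphChart (e : E3 ≃ₗᵢ[ℝ] E3) (g : E2 → ℝ) (u : E2) :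
    flat (e (graphChart e g u)) = u := by simp [graphChart, graphMap]

theorem graphHeight_graphChart (e : E3 ≃ₗᵢ[ℝ] E3) (g : E2 → ℝ) (u : E2) :
    graphHeight e g (graphChart e g u) = 0 := by simp [graphHeight, graphChart, graphMap]

theorem graphChart_flat {e : E3 ≃ₗᵢ[ℝ] E3} {g : E2 → ℝ} {y : E3} (h : graphHeight e g y = 0) :
    graphChart e g (flat (e y)) = y := by
  rw [graphChart, graphMap, ← sub_eq_zero.1 h, glue_flat, e.symm_apply_apply]

theorem integral_fderiv_eq_zero {E : Type*} [NormedAddCommGroup E] [NormedSpace ℝ E]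
    [MeasurableSpace E] [BorelSpace E] [FiniteDimensional ℝ E] {μ : Measure E}
    [μ.IsAddHaarMeasure] {f : E → ℝ} (hf : ContDiff ℝ 1 f) (hc : HasCompactSupport f) (v : E) :
    ∫ y, fderiv ℝ f y v ∂μ = 0 := by
  have hcont : Continuous fun y => fderiv ℝ f y v :=
    (hf.continuous_fderiv one_ne_zero).clm_apply continuous_const
  have hi : Integrable (fun y => fderiv ℝ f y v) μ :=
    hcont.integrable_of_hasCompactSupport (hc.fderiv_apply ℝ v)
  have := integral_mul_fderiv_eq_neg_fderiv_mul_of_integrable (μ := μ) (f := fun _ : E => (1 : ℝ))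
    (g := f) (v := v) (by simp) (by simpa using hi)
    (by simpa using hf.continuous.integrable_of_hasCompactSupport hc)
    (fun _ _ => by fun_prop) (fun x _ => hf.differentiable one_ne_zero x)
  simpa using this

/-- The homeomorphism flattening the graph of `g`. -/
noncomputable def shear (e : E3 ≃ₗᵢ[ℝ] E3) {g : E2 → ℝ} (hg : Continuous g) : (E2 × ℝ) ≃ₜ E3 :=
  Homeomorph.trans
    { toFun := fun q => (q.1, g q.1 + q.2)
      invFun := fun q => (q.1, q.2 - g q.1)
      left_inv := fun q => by simp
      right_inv := fun q => by simp
      continuous_toFun := by fun_prop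
      continuous_invFun := by fun_prop }
    (glue.toHomeomorph.trans e.symm.toHomeomorph)

theorem shear_apply (e : E3 ≃ₗᵢ[ℝ] E3) {g : E2 → ℝ} (hg : Continuous g) (q : E2 × ℝ) :
    shear e hg q = e.symm (glue (q.1, g q.1 + q.2)) := rfl

theorem shear_zero (e : E3 ≃ₗᵢ[ℝ] E3) {g : E2 → ℝ} (hg : Continuous g) (u : E2) :
    shear e hg (u, 0) = graphChart e g u := by simp [shear_apply, graphChart, graphMap]

theorem graphHeight_shear (e : E3 ≃ₗᵢ[ℝ] E3) {g : E2 → ℝ} (hg : Continuous g) (q : E2 × ℝ) :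
    graphHeight e g (shear e hg q) = q.2 := by simp [graphHeight, shear_apply]

theorem measurePreserving_shear (e : E3 ≃ₗᵢ[ℝ] E3) {g : E2 → ℝ} (hg : Continuous g) :
    MeasurePreserving (shear e hg) := by
  have h1 : MeasurePreserving (fun q : E2 × ℝ => (id q.1, g q.1 + q.2))
      (volume.prod volume) (volume.prod volume) := by
    refine (MeasurePreserving.id _).skew_product (g := fun u s => g u + s) (by fun_prop) ?_
    exact ae_of_all _ fun u => (measurePreserving_add_left volume (g u)).map_eq
  exact (e.symm.measurePreserving.comp measurePreserving_glue).comp h1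

/-- The shear flattens the graph, preserves volume and is C¹, so it moves the integral to the
half-space s < 0. There the derivative along v is a horizontal derivative plus β(u) times the
vertical one. The horizontal part integrates to zero on every horizontal plane, the vertical part
gives the boundary value, and β is exactly ⟨conormal, v⟩. -/
theorem setIntegral_graphHeight_neg (e : E3 ≃ₗᵢ[ℝ] E3) {g : E2 → ℝ} (hg : ContDiff ℝ 1 g)
    {f : E3 → ℝ} (hf : ContDiff ℝ 1 f) (hc : HasCompactSupport f) (v : E3) :
    ∫ y in {y | graphHeight e g y < 0}, fderiv ℝ f y v =
      ∫ u, f (graphChart e g u) * ⟪graphConormal e g (graphChart e g u), v⟫ := by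
  set T := shear e hg.continuous with hT
  have hTmp : MeasurePreserving T := measurePreserving_shear e hg.continuous
  have hpre : T ⁻¹' {y | graphHeight e g y < 0} = univ ×ˢ Iio 0 := by
    ext q
    simp [hT, graphHeight_shear]
  rw [← hTmp.setIntegral_preimage_emb T.measurableEmbedding, hpre]
  set F : E2 × ℝ → ℝ := fun q => f (T q) with hF
  have hgd : ∀ u, HasFDerivAt g (fderiv ℝ g u) u := fun u =>
    (hg.differentiable one_ne_zero u).hasFDerivAt
  have hTc : ContDiff ℝ 1 T := by
    have h1 : ContDiff ℝ 1 fun q : E2 × ℝ => (q.1, g q.1 + q.2) :=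
      contDiff_fst.prodMk ((hg.comp contDiff_fst).add contDiff_snd)
    exact e.symm.contDiff.comp (glue.contDiff.comp h1)
  have hTd : ∀ (q w : E2 × ℝ), fderiv ℝ T q w =
      e.symm (glue (w.1, fderiv ℝ g q.1 w.1 + w.2)) := by
    intro q w
    have h1 : HasFDerivAt (fun q : E2 × ℝ => (q.1, g q.1 + q.2))
        ((ContinuousLinearMap.fst ℝ E2 ℝ).prod
          ((fderiv ℝ g q.1).comp (ContinuousLinearMap.fst ℝ E2 ℝ) +
            ContinuousLinearMap.snd ℝ E2 ℝ)) q :=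
      hasFDerivAt_fst.prodMk (((hgd q.1).comp q hasFDerivAt_fst).add hasFDerivAt_snd)
    have h2 := ((e.symm.toContinuousLinearEquiv : E3 →L[ℝ] E3).hasFDerivAt.comp q
      ((glue : (E2 × ℝ) →L[ℝ] E3).hasFDerivAt.comp q h1))
    have h3 : fderiv ℝ T q = _ := h2.fderiv
    rw [h3]
    rfl
  have hFc : ContDiff ℝ 1 F := hf.comp hTc
  have hFs : HasCompactSupport F := hc.comp_homeomorph T
  have hFd : ∀ (q w : E2 × ℝ), fderiv ℝ F q w =
      fderiv ℝ f (T q) (e.symm (glue (w.1, fderiv ℝ g q.1 w.1 + w.2))) := by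
    intro q w
    have : fderiv ℝ F q = (fderiv ℝ f (T q)).comp (fderiv ℝ T q) :=
      fderiv_comp q (hf.differentiable one_ne_zero _) (hTc.differentiable one_ne_zero _)
    rw [this, ContinuousLinearMap.comp_apply, hTd]
  set a := flat (e v) with ha
  set β : E2 → ℝ := fun u => (e v) 2 - fderiv ℝ g u a with hβ
  have hβc : Continuous β :=
    continuous_const.sub ((hg.continuous_fderiv one_ne_zero).clm_apply continuous_const)
  -- β is only continuous, but it does not depend on the height, so it leaves the vertical integral
  -- and is never differentiated.
  have hsplit : ∀ q : E2 × ℝ, fderiv ℝ f (T q) v =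
      fderiv ℝ F q (a, 0) + β q.1 * fderiv ℝ F q (0, 1) := by
    intro q
    have h1 : v = e.symm (glue (a, fderiv ℝ g q.1 a + β q.1)) := by
      rw [hβ, add_sub_cancel, ha, glue_flat, e.symm_apply_apply]
    have h2 : fderiv ℝ F q (a, β q.1) = fderiv ℝ f (T q) v := by
      rw [hFd]; exact congrArg _ h1.symm
    rw [← h2, ← smul_eq_mul, ← map_smul, ← map_add]
    congr 1
    simp
  have hc1 : ∀ w, Continuous fun q => fderiv ℝ F q w := fun w =>
    (hFc.continuous_fderiv one_ne_zero).clm_apply continuous_const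
  have hi1 : Integrable (fun q => fderiv ℝ F q (a, 0)) :=
    (hc1 _).integrable_of_hasCompactSupport (hFs.fderiv_apply ℝ _)
  have hi2 : Integrable (fun q => β q.1 * fderiv ℝ F q (0, 1)) :=
    ((hβc.comp continuous_fst).mul (hc1 _)).integrable_of_hasCompactSupport
      (hFs.fderiv_apply ℝ _).mul_left
  have hemb1 : ∀ s : ℝ, IsClosedEmbedding fun u : E2 => (u, s) := fun s =>
    IsClosedEmbedding.of_continuous_injective_isClosedMap (by fun_prop)
      (fun a b h => congrArg Prod.fst h) (fun A hA => by
        have : (fun u : E2 => (u, s)) '' A = A ×ˢ {s} := by ext ⟨u, t⟩; simp [eq_comm]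
        rw [this]; exact hA.prod isClosed_singleton)
  have hemb2 : ∀ u : E2, IsClosedEmbedding fun s : ℝ => (u, s) := fun u =>
    IsClosedEmbedding.of_continuous_injective_isClosedMap (by fun_prop)
      (fun a b h => congrArg Prod.snd h) (fun A hA => by
        have : (fun s : ℝ => (u, s)) '' A = {u} ×ˢ A := by ext ⟨u, t⟩; simp [eq_comm, and_comm]
        rw [this]; exact isClosed_singleton.prod hA)
  simp_rw [hsplit]
  rw [integral_add hi1.integrableOn hi2.integrableOn]
  have hz1 : ∫ q in univ ×ˢ Iio (0 : ℝ), fderiv ℝ F q (a, 0) = 0 := by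
    rw [Measure.volume_eq_prod, ← Measure.prod_restrict, Measure.restrict_univ,
      integral_prod_symm]
    · have : ∀ s : ℝ, ∫ u : E2, fderiv ℝ F (u, s) (a, 0) = 0 := by
        intro s
        have h1 : ContDiff ℝ 1 fun u : E2 => F (u, s) := hFc.comp (contDiff_prodMk_left s)
        have h2 : HasCompactSupport fun u : E2 => F (u, s) :=
          hFs.comp_isClosedEmbedding (hemb1 s)
        refine Eq.trans ?_ (integral_fderiv_eq_zero (μ := (volume : Measure E2)) h1 h2 a)
        refine integral_congr_ae (ae_of_all _ fun u => ?_)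
        have h3 := ((hFc.differentiable one_ne_zero (u, s)).hasFDerivAt.comp u
          (hasFDerivAt_prodMk_left (𝕜 := ℝ) u s)).fderiv
        have h4 : fderiv ℝ (fun u : E2 => F (u, s)) u = _ := h3
        simp only [h4]
        rfl
      simp [this]
    · rw [← Measure.restrict_univ (μ := (volume : Measure E2)), Measure.prod_restrict]
      exact hi1.integrableOn
  have hz2 : ∫ q in univ ×ˢ Iio (0 : ℝ), β q.1 * fderiv ℝ F q (0, 1) =
      ∫ u, β u * F (u, 0) := by
    rw [Measure.volume_eq_prod, ← Measure.prod_restrict, Measure.restrict_univ,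
      integral_prod]
    · refine integral_congr_ae (ae_of_all _ fun u => ?_)
      simp only
      rw [integral_const_mul]
      congr 1
      have h1 : ContDiff ℝ 1 fun s : ℝ => F (u, s) := hFc.comp (contDiff_prodMk_right u)
      have h2 : HasCompactSupport fun s : ℝ => F (u, s) :=
        hFs.comp_isClosedEmbedding (hemb2 u)
      rw [← h2.integral_Iic_deriv_eq h1 0, integral_Iic_eq_integral_Iio]
      refine integral_congr_ae (ae_of_all _ fun s => ?_)
      have h3 := ((hFc.differentiable one_ne_zero (u, s)).hasFDerivAt.comp s
          (hasFDerivAt_prodMk_right u s)).hasDerivAt.deriv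
      have h4 : deriv (fun s : ℝ => F (u, s)) s = _ := h3
      simp only
      rw [h4]
      simp
    · rw [← Measure.restrict_univ (μ := (volume : Measure E2)), Measure.prod_restrict]
      exact hi2.integrableOn
  rw [hz1, hz2, zero_add]
  refine integral_congr_ae (ae_of_all _ fun u => ?_)
  simp only
  rw [inner_graphConormal, flat_graphChart, hF]
  simp only [hT, shear_zero]
  ring

namespace IsLocalSubgraph

variable {Ω : Set E3} {p : E3} {e : E3 ≃ₗᵢ[ℝ] E3} {g : E2 → ℝ} {ε : ℝ}

theorem frontier_inter_ball (h : IsLocalSubgraph Ω p e g ε) :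
    frontier Ω ∩ ball p ε = graphChart e g '' (graphChart e g ⁻¹' ball p ε) := by
  ext y
  constructor
  · rintro ⟨hy, hb⟩
    have h0 := graphChart_flat ((h.mem_frontier_iff hb).1 hy)
    exact ⟨flat (e y), by rwa [mem_preimage, h0], h0⟩
  · rintro ⟨u, hu, rfl⟩
    exact ⟨(h.mem_frontier_iff hu).2 (graphHeight_graphChart e g u), hu⟩

theorem restrict_frontier_inter_ball (h : IsLocalSubgraph Ω p e g ε) :
    μHE[2].restrict (frontier Ω ∩ ball p ε) = Measure.map (graphChart e g)
      ((volume.restrict (graphChart e g ⁻¹' ball p ε)).withDensity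
        fun u => ENNReal.ofReal (graphJacobian g u)) := by
  have hg := h.contDiff.continuous
  have hopen : IsOpen (graphChart e g ⁻¹' ball p ε) :=
    isOpen_ball.preimage (continuous_graphChart e hg)
  have hmp : MeasurePreserving e.symm (μHE[2] : Measure E3) μHE[2] :=
    e.symm.toIsometryEquiv.measurePreserving_euclideanHausdorffMeasure 2
  have hemb : MeasurableEmbedding e.symm := e.symm.toHomeomorph.measurableEmbedding
  have h1 : (graphChart e g '' (graphChart e g ⁻¹' ball p ε)) =
      e.symm '' (graphMap g '' (graphChart e g ⁻¹' ball p ε)) := by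
    rw [image_image]; rfl
  rw [h.frontier_inter_ball, h1, ← (hmp.restrict_image_emb hemb _).map_eq,
    restrict_image_graphMap hg hopen h.contDiff.contDiffOn,
    Measure.map_map e.symm.continuous.measurable (isClosedEmbedding_graphMap hg).continuous.measurable]
  rfl

theorem setIntegral_frontier_inter_ball (h : IsLocalSubgraph Ω p e g ε) (F : E3 → ℝ) :
    ∫ y in frontier Ω ∩ ball p ε, F y ∂μHE[2] =
      ∫ u in graphChart e g ⁻¹' ball p ε, graphJacobian g u * F (graphChart e g u) := by
  rw [h.restrict_frontier_inter_ball,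
    (measurableEmbedding_graphChart e h.contDiff.continuous).integral_map,
    integral_withDensity_eq_integral_toReal_smul (measurable_graphJacobian g).ennreal_ofReal
      (ae_of_all _ fun _ => ENNReal.ofReal_lt_top)]
  refine integral_congr_ae (ae_of_all _ fun u => ?_)
  simp only [smul_eq_mul]
  rw [ENNReal.toReal_ofReal (graphJacobian_pos g u).le]

theorem integrableOn_frontier_inter_ball (h : IsLocalSubgraph Ω p e g ε) (F : E3 → ℝ) :
    IntegrableOn F (frontier Ω ∩ ball p ε) μHE[2] ↔
      IntegrableOn (fun u => graphJacobian g u * F (graphChart e g u))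
        (graphChart e g ⁻¹' ball p ε) := by
  rw [IntegrableOn, h.restrict_frontier_inter_ball,
    (measurableEmbedding_graphChart e h.contDiff.continuous).integrable_map_iff,
    integrable_withDensity_iff_integrable_smul' (measurable_graphJacobian g).ennreal_ofReal
      (ae_of_all _ fun _ => ENNReal.ofReal_lt_top), IntegrableOn]
  refine integrable_congr (ae_of_all _ fun u => ?_)
  simp only [smul_eq_mul, Function.comp]
  rw [ENNReal.toReal_ofReal (graphJacobian_pos g u).le]

theorem integral_fderiv (h : IsLocalSubgraph Ω p e g ε) {f : E3 → ℝ} (hf : ContDiff ℝ 1 f)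
    (hc : HasCompactSupport f) (hs : tsupport f ⊆ ball p ε) (v : E3) :
    ∫ y in Ω, fderiv ℝ f y v =
      ∫ y in frontier Ω, f y * ⟪externalNormal Ω y, v⟫ ∂μHE[2] := by
  have hzero : ∀ y, y ∉ ball p ε → f y = 0 := fun y hy =>
    image_eq_zero_of_notMem_tsupport fun h => hy (hs h)
  have hdzero : ∀ y, y ∉ ball p ε → fderiv ℝ f y v = 0 := fun y hy => by
    have : y ∉ tsupport (fderiv ℝ f) := fun h => hy (hs (tsupport_fderiv_subset ℝ h))
    rw [image_eq_zero_of_notMem_tsupport this, zero_apply]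
  have h1 : ∫ y in Ω, fderiv ℝ f y v =
      ∫ y in {y | graphHeight e g y < 0}, fderiv ℝ f y v := by
    rw [← integral_indicator h.isOpen.measurableSet, ← integral_indicator
      (isOpen_lt (continuous_graphHeight h.contDiff.continuous) continuous_const).measurableSet]
    refine integral_congr_ae (ae_of_all _ fun y => ?_)
    by_cases hy : y ∈ ball p ε
    · by_cases hyΩ : y ∈ Ω
      · rw [indicator_of_mem hyΩ, indicator_of_mem
          (show y ∈ {y | graphHeight e g y < 0} from (h.mem_iff_graphHeight hy).1 hyΩ)]
      · rw [indicator_of_notMem hyΩ, indicator_of_notMem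
          (show y ∉ {y | graphHeight e g y < 0} from fun hn =>
            hyΩ ((h.mem_iff_graphHeight hy).2 hn))]
    · simp [indicator, hdzero y hy]
  have h2 : ∫ y in frontier Ω, f y * ⟪externalNormal Ω y, v⟫ ∂μHE[2] =
      ∫ y in frontier Ω ∩ ball p ε, f y * ⟪externalNormal Ω y, v⟫ ∂μHE[2] := by
    refine setIntegral_eq_of_subset_of_forall_sdiff_eq_zero
      (isClosed_frontier (s := Ω)).measurableSet inter_subset_left ?_
    rintro y ⟨hy, hyn⟩
    rw [hzero y fun hb => hyn ⟨hy, hb⟩, zero_mul]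
  rw [h1, setIntegral_graphHeight_neg e h.contDiff hf hc, h2, h.setIntegral_frontier_inter_ball,
    ← integral_indicator (measurableSet_ball.preimage
      (continuous_graphChart e h.contDiff.continuous).measurable)]
  refine integral_congr_ae (ae_of_all _ fun u => ?_)
  by_cases hu : graphChart e g u ∈ ball p ε
  · rw [indicator_of_mem (show u ∈ graphChart e g ⁻¹' ball p ε from hu),
      h.externalNormal_eq hu ((h.mem_frontier_iff hu).2 (graphHeight_graphChart e g u)),
      graphNormal, inner_smul_left, flat_graphChart]
    have := (graphJacobian_pos g u).ne'
    simp only [conj_trivial]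
    field_simp
  · rw [indicator_of_notMem (show u ∉ graphChart e g ⁻¹' ball p ε from hu)]
    simp [hzero _ hu]

end IsLocalSubgraph

namespace IsLyapunovDomain

variable {Ω : Set E3}

/-- By compactness only local finiteness matters. In a chart the projection does not increase
distances, so the parameter domain is bounded and the continuous Jacobian is integrable on it. -/
theorem euclideanHausdorffMeasure_frontier_lt_top (hΩ : IsLyapunovDomain Ω) :
    μHE[2] (frontier Ω) < ⊤ := by
  refine hΩ.isCompact_frontier.measure_lt_top_of_nhdsWithin fun p hp => ?_
  obtain ⟨e, g, C, α, ε, -, -, hε, h⟩ := hΩ.exists_isLocalSubgraph hp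
  refine ⟨frontier Ω ∩ ball p ε, inter_mem self_mem_nhdsWithin
    (nhdsWithin_le_nhds (ball_mem_nhds p hε)), ?_⟩
  have hint : IntegrableOn (fun _ => (1 : ℝ)) (frontier Ω ∩ ball p ε) μHE[2] := by
    rw [h.integrableOn_frontier_inter_ball]
    simp only [mul_one]
    refine ((continuous_graphJacobian h.contDiff).continuousOn.integrableOn_compact
      (isCompact_closedBall (flat (e p)) ε)).mono_set ?_
    · intro u hu
      have h1 : ‖flat (e (graphChart e g u - p))‖ ≤ ε := by
        refine (norm_flat_le _).trans ?_
        rw [mem_preimage, mem_ball, dist_eq_norm] at hu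
        rw [e.norm_map]
        exact hu.le
      have h2 : flat (e (graphChart e g u - p)) = u - flat (e p) := by
        rw [e.map_sub, map_sub, flat_graphChart]
      rw [h2] at h1
      exact mem_closedBall_iff_norm.2 h1
  rw [integrableOn_const_iff (by simp)] at hint
  simpa using hint

/-- **Gradient theorem** on Lyapunov domains. -/
theorem integral_fderiv (hΩ : IsLyapunovDomain Ω) {f : E3 → ℝ} (hf : ContDiff ℝ 1 f)
    (hc : HasCompactSupport f) (v : E3) :
    ∫ y in Ω, fderiv ℝ f y v =
      ∫ y in frontier Ω, f y * ⟪externalNormal Ω y, v⟫ ∂μHE[2] := by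
  have hex : ∀ p : frontier Ω, ∃ (e : E3 ≃ₗᵢ[ℝ] E3) (g : E2 → ℝ) (ε : ℝ), 0 < ε ∧
      IsLocalSubgraph Ω p e g ε := fun p => by
    obtain ⟨e, g, C, α, ε, -, -, hε, h⟩ := hΩ.exists_isLocalSubgraph p.2
    exact ⟨e, g, ε, hε, h⟩
  choose e g ε hε hloc using hex
  obtain ⟨t, ht⟩ := hΩ.isCompact_frontier.elim_finite_subcover (fun p : frontier Ω => ball p.1 (ε p))
    (fun p => isOpen_ball) fun y hy => mem_iUnion.2 ⟨⟨y, hy⟩, mem_ball_self (hε _)⟩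
  -- The index `none` stands for Ω itself, the others for finitely many coordinate balls covering
  -- the boundary.
  set U : Option t → Set E3 := fun i => i.elim Ω fun p => ball p.1.1 (ε p.1) with hU
  have hUo : ∀ i, IsOpen (U i) := by
    rintro (_ | p)
    · exact hΩ.isOpen
    · exact isOpen_ball
  have hcov : closure Ω ⊆ ⋃ i, U i := by
    intro y hy
    by_cases hyΩ : y ∈ Ω
    · exact mem_iUnion.2 ⟨none, hyΩ⟩
    · have hyS : y ∈ frontier Ω := ⟨hy, fun h => hyΩ (interior_subset h)⟩
      obtain ⟨p, hp, hyp⟩ := mem_iUnion₂.1 (ht hyS)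
      exact mem_iUnion.2 ⟨some ⟨p, hp⟩, hyp⟩
  obtain ⟨ρ, hρ⟩ := SmoothPartitionOfUnity.exists_isSubordinate (modelWithCornersSelf ℝ E3)
    isClosed_closure U hUo hcov
  have hρc : ∀ i, ContDiff ℝ 1 (ρ i) := fun i =>
    ((ρ i).contMDiff.contDiff).of_le (by exact_mod_cast le_top)
  have hρ1 : ∀ y ∈ closure Ω, ∑ i, ρ i y = 1 := fun y hy => by
    rw [← finsum_eq_sum_of_fintype]
    exact ρ.sum_eq_one hy
  have hfc : ∀ i, ContDiff ℝ 1 fun y => ρ i y * f y := fun i => (hρc i).mul hf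
  have hfs : ∀ i, HasCompactSupport fun y => ρ i y * f y := fun i => hc.mul_left
  have hft : ∀ i, tsupport (fun y => ρ i y * f y) ⊆ U i := fun i =>
    (tsupport_mul_subset_left).trans (hρ i)
  have hpiece : ∀ i, ∫ y in Ω, fderiv ℝ (fun y => ρ i y * f y) y v =
      ∫ y in frontier Ω, (ρ i y * f y) * ⟪externalNormal Ω y, v⟫ ∂μHE[2] := by
    rintro (_ | p)
    -- The interior piece contributes zero on both sides: it vanishes on the boundary, and its
    -- derivative has integral zero over all of space.
    · have hsub : tsupport (fun y => ρ none y * f y) ⊆ Ω := hft none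
      have h1 : ∫ y in Ω, fderiv ℝ (fun y => ρ none y * f y) y v = 0 := by
        rw [← integral_fderiv_eq_zero (μ := (volume : Measure E3)) (hfc none) (hfs none) v]
        refine setIntegral_eq_integral_of_forall_compl_eq_zero fun y hy => ?_
        have : y ∉ tsupport (fderiv ℝ fun y => ρ none y * f y) := fun h =>
          hy (hsub (tsupport_fderiv_subset ℝ h))
        rw [image_eq_zero_of_notMem_tsupport this, zero_apply]
      rw [h1, eq_comm]
      refine setIntegral_eq_zero_of_forall_eq_zero fun y hy => ?_
      have hyΩ : y ∉ Ω := by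
        rw [hΩ.isOpen.frontier_eq] at hy
        exact hy.2
      have : ρ none y * f y = 0 :=
        image_eq_zero_of_notMem_tsupport (f := fun y => ρ none y * f y) fun h => hyΩ (hsub h)
      rw [this, zero_mul]
    · exact (hloc p.1).integral_fderiv (hfc _) (hfs _) (hft (some p)) v
  have hcontd : ∀ i, Continuous fun y => fderiv ℝ (fun y => ρ i y * f y) y v := fun i =>
    ((hfc i).continuous_fderiv one_ne_zero).clm_apply continuous_const
  have hL : ∫ y in Ω, fderiv ℝ f y v = ∑ i, ∫ y in Ω, fderiv ℝ (fun y => ρ i y * f y) y v := by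
    rw [← integral_finsetSum]
    · refine setIntegral_congr_fun hΩ.isOpen.measurableSet fun y hy => ?_
      have h1 : f =ᶠ[𝓝 y] fun y => ∑ i, ρ i y * f y := by
        filter_upwards [hΩ.isOpen.mem_nhds hy] with z hz
        rw [← Finset.sum_mul, hρ1 z (subset_closure hz), one_mul]
      rw [h1.fderiv_eq, fderiv_fun_sum fun i _ => (hfc i).differentiable one_ne_zero y,
        sum_apply]
    · intro i _
      exact ((hcontd i).integrable_of_hasCompactSupport ((hfs i).fderiv_apply ℝ v)).integrableOn
  have hR : ∫ y in frontier Ω, f y * ⟪externalNormal Ω y, v⟫ ∂μHE[2] =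
      ∑ i, ∫ y in frontier Ω, (ρ i y * f y) * ⟪externalNormal Ω y, v⟫ ∂μHE[2] := by
    rw [← integral_finsetSum]
    · refine setIntegral_congr_fun isClosed_frontier.measurableSet fun y hy => ?_
      rw [← Finset.sum_mul, ← Finset.sum_mul, hρ1 y (frontier_subset_closure hy), one_mul]
    · intro i _
      refine ContinuousOn.integrableOn_of_subset_isCompact ?_ hΩ.isCompact_frontier
        (isClosed_frontier (s := Ω)).measurableSet subset_rfl
        hΩ.euclideanHausdorffMeasure_frontier_lt_top.ne
      exact (hfc i).continuous.continuousOn.mul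
        (hΩ.continuousOn_externalNormal.inner continuousOn_const)
  rw [hL, hR]
  exact Finset.sum_congr rfl fun i _ => hpiece i

end IsLyapunovDomain

/-! ### Integrability of the kernel on a Lyapunov surface. -/

/-- The kernel of the double layer potential. -/
noncomputable def gaussKernel (Ω : Set E3) (x y : E3) : ℝ :=
  ⟪y - x, externalNormal Ω y⟫ / ‖y - x‖ ^ 3

theorem integrableOn_rpow_norm_sub {α : ℝ} (hα : 0 < α) (u₀ : E2) (ε : ℝ) :
    IntegrableOn (fun u : E2 => ‖u - u₀‖ ^ (α - 2)) (ball u₀ ε) := by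
  have h1 : IntegrableOn (fun u : E2 => ‖u‖ ^ (α - 2)) (ball 0 ε) := by
    rw [integrableOn_fun_norm_addHaar (volume : Measure E2) (f := fun s => s ^ (α - 2))]
    rcases le_or_gt ε 0 with hε | hε
    · rw [Ioo_eq_empty (by simpa using hε)]
      exact integrableOn_empty
    have h2 : IntegrableOn (fun s : ℝ => s ^ (α - 1)) (Ioo 0 ε) :=
      (intervalIntegral.integrableOn_Ioo_rpow_iff hε).2 (by linarith)
    refine h2.congr_fun (fun s hs => ?_) measurableSet_Ioo
    simp only [finrank_euclideanSpace, Fintype.card_fin, smul_eq_mul]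
    rw [show α - 1 = 1 + (α - 2) by ring, Real.rpow_add hs.1, Real.rpow_one]
    simp
  rw [← integrable_indicator_iff measurableSet_ball] at h1 ⊢
  refine (h1.comp_sub_right u₀).congr (ae_of_all _ fun u => ?_)
  simp only [indicator, mem_ball_iff_norm, sub_zero]

theorem HolderWith.norm_sub_sub_fderiv_le {E : Type*} [NormedAddCommGroup E] [NormedSpace ℝ E]
    {g : E → ℝ} {C α : ℝ≥0} (hg : Differentiable ℝ g) (hH : HolderWith C α (fderiv ℝ g))
    (u w : E) : |g w - g u - fderiv ℝ g u (w - u)| ≤ C * ‖w - u‖ ^ (α : ℝ) * ‖w - u‖ := by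
  refine (convex_segment u w).norm_image_sub_le_of_norm_fderiv_le' (𝕜 := ℝ) (fun z _ => hg z)
    (fun z hz => ?_) (left_mem_segment ℝ u w) (right_mem_segment ℝ u w)
  rw [← dist_eq_norm]
  refine (hH.dist_le z u).trans ?_
  have h1 : dist z u ≤ ‖w - u‖ := by
    rw [segment_eq_image'] at hz
    obtain ⟨s, hs, rfl⟩ := hz
    rw [dist_eq_norm, add_sub_cancel_left, norm_smul, Real.norm_of_nonneg hs.1]
    exact mul_le_of_le_one_left (norm_nonneg _) hs.2
  gcongr

namespace IsLocalSubgraph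

variable {Ω : Set E3} {x : E3} {e : E3 ≃ₗᵢ[ℝ] E3} {g : E2 → ℝ} {ε : ℝ}

/-- In the chart, kernel times surface element is ⟨conormal, y - x⟩ / |y - x|³. The numerator is a
Taylor remainder of g, at most C |u - u₀|^(1 + α) by the Hölder condition, while |y - x| ≥ |u - u₀|.
The resulting bound C |u - u₀|^(α - 2) is integrable in the plane because α > 0. -/
theorem integrableOn_gaussKernel (h : IsLocalSubgraph Ω x e g ε) (hx : x ∈ frontier Ω)
    {C α : ℝ≥0} (hα : 0 < α) (hH : HolderWith C α (fderiv ℝ g)) (hε : 0 < ε) :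
    IntegrableOn (gaussKernel Ω x) (frontier Ω ∩ ball x ε) μHE[2] := by
  rw [h.integrableOn_frontier_inter_ball]
  have hg := h.contDiff
  have hcont := continuous_graphChart e hg.continuous
  set u₀ := flat (e x) with hu₀
  have hx0 : graphChart e g u₀ = x :=
    graphChart_flat ((h.mem_frontier_iff (mem_ball_self hε)).1 hx)
  have hmeas : MeasurableSet (graphChart e g ⁻¹' ball x ε) :=
    measurableSet_ball.preimage hcont.measurable
  have hnormal : ∀ u ∈ graphChart e g ⁻¹' ball x ε,
      graphJacobian g u * gaussKernel Ω x (graphChart e g u) =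
      ⟪graphConormal e g (graphChart e g u), graphChart e g u - x⟫ / ‖graphChart e g u - x‖ ^ 3 := by
    intro u hu
    have hJ := (graphJacobian_pos g u).ne'
    rw [gaussKernel, h.externalNormal_eq hu
      ((h.mem_frontier_iff hu).2 (graphHeight_graphChart e g u)), graphNormal, inner_smul_right,
      flat_graphChart, real_inner_comm]
    field_simp
  have hle : ∀ u, ‖u - u₀‖ ≤ ‖graphChart e g u - x‖ := by
    intro u
    have : u - u₀ = flat (e (graphChart e g u - x)) := by
      rw [e.map_sub, map_sub, flat_graphChart]
    rw [this]
    exact (norm_flat_le _).trans (e.norm_map _).le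
  have hsub : graphChart e g ⁻¹' ball x ε ⊆ ball u₀ ε := by
    intro u hu
    rw [mem_preimage, mem_ball_iff_norm] at hu
    exact mem_ball_iff_norm.2 ((hle u).trans_lt hu)
  refine Integrable.mono' (((integrableOn_rpow_norm_sub (α := α) hα u₀ ε).mono_set hsub).const_mul
    (C : ℝ)) ?_ ?_
  · have h1 : Measurable fun u =>
        ⟪graphConormal e g (graphChart e g u), graphChart e g u - x⟫ /
          ‖graphChart e g u - x‖ ^ 3 := by
      have h2 := continuous_graphConormal (e := e) hg
      refine Measurable.div (Continuous.measurable ?_) (Continuous.measurable ?_)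
      · exact (h2.comp hcont).inner (hcont.sub continuous_const)
      · fun_prop
    refine h1.aestronglyMeasurable.congr ?_
    filter_upwards [ae_restrict_mem hmeas] with u hu
    exact (hnormal u hu).symm
  · filter_upwards [ae_restrict_mem hmeas] with u hu
    rw [hnormal u hu, inner_graphConormal, flat_graphChart]
    -- At u₀ the quotient is 0 by the convention for division by zero.
    rcases eq_or_ne u u₀ with rfl | hne
    · rw [hx0]
      simp
      positivity
    have hpos : 0 < ‖u - u₀‖ := norm_pos_iff.2 (sub_ne_zero.2 hne)
    have h1 : e (graphChart e g u - x) 2 - fderiv ℝ g u (flat (e (graphChart e g u - x))) =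
        -(g u₀ - g u - fderiv ℝ g u (u₀ - u)) := by
      have h2 : flat (e (graphChart e g u - x)) = u - u₀ := by
        rw [e.map_sub, map_sub, flat_graphChart]
      have h3 : e (graphChart e g u - x) 2 = g u - g u₀ := by
        conv_lhs => rw [← hx0]
        simp [graphChart, graphMap]
      rw [h2, h3, ← neg_sub u₀ u, map_neg]
      ring
    have h4 := hH.norm_sub_sub_fderiv_le (hg.differentiable one_ne_zero) u u₀
    rw [norm_sub_rev] at h4
    have h5 : ‖u - u₀‖ ^ ((α : ℝ) - 2) = ‖u - u₀‖ ^ (α : ℝ) * ‖u - u₀‖ / ‖u - u₀‖ ^ 3 := by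
      rw [Real.rpow_sub hpos]
      have : ‖u - u₀‖ ^ (2 : ℝ) = ‖u - u₀‖ ^ 2 := by exact_mod_cast Real.rpow_natCast _ 2
      rw [this]
      field_simp
    rw [h1, h5, Real.norm_eq_abs, abs_div, abs_neg, abs_of_nonneg (pow_nonneg (norm_nonneg _) 3),
      ← mul_div_assoc]
    have h6 := hle u
    refine div_le_div₀ (by positivity) ?_ (by positivity) (by gcongr)
    rw [← mul_assoc]
    exact h4

end IsLocalSubgraph

/-- A point has no area, so the default values that the normal derivatives take at y = x are
harmless. -/
theorem ae_restrict_frontier_ne (Ω : Set E3) (x : E3) : ∀ᵐ y ∂(μHE[2].restrict (frontier Ω)), y ≠ x :=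
  ae_restrict_of_ae (by
    rw [ae_iff]
    simpa using euclideanHausdorffMeasure_two_singleton x)

theorem normalDerivInv_ae_eq (Ω : Set E3) (x : E3) :
    normalDerivInv Ω x =ᵐ[μHE[2].restrict (frontier Ω)] fun y => -gaussKernel Ω x y := by
  filter_upwards [ae_restrict_frontier_ne Ω x] with y hy
  exact normalDerivInv_eq Ω hy

theorem normalDerivLog_ae_eq (Ω : Set E3) (x : E3) :
    normalDerivLog Ω x =ᵐ[μHE[2].restrict (frontier Ω)] fun y => ‖y - x‖ * gaussKernel Ω x y := by
  filter_upwards [ae_restrict_frontier_ne Ω x] with y hy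
  have : 0 < ‖y - x‖ := norm_pos_iff.2 (sub_ne_zero.2 hy)
  rw [normalDerivLog_eq Ω hy, gaussKernel]
  field_simp

namespace IsLyapunovDomain

variable {Ω : Set E3}

theorem continuousOn_gaussKernel (hΩ : IsLyapunovDomain Ω) (x : E3) :
    ContinuousOn (gaussKernel Ω x) (frontier Ω \ {x}) := by
  refine ContinuousOn.div ?_ (by fun_prop) ?_
  · exact ContinuousOn.inner (by fun_prop) (hΩ.continuousOn_externalNormal.mono sdiff_subset)
  · intro y hy
    exact pow_ne_zero 3 (norm_ne_zero_iff.2 (sub_ne_zero.2 hy.2))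

theorem integrableOn_gaussKernel (hΩ : IsLyapunovDomain Ω) (x : E3) :
    IntegrableOn (gaussKernel Ω x) (frontier Ω) μHE[2] := by
  have hfar : ∀ U : Set E3, IsOpen U → (x ∈ frontier Ω → x ∈ U) →
      IntegrableOn (gaussKernel Ω x) (frontier Ω \ U) μHE[2] := by
    intro U hU hxU
    have hcomp : IsCompact (frontier Ω \ U) := hΩ.isCompact_frontier.diff hU
    refine ((hΩ.continuousOn_gaussKernel x).mono ?_).integrableOn_of_subset_isCompact hcomp
      hcomp.measurableSet subset_rfl
      ((measure_mono sdiff_subset).trans_lt hΩ.euclideanHausdorffMeasure_frontier_lt_top).ne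
    rintro y ⟨hy, hyU⟩
    refine ⟨hy, ?_⟩
    rintro rfl
    exact hyU (hxU hy)
  by_cases hx : x ∈ frontier Ω
  · obtain ⟨e, g, C, α, ε, hα, hH, hε, h⟩ := hΩ.exists_isLocalSubgraph hx
    rw [← inter_union_sdiff (frontier Ω) (ball x ε)]
    exact (h.integrableOn_gaussKernel hx hα hH hε).union
      (hfar _ isOpen_ball fun _ => mem_ball_self hε)
  · simpa using hfar ∅ isOpen_empty fun h => absurd h hx

theorem integrableOn_norm_mul_gaussKernel (hΩ : IsLyapunovDomain Ω) (x : E3) :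
    IntegrableOn (fun y => ‖y - x‖ * gaussKernel Ω x y) (frontier Ω) μHE[2] := by
  obtain ⟨D, hD⟩ := hΩ.isCompact_frontier.exists_bound_of_continuousOn
    (f := fun y => ‖y - x‖) (by fun_prop)
  refine Integrable.bdd_mul (c := D) (hΩ.integrableOn_gaussKernel x)
    (Continuous.aestronglyMeasurable (by fun_prop)) ?_
  filter_upwards [ae_restrict_mem (isClosed_frontier (s := Ω)).measurableSet] with y hy
  exact hD y hy

theorem integrableOn_normalDerivInv (hΩ : IsLyapunovDomain Ω) (x : E3) :
    IntegrableOn (normalDerivInv Ω x) (frontier Ω) μHE[2] :=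
  (hΩ.integrableOn_gaussKernel x).neg.congr (normalDerivInv_ae_eq Ω x).symm

theorem integrableOn_normalDerivLog (hΩ : IsLyapunovDomain Ω) (x : E3) :
    IntegrableOn (normalDerivLog Ω x) (frontier Ω) μHE[2] :=
  (hΩ.integrableOn_norm_mul_gaussKernel x).congr (normalDerivLog_ae_eq Ω x).symm

theorem volume_frontier (hΩ : IsLyapunovDomain Ω) : volume (frontier Ω) = 0 := by
  rw [← EuclideanSpace.euclideanHausdorffMeasure_eq_volume]
  exact (Measure.euclideanHausdorffMeasure_zero_or_top (by norm_num) (frontier Ω)).resolve_right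
    hΩ.euclideanHausdorffMeasure_frontier_lt_top.ne

end IsLyapunovDomain

/-! ### Radial test fields and their divergence. -/

/-- **Du Bois-Reymond lemma** on the half-line. -/
theorem exists_ae_eq_const_of_integral_deriv_mul_eq_zero {P : ℝ → ℝ}
    (hP : LocallyIntegrable P)
    (h : ∀ ξ : ℝ → ℝ, ContDiff ℝ ∞ ξ → HasCompactSupport ξ → tsupport ξ ⊆ Ioi 0 →
      ∫ R, deriv ξ R * P R = 0) :
    ∃ C, ∀ᵐ R : ℝ, R ∈ Ioi 0 → P R = C := by
  let bump : ContDiffBump (2 : ℝ) := ⟨1 / 2, 1, by norm_num, by norm_num⟩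
  set ρ : ℝ → ℝ := bump.normed volume with hρ
  have hρc : ContDiff ℝ ∞ ρ := bump.contDiff_normed
  have hρs : HasCompactSupport ρ := bump.hasCompactSupport_normed
  have hρ1 : ∫ R, ρ R = 1 := bump.integral_normed
  have hρt : tsupport ρ ⊆ Ioi 0 := by
    rw [hρ, bump.tsupport_normed_eq, Real.closedBall_eq_Icc]
    intro s hs
    have : (2 : ℝ) - 1 ≤ s := hs.1
    exact mem_Ioi.2 (by linarith)
  refine ⟨∫ R, ρ R * P R, ?_⟩
  have key : ∀ g : ℝ → ℝ, ContDiff ℝ ∞ g → HasCompactSupport g → tsupport g ⊆ Ioi 0 →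
      ∫ R, g R • (P R - ∫ R, ρ R * P R) = 0 := by
    intro g hg hgs hgt
    have hmul : ∀ φ : ℝ → ℝ, Continuous φ → HasCompactSupport φ →
        Integrable (fun R => φ R * P R) := fun φ hφ hφs => by
      simpa [mul_comm] using hP.integrable_smul_left_of_hasCompactSupport hφ hφs
    -- Subtracting this multiple of ρ makes the integral zero, so the primitive of w is again
    -- compactly supported in (0, ∞) and may serve as a test function.
    set w : ℝ → ℝ := fun s => g s - (∫ R, g R) * ρ s with hw
    have hwc : ContDiff ℝ ∞ w := hg.sub (contDiff_const.mul hρc)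
    have hws : HasCompactSupport w := hgs.sub hρs.mul_left
    have hwi : Integrable w := hwc.continuous.integrable_of_hasCompactSupport hws
    have hgi : Integrable g := hg.continuous.integrable_of_hasCompactSupport hgs
    have hρi : Integrable ρ := hρc.continuous.integrable_of_hasCompactSupport hρs
    have hw0 : ∫ s, w s = 0 := by
      rw [hw, integral_sub hgi (hρi.const_mul _), integral_const_mul, hρ1, mul_one, sub_self]
    have hwt : tsupport w ⊆ Ioi 0 := by
      refine (tsupport_sub g fun s => (∫ R, g R) * ρ s).trans (union_subset hgt ?_)
      exact (tsupport_mul_subset_right).trans hρt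
    obtain ⟨a, b, ha, hab⟩ : ∃ a b : ℝ, 0 < a ∧ ∀ s, s ∉ Icc a b → w s = 0 := by
      rcases (tsupport w).eq_empty_or_nonempty with he | hne
      · exact ⟨1, 1, one_pos, fun s _ => image_eq_zero_of_notMem_tsupport (by simp [he])⟩
      · obtain ⟨a, haw, ha⟩ := hws.exists_isLeast hne
        obtain ⟨b, hbw, hb⟩ := hws.exists_isGreatest hne
        exact ⟨a, b, hwt haw, fun s hs => image_eq_zero_of_notMem_tsupport fun hsw =>
          hs ⟨ha hsw, hb hsw⟩⟩
    set ξ : ℝ → ℝ := fun R => ∫ s in (0 : ℝ)..R, w s with hξ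
    have hξd : ∀ R, HasDerivAt ξ (w R) R := fun R =>
      intervalIntegral.integral_hasDerivAt_right (hwc.continuous.intervalIntegrable _ _)
        hwc.continuous.stronglyMeasurable.stronglyMeasurableAtFilter hwc.continuous.continuousAt
    have hξderiv : deriv ξ = w := funext fun R => (hξd R).deriv
    have hξc : ContDiff ℝ ∞ ξ := by
      rw [contDiff_infty_iff_deriv]
      exact ⟨fun R => (hξd R).differentiableAt, by rwa [hξderiv]⟩
    have hξz : ∀ R, R ∉ Icc a b → ξ R = 0 := by
      intro R hR
      by_cases hRa : R < a
      · refine intervalIntegral.integral_zero_ae (ae_of_all _ fun s hs => hab s fun hsI => ?_)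
        rw [mem_uIoc] at hs
        rcases hs with hs | hs
        · linarith [hs.2, hsI.1]
        · linarith [hs.2, hsI.1]
      · have hRb : b < R := by
          by_contra! hh
          exact hR ⟨not_lt.1 hRa, hh⟩
        have h0R : 0 ≤ R := ha.le.trans (not_lt.1 hRa)
        rw [hξ]
        simp only
        rw [intervalIntegral.integral_of_le h0R]
        refine Eq.trans ?_ hw0
        refine setIntegral_eq_integral_of_forall_compl_eq_zero fun s hs => hab s fun hsI => hs ?_
        exact ⟨ha.trans_le hsI.1, hsI.2.trans hRb.le⟩
    have hξs : HasCompactSupport ξ := HasCompactSupport.intro isCompact_Icc hξz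
    have hξt : tsupport ξ ⊆ Ioi 0 := by
      have : tsupport ξ ⊆ Icc a b := closure_minimal (fun s hs => by
        by_contra hn
        exact hs (hξz s hn)) isClosed_Icc
      exact fun s hs => ha.trans_le (this hs).1
    have h0 := h ξ hξc hξs hξt
    rw [hξderiv] at h0
    have h1 : ∫ R, w R * P R = (∫ R, g R * P R) - (∫ R, g R) * ∫ R, ρ R * P R := by
      rw [← integral_const_mul, ← integral_sub (hmul g hg.continuous hgs)
        ((hmul ρ hρc.continuous hρs).const_mul _)]
      refine integral_congr_ae (ae_of_all _ fun R => ?_)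
      simp only [hw]
      ring
    simp only [smul_eq_mul, mul_sub]
    rw [integral_sub (hmul g hg.continuous hgs) (hgi.mul_const _), integral_mul_const, ← h1, h0]
  have := isOpen_Ioi.ae_eq_zero_of_integral_contDiff_smul_eq_zero (U := Ioi (0 : ℝ))
    (f := fun R => P R - ∫ R, ρ R * P R) (μ := volume)
    ((hP.sub (locallyIntegrable_const _)).locallyIntegrableOn _) key
  filter_upwards [this] with R hR h0
  exact sub_eq_zero.1 (hR h0)

/-- Since η vanishes near 0, the singularity of the norm at x is not felt. -/
theorem contDiff_comp_norm_sub {n : ℕ∞ω} {η : ℝ → ℝ} (hη : ContDiff ℝ n η) (h0 : 0 ∉ tsupport η)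
    (x : E3) : ContDiff ℝ n fun y => η ‖y - x‖ := by
  rw [contDiff_iff_contDiffAt]
  intro y
  by_cases hy : y = x
  · subst hy
    have h1 : ∀ᶠ s in 𝓝 (0 : ℝ), η s = 0 := by
      filter_upwards [(isClosed_tsupport η).isOpen_compl.mem_nhds h0] with s hs
      exact image_eq_zero_of_notMem_tsupport hs
    have h2 : Tendsto (fun z : E3 => ‖z - y‖) (𝓝 y) (𝓝 0) := by
      have : Tendsto (fun z : E3 => ‖z - y‖) (𝓝 y) (𝓝 ‖y - y‖) :=
        Continuous.tendsto (by fun_prop) y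
      rwa [sub_self, norm_zero] at this
    have h3 : (fun z => η ‖z - y‖) =ᶠ[𝓝 y] fun _ => 0 := h2.eventually h1
    exact contDiffAt_const.congr_of_eventuallyEq h3
  · have h1 : ContDiffAt ℝ n (fun y : E3 => ‖y - x‖) y :=
      (contDiffAt_id.sub contDiffAt_const).norm ℝ (sub_ne_zero.2 hy)
    exact hη.contDiffAt.comp y h1

theorem hasCompactSupport_comp_norm_sub {η : ℝ → ℝ} (hη : HasCompactSupport η) (x : E3) :
    HasCompactSupport fun y : E3 => η ‖y - x‖ := by
  obtain ⟨B, hB⟩ := hη.isBounded.subset_closedBall 0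
  refine HasCompactSupport.intro (isCompact_closedBall x B) fun y hy => ?_
  refine image_eq_zero_of_notMem_tsupport fun h => hy ?_
  have := hB h
  rw [mem_closedBall_zero_iff, norm_norm] at this
  exact mem_closedBall_iff_norm.2 this

namespace IsLyapunovDomain

variable {Ω : Set E3}

/-- The gradient theorem is applied to each component of the field η(r)(y - x) and summed over an
orthonormal basis; the divergence is r η'(r) + 3 η(r). -/
theorem integral_divergence_radial (hΩ : IsLyapunovDomain Ω) (x : E3) {η : ℝ → ℝ}
    (hη : ContDiff ℝ 1 η) (hηs : HasCompactSupport η) (h0 : 0 ∉ tsupport η) :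
    ∫ y in Ω, (deriv η ‖y - x‖ * ‖y - x‖ + 3 * η ‖y - x‖) =
      ∫ y in frontier Ω, η ‖y - x‖ * ⟪y - x, externalNormal Ω y⟫ ∂μHE[2] := by
  let b := EuclideanSpace.basisFun (Fin 3) ℝ
  have hηc := contDiff_comp_norm_sub hη h0 x
  have hηcs := hasCompactSupport_comp_norm_sub hηs x
  have hfc : ∀ i, ContDiff ℝ 1 fun y => η ‖y - x‖ * ⟪y - x, b i⟫ := fun i =>
    hηc.mul ((contDiff_id.sub contDiff_const).inner ℝ contDiff_const)
  have hfs : ∀ i, HasCompactSupport fun y => η ‖y - x‖ * ⟪y - x, b i⟫ := fun i => hηcs.mul_right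
  have hgrad := fun i => hΩ.integral_fderiv (hfc i) (hfs i) (b i)
  have hsum : ∀ y, ∑ i, fderiv ℝ (fun y => η ‖y - x‖ * ⟪y - x, b i⟫) y (b i) =
      deriv η ‖y - x‖ * ‖y - x‖ + 3 * η ‖y - x‖ := by
    intro y
    by_cases hy : y = x
    · have h1 : ∀ i, fderiv ℝ (fun y => η ‖y - x‖ * ⟪y - x, b i⟫) y = 0 := by
        intro i
        have h2 : x ∉ tsupport fun y => η ‖y - x‖ * ⟪y - x, b i⟫ := by
          rw [notMem_tsupport_iff_eventuallyEq]
          have h3 : ∀ᶠ s in 𝓝 (0 : ℝ), η s = 0 := by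
            filter_upwards [(isClosed_tsupport η).isOpen_compl.mem_nhds h0] with s hs
            exact image_eq_zero_of_notMem_tsupport hs
          have h4 : Tendsto (fun y : E3 => ‖y - x‖) (𝓝 x) (𝓝 0) := by
            have : Tendsto (fun y : E3 => ‖y - x‖) (𝓝 x) (𝓝 ‖x - x‖) :=
              Continuous.tendsto (by fun_prop) x
            rwa [sub_self, norm_zero] at this
          filter_upwards [h4.eventually h3] with z hz
          simp [hz]
        rw [hy]
        exact image_eq_zero_of_notMem_tsupport fun h => h2 (tsupport_fderiv_subset ℝ h)
      rw [Finset.sum_eq_zero fun i _ => by rw [h1, zero_apply], hy]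
      simp [image_eq_zero_of_notMem_tsupport h0]
    · have hn : HasFDerivAt (fun z : E3 => ‖z - x‖) (‖y - x‖⁻¹ • innerSL ℝ (y - x)) y := by
        have := hasFDerivAt_norm_sub hy
        simpa only [norm_sub_rev x] using this
      have hηd : HasFDerivAt (fun z : E3 => η ‖z - x‖) _ y :=
        ((hη.differentiable one_ne_zero ‖y - x‖).hasDerivAt).comp_hasFDerivAt y hn
      have hpos : ‖y - x‖ ≠ 0 := norm_ne_zero_iff.2 (sub_ne_zero.2 hy)
      have h1 : ∀ i, fderiv ℝ (fun y => η ‖y - x‖ * ⟪y - x, b i⟫) y (b i) =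
          deriv η ‖y - x‖ * ‖y - x‖⁻¹ * (⟪y - x, b i⟫ * ⟪b i, y - x⟫) + η ‖y - x‖ := by
        intro i
        have hin : HasFDerivAt (fun z : E3 => ⟪z - x, b i⟫) (innerSL ℝ (b i)) y := by
          have h2 := (innerSL ℝ (b i)).hasFDerivAt.comp y ((hasFDerivAt_id y).sub_const x)
          have h3 : (fun z : E3 => ⟪z - x, b i⟫) = (innerSL ℝ (b i)) ∘ fun z => id z - x := by
            ext z
            simp [real_inner_comm, inner_sub_left]
          rw [h3]
          simpa using h2
        have h4 : fderiv ℝ (fun y => η ‖y - x‖ * ⟪y - x, b i⟫) y = _ := (hηd.mul hin).fderiv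
        rw [h4]
        simp only [add_apply, smul_apply, innerSL_apply_apply, smul_eq_mul,
          real_inner_self_eq_norm_sq, b.norm_eq_one, real_inner_comm (b i) (y - x)]
        ring
      simp_rw [h1]
      rw [Finset.sum_add_distrib, ← Finset.mul_sum, b.sum_inner_mul_inner,
        real_inner_self_eq_norm_sq]
      simp
      field_simp
  simp_rw [← hsum]
  rw [integral_finsetSum, Finset.sum_congr rfl fun i _ => hgrad i, ← integral_finsetSum]
  · refine integral_congr_ae (ae_of_all _ fun y => ?_)
    simp only
    rw [← b.sum_inner_mul_inner, Finset.mul_sum]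
    refine Finset.sum_congr rfl fun i _ => ?_
    rw [real_inner_comm (externalNormal Ω y)]
    ring
  · intro i _
    refine ContinuousOn.integrableOn_of_subset_isCompact ?_ hΩ.isCompact_frontier
      (isClosed_frontier (s := Ω)).measurableSet subset_rfl
      hΩ.euclideanHausdorffMeasure_frontier_lt_top.ne
    exact (hfc i).continuous.continuousOn.mul
      (hΩ.continuousOn_externalNormal.inner continuousOn_const)
  · intro i _
    exact ((((hfc i).continuous_fderiv one_ne_zero).clm_apply
      continuous_const).integrable_of_hasCompactSupport ((hfs i).fderiv_apply ℝ (b i))).integrableOn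

end IsLyapunovDomain

theorem charS_nonneg (Ω : Set E3) (y : E3) : 0 ≤ charS Ω y := by
  unfold charS; split_ifs <;> norm_num

theorem charS_le_one (Ω : Set E3) (y : E3) : charS Ω y ≤ 1 := by
  unfold charS; split_ifs <;> norm_num

theorem norm_charS_le (Ω : Set E3) (y : E3) : ‖charS Ω y‖ ≤ 1 := by
  rw [Real.norm_of_nonneg (charS_nonneg Ω y)]; exact charS_le_one Ω y

theorem charS_of_mem {Ω : Set E3} {y : E3} (h : y ∈ Ω) : charS Ω y = 1 := if_pos h

theorem charS_of_notMem_closure {Ω : Set E3} {y : E3} (h : y ∉ closure Ω) : charS Ω y = 0 := by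
  rw [charS, if_neg fun h' => h (subset_closure h'), if_neg fun h' => h (frontier_subset_closure h')]

theorem charS_of_mem_frontier {Ω : Set E3} (hΩ : IsOpen Ω) {y : E3} (h : y ∈ frontier Ω) :
    charS Ω y = 1 / 2 := by
  rw [charS, if_neg fun h' => ?_, if_pos h]
  rw [hΩ.frontier_eq] at h
  exact h.2 h'

theorem measurable_charS {Ω : Set E3} (hΩ : IsOpen Ω) : Measurable (charS Ω) :=
  Measurable.ite hΩ.measurableSet measurable_const
    (Measurable.ite (isClosed_frontier (s := Ω)).measurableSet measurable_const measurable_const)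

theorem eventually_charS_eq {Ω : Set E3} (hΩ : IsOpen Ω) {y : E3} (h : y ∉ frontier Ω) :
    ∀ᶠ z in 𝓝 y, charS Ω z = charS Ω y := by
  by_cases hy : y ∈ Ω
  · filter_upwards [hΩ.mem_nhds hy] with z hz
    rw [charS_of_mem hz, charS_of_mem hy]
  · have hc : y ∉ closure Ω := fun hc => h (by rw [hΩ.frontier_eq]; exact ⟨hc, hy⟩)
    filter_upwards [isClosed_closure.isOpen_compl.mem_nhds hc] with z hz
    rw [charS_of_notMem_closure hz, charS_of_notMem_closure hc]

/-- The integral over the unit sphere of `charS Ω (x + R θ)`. -/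
noncomputable def sphereIntegral (Ω : Set E3) (x : E3) (R : ℝ) : ℝ :=
  ∫ θ, charS Ω (x + R • θ) ∂unitSphereMeasure

/-- The integral of the Gauss kernel over the part of the boundary in the ball of radius `R`. -/
noncomputable def kernelIntegral (Ω : Set E3) (x : E3) (R : ℝ) : ℝ :=
  ∫ y in frontier Ω, (ball x R).indicator (gaussKernel Ω x) y ∂μHE[2]

theorem integrable_charS_unitSphere {Ω : Set E3} (hΩ : IsOpen Ω) (x : E3) (R : ℝ) :
    Integrable (fun θ => charS Ω (x + R • θ)) unitSphereMeasure :=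
  Integrable.of_bound ((measurable_charS hΩ).comp (by fun_prop)).aestronglyMeasurable 1
    (ae_of_all _ fun _ => norm_charS_le Ω _)

theorem unitSphereMeasure_real_univ : unitSphereMeasure.real univ = 4 * Real.pi := by
  rw [measureReal_def, unitSphereMeasure_univ, ENNReal.toReal_ofReal (by positivity)]

theorem norm_sphereIntegral_le (Ω : Set E3) (x : E3) (R : ℝ) :
    ‖sphereIntegral Ω x R‖ ≤ 4 * Real.pi := by
  have := norm_integral_le_of_norm_le_const (μ := unitSphereMeasure) (C := 1)
    (ae_of_all _ fun θ => norm_charS_le Ω (x + R • θ))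
  rwa [unitSphereMeasure_real_univ, one_mul] at this

theorem measurable_sphereIntegral {Ω : Set E3} (hΩ : IsOpen Ω) (x : E3) :
    Measurable (sphereIntegral Ω x) := by
  have h : StronglyMeasurable fun p : ℝ × E3 => charS Ω (x + p.1 • p.2) :=
    ((measurable_charS hΩ).comp (by fun_prop)).stronglyMeasurable
  exact (h.integral_prod_right' (ν := unitSphereMeasure)).measurable

namespace IsLyapunovDomain

variable {Ω : Set E3}

theorem isFiniteMeasure_restrict (hΩ : IsLyapunovDomain Ω) :
    IsFiniteMeasure (μHE[2].restrict (frontier Ω)) :=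
  ⟨by rw [Measure.restrict_apply_univ]; exact hΩ.euclideanHausdorffMeasure_frontier_lt_top⟩

theorem integrable_mul_indicator_prod (hΩ : IsLyapunovDomain Ω) (x : E3) {w : ℝ → ℝ}
    {μ : Measure ℝ} [SFinite μ] (hw : Integrable w μ) {k : E3 → ℝ}
    (hk : IntegrableOn k (frontier Ω) μHE[2]) :
    Integrable (fun p : ℝ × E3 => w p.1 * (ball x p.1).indicator k p.2)
      (μ.prod (μHE[2].restrict (frontier Ω))) := by
  have := hΩ.isFiniteMeasure_restrict
  have h1 : Integrable (fun p : ℝ × E3 => w p.1 * k p.2)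
    (μ.prod (μHE[2].restrict (frontier Ω))) := hw.mul_prod hk
  have hms : MeasurableSet {p : ℝ × E3 | dist p.2 x < p.1} :=
    measurableSet_lt (by fun_prop) (by fun_prop)
  refine (h1.indicator hms).congr (ae_of_all _ fun p => ?_)
  by_cases h : dist p.2 x < p.1
  · simp [indicator, h]
  · simp [indicator, h]

theorem norm_kernelIntegral_le (hΩ : IsLyapunovDomain Ω) (x : E3) (R : ℝ) :
    ‖kernelIntegral Ω x R‖ ≤ ∫ y in frontier Ω, ‖gaussKernel Ω x y‖ ∂μHE[2] :=
  norm_integral_le_of_norm_le (hΩ.integrableOn_gaussKernel x).norm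
    (ae_of_all _ fun _ => norm_indicator_le_norm_self _ _)

/-- Passing to a strongly measurable representative of the kernel makes the integrand jointly
measurable in R and y. -/
theorem stronglyMeasurable_kernelIntegral (hΩ : IsLyapunovDomain Ω) (x : E3) :
    StronglyMeasurable (kernelIntegral Ω x) := by
  have := hΩ.isFiniteMeasure_restrict
  have hms : MeasurableSet {p : ℝ × E3 | dist p.2 x < p.1} :=
    measurableSet_lt (by fun_prop) (by fun_prop)
  have hk := (hΩ.integrableOn_gaussKernel x).aestronglyMeasurable
  have h1 : StronglyMeasurable ({p : ℝ × E3 | dist p.2 x < p.1}.indicator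
      fun p => hk.mk (gaussKernel Ω x) p.2) :=
    (hk.stronglyMeasurable_mk.comp_measurable measurable_snd).indicator hms
  have h2 : kernelIntegral Ω x = fun R => ∫ y in frontier Ω,
      {p : ℝ × E3 | dist p.2 x < p.1}.indicator
        (fun p => hk.mk (gaussKernel Ω x) p.2) (R, y) ∂μHE[2] := by
    ext R
    refine integral_congr_ae ?_
    filter_upwards [hk.ae_eq_mk] with y hy
    simp [indicator, ← hy]
  rw [h2]
  exact h1.integral_prod_right'

theorem locallyIntegrable_kernelIntegral (hΩ : IsLyapunovDomain Ω) (x : E3) :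
    LocallyIntegrable (kernelIntegral Ω x) := by
  refine (locallyIntegrable_const (∫ y in frontier Ω, ‖gaussKernel Ω x y‖ ∂μHE[2])).mono
    (hΩ.stronglyMeasurable_kernelIntegral x).aestronglyMeasurable (ae_of_all _ fun R => ?_)
  exact (hΩ.norm_kernelIntegral_le x R).trans (Real.le_norm_self _)

theorem locallyIntegrable_sphereIntegral (hΩ : IsLyapunovDomain Ω) (x : E3) :
    LocallyIntegrable (sphereIntegral Ω x) := by
  refine (locallyIntegrable_const (4 * Real.pi)).mono
    (measurable_sphereIntegral hΩ.isOpen x).aestronglyMeasurable (ae_of_all _ fun R => ?_)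
  exact (norm_sphereIntegral_le Ω x R).trans (Real.le_norm_self _)

/-- After Fubini, a boundary point at distance r contributes the kernel times the integral of ξ'
over (r, ∞), which is -ξ(r). -/
theorem integral_deriv_mul_kernelIntegral (hΩ : IsLyapunovDomain Ω) (x : E3) {ξ : ℝ → ℝ}
    (hξ : ContDiff ℝ 1 ξ) (hξs : HasCompactSupport ξ) :
    ∫ R, deriv ξ R * kernelIntegral Ω x R =
      -∫ y in frontier Ω, ξ ‖y - x‖ * gaussKernel Ω x y ∂μHE[2] := by
  have := hΩ.isFiniteMeasure_restrict
  have hd : Integrable (deriv ξ) :=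
    (hξ.continuous_deriv le_rfl).integrable_of_hasCompactSupport hξs.deriv
  have h1 := integral_integral_swap
    (f := fun R y => deriv ξ R * (ball x R).indicator (gaussKernel Ω x) y)
    (hΩ.integrable_mul_indicator_prod x hd (hΩ.integrableOn_gaussKernel x))
  have h2 : ∫ R, deriv ξ R * kernelIntegral Ω x R = ∫ R, ∫ y in frontier Ω,
      deriv ξ R * (ball x R).indicator (gaussKernel Ω x) y ∂μHE[2] := by
    refine integral_congr_ae (ae_of_all _ fun R => ?_)
    simp only
    rw [integral_const_mul, kernelIntegral]
  rw [h2]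
  refine h1.trans ?_
  rw [← integral_neg]
  refine integral_congr_ae (ae_of_all _ fun y => ?_)
  have h3 : ∀ R, deriv ξ R * (ball x R).indicator (gaussKernel Ω x) y =
      (Ioi ‖y - x‖).indicator (deriv ξ) R * gaussKernel Ω x y := by
    intro R
    by_cases h : ‖y - x‖ < R
    · rw [indicator_of_mem (mem_ball_iff_norm.2 h), indicator_of_mem (mem_Ioi.2 h)]
    · rw [indicator_of_notMem fun h' => h (mem_ball_iff_norm.1 h'),
        indicator_of_notMem (show R ∉ Ioi ‖y - x‖ from h)]
      simp
  simp_rw [h3]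
  rw [integral_mul_const, integral_indicator measurableSet_Ioi, hξs.integral_Ioi_deriv_eq hξ]
  ring

theorem setIntegral_eq_integral_charS (hΩ : IsLyapunovDomain Ω) (f : E3 → ℝ) :
    ∫ y in Ω, f y = ∫ y, charS Ω y * f y := by
  rw [← integral_indicator hΩ.isOpen.measurableSet]
  have : ∀ᵐ y : E3, y ∉ frontier Ω := measure_eq_zero_iff_ae_notMem.1 hΩ.volume_frontier
  refine integral_congr_ae ?_
  filter_upwards [this] with y hy
  by_cases h : y ∈ Ω
  · rw [indicator_of_mem h, charS_of_mem h, one_mul]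
  · rw [indicator_of_notMem h, charS, if_neg h, if_neg hy, zero_mul]

theorem integral_deriv_mul_eq_zero (hΩ : IsLyapunovDomain Ω) (x : E3) {ξ : ℝ → ℝ}
    (hξ : ContDiff ℝ ∞ ξ) (hξs : HasCompactSupport ξ) (hξt : tsupport ξ ⊆ Ioi 0) :
    ∫ R, deriv ξ R * (sphereIntegral Ω x R + kernelIntegral Ω x R) = 0 := by
  have h0 : (0 : ℝ) ∉ tsupport ξ := fun h => lt_irrefl (0 : ℝ) (hξt h)
  -- With this η the flux density is ξ times the kernel, and the divergence times the polar weight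
  -- s² is exactly ξ'.
  set η : ℝ → ℝ := fun s => ξ s * (s ^ 3)⁻¹ with hη
  have hηt : tsupport η ⊆ tsupport ξ := tsupport_mul_subset_left
  have hη0 : (0 : ℝ) ∉ tsupport η := fun h => h0 (hηt h)
  have hηs : HasCompactSupport η := hξs.mul_right
  have hnear : ∀ᶠ s in 𝓝 (0 : ℝ), η s = 0 := by
    filter_upwards [(isClosed_tsupport η).isOpen_compl.mem_nhds hη0] with s hs
    exact image_eq_zero_of_notMem_tsupport hs
  have hηc : ContDiff ℝ ∞ η := by
    rw [contDiff_iff_contDiffAt]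
    intro s
    by_cases hs : s = 0
    · rw [hs]
      exact (contDiffAt_const (c := (0 : ℝ))).congr_of_eventuallyEq hnear
    · exact hξ.contDiffAt.mul ((contDiffAt_id.pow 3).inv (pow_ne_zero 3 hs))
  have hη1 : ContDiff ℝ 1 η := hηc.of_le (by exact_mod_cast le_top)
  have hξ1 : ContDiff ℝ 1 ξ := hξ.of_le (by exact_mod_cast le_top)
  have hdiv : ∀ s, s ^ 2 * (deriv η s * s + 3 * η s) = deriv ξ s := by
    intro s
    by_cases hs : s = 0
    · have h1 : deriv ξ s = 0 := by
        rw [hs]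
        exact image_eq_zero_of_notMem_tsupport fun h => h0 (tsupport_deriv_subset h)
      rw [h1, hs]
      simp
    · have h1 : HasDerivAt η (deriv ξ s * (s ^ 3)⁻¹ + ξ s * (-(3 * s ^ 2) / (s ^ 3) ^ 2)) s := by
        have h2 : HasDerivAt (fun s : ℝ => s ^ 3) (3 * s ^ 2) s := by
          simpa using hasDerivAt_pow 3 s
        exact (hξ1.differentiable one_ne_zero s).hasDerivAt.mul (h2.inv (pow_ne_zero 3 hs))
      rw [h1.deriv, hη]
      field_simp
      ring
  have hζc : Continuous fun y : E3 => deriv η ‖y - x‖ * ‖y - x‖ + 3 * η ‖y - x‖ := by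
    have := hη1.continuous_deriv le_rfl
    have := hη1.continuous
    fun_prop
  have hζs : HasCompactSupport fun y : E3 => deriv η ‖y - x‖ * ‖y - x‖ + 3 * η ‖y - x‖ :=
    ((hasCompactSupport_comp_norm_sub hηs.deriv x).mul_right).add
      (hasCompactSupport_comp_norm_sub hηs x).mul_left
  have hint : Integrable fun y : E3 =>
      charS Ω y * (deriv η ‖y - x‖ * ‖y - x‖ + 3 * η ‖y - x‖) :=
    (hζc.integrable_of_hasCompactSupport hζs).bdd_mul
      (measurable_charS hΩ.isOpen).aestronglyMeasurable (ae_of_all _ (norm_charS_le Ω))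
  have hL : ∫ y in Ω, (deriv η ‖y - x‖ * ‖y - x‖ + 3 * η ‖y - x‖) =
      ∫ R, deriv ξ R * sphereIntegral Ω x R := by
    rw [hΩ.setIntegral_eq_integral_charS, integral_polar x hint]
    rw [← setIntegral_eq_integral_of_forall_compl_eq_zero (s := Ioi (0 : ℝ))
      (f := fun R => deriv ξ R * sphereIntegral Ω x R)]
    · refine setIntegral_congr_fun measurableSet_Ioi fun R hR => ?_
      have hR : 0 < R := hR
      have h1 : ∀ᵐ θ ∂unitSphereMeasure, ‖x + R • θ - x‖ = R := by
        filter_upwards [ae_restrict_mem (isClosed_sphere (x := (0 : E3)) (ε := 1)).measurableSet]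
          with θ hθ
        rw [add_sub_cancel_left, norm_smul, mem_sphere_zero_iff_norm.1 hθ, mul_one,
          Real.norm_of_nonneg hR.le]
      have h2 : ∫ θ, charS Ω (x + R • θ) * (deriv η ‖x + R • θ - x‖ * ‖x + R • θ - x‖ +
          3 * η ‖x + R • θ - x‖) ∂unitSphereMeasure =
          ∫ θ, charS Ω (x + R • θ) * (deriv η R * R + 3 * η R) ∂unitSphereMeasure := by
        refine integral_congr_ae ?_
        filter_upwards [h1] with θ hθ
        rw [hθ]
      rw [h2, integral_mul_const, ← hdiv, sphereIntegral]
      ring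
    · intro R hR
      have : deriv ξ R = 0 :=
        image_eq_zero_of_notMem_tsupport fun h => hR (hξt (tsupport_deriv_subset h))
      rw [this, zero_mul]
  have hR : ∫ y in frontier Ω, η ‖y - x‖ * ⟪y - x, externalNormal Ω y⟫ ∂μHE[2] =
      ∫ y in frontier Ω, ξ ‖y - x‖ * gaussKernel Ω x y ∂μHE[2] := by
    refine integral_congr_ae (ae_of_all _ fun y => ?_)
    simp only [hη, gaussKernel]
    ring
  have hmain := hΩ.integral_divergence_radial x hη1 hηs hη0
  rw [hL, hR] at hmain
  have hdc : Continuous (deriv ξ) := hξ1.continuous_deriv le_rfl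
  have i1 : Integrable fun R => deriv ξ R * sphereIntegral Ω x R := by
    simpa [mul_comm] using (hΩ.locallyIntegrable_sphereIntegral
      x).integrable_smul_left_of_hasCompactSupport hdc hξs.deriv
  have i2 : Integrable fun R => deriv ξ R * kernelIntegral Ω x R := by
    simpa [mul_comm] using (hΩ.locallyIntegrable_kernelIntegral
      x).integrable_smul_left_of_hasCompactSupport hdc hξs.deriv
  simp_rw [mul_add]
  rw [integral_add i1 i2, hmain, hΩ.integral_deriv_mul_kernelIntegral x hξ1 hξs, add_neg_cancel]

/-! ### Small radii and the Gauss formula in balls. -/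

theorem tendsto_kernelIntegral_zero (hΩ : IsLyapunovDomain Ω) (x : E3) :
    Tendsto (kernelIntegral Ω x) (𝓝[>] 0) (𝓝 0) := by
  have h := tendsto_integral_filter_of_dominated_convergence (l := 𝓝[>] (0 : ℝ))
    (μ := μHE[2].restrict (frontier Ω)) (F := fun R => (ball x R).indicator (gaussKernel Ω x))
    (f := fun _ => (0 : ℝ)) (fun y => ‖gaussKernel Ω x y‖)
    (Eventually.of_forall fun R =>
      (hΩ.integrableOn_gaussKernel x).aestronglyMeasurable.indicator measurableSet_ball)
    (Eventually.of_forall fun R => ae_of_all _ fun y => norm_indicator_le_norm_self _ _)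
    (hΩ.integrableOn_gaussKernel x).norm ?_
  · rw [integral_zero] at h
    exact h
  · filter_upwards [ae_restrict_frontier_ne Ω x] with y hy
    have hpos : 0 < ‖y - x‖ := norm_pos_iff.2 (sub_ne_zero.2 hy)
    refine tendsto_const_nhds.congr' ?_
    filter_upwards [nhdsWithin_le_nhds (Iio_mem_nhds hpos)] with R hR
    rw [indicator_of_notMem fun h => lt_asymm (mem_ball_iff_norm.1 h) hR]

end IsLyapunovDomain

/-- The plane orthogonal to v is a cone of volume zero, and in polar coordinates its volume is an
infinite multiple of the measure of its directions. -/
theorem unitSphereMeasure_inner_eq_zero {v : E3} (hv : v ≠ 0) :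
    unitSphereMeasure {θ | ⟪v, θ⟫ = 0} = 0 := by
  have hm : MeasurableSet {θ : E3 | ⟪v, θ⟫ = 0} := measurableSet_eq_fun (by fun_prop) (by fun_prop)
  have hvol : volume {θ : E3 | ⟪v, θ⟫ = 0} = 0 := by
    have := Measure.addHaar_submodule (volume : Measure E3) (LinearMap.ker (innerSL ℝ v : E3 →ₗ[ℝ] ℝ)) ?_
    · exact this
    · intro htop
      have : v ∈ LinearMap.ker (innerSL ℝ v : E3 →ₗ[ℝ] ℝ) := by rw [htop]; trivial
      rw [LinearMap.mem_ker] at this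
      exact hv (inner_self_eq_zero.1 this)
  have h := lintegral_polar (f := {θ : E3 | ⟪v, θ⟫ = 0}.indicator 1) (measurable_one.indicator hm)
  rw [lintegral_indicator_one hm, hvol] at h
  have h2 : ∀ R ∈ Ioi (0 : ℝ), ENNReal.ofReal (R ^ 2) *
      ∫⁻ θ in sphere (0 : E3) 1, {θ : E3 | ⟪v, θ⟫ = 0}.indicator 1 (R • θ) ∂μHE[2] =
      ENNReal.ofReal (R ^ 2) * unitSphereMeasure {θ | ⟪v, θ⟫ = 0} := by
    intro R hR
    have hR : 0 < R := hR
    rw [← lintegral_indicator_one hm]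
    congr 1
    refine lintegral_congr fun θ => ?_
    simp [indicator, inner_smul_right, hR.ne']
  rw [setLIntegral_congr_fun measurableSet_Ioi h2, lintegral_mul_const _ (by fun_prop), eq_comm,
    mul_eq_zero] at h
  refine h.resolve_left ?_
  rw [lintegral_eq_zero_iff (by fun_prop)]
  intro hae
  have h3 : ∀ᵐ R : ℝ, R ∉ Ioi (0 : ℝ) := by
    filter_upwards [(ae_restrict_iff' measurableSet_Ioi).1 hae] with R hR hR0
    have := hR hR0
    simp only [Pi.zero_apply, ENNReal.ofReal_eq_zero] at this
    have h5 : 0 < R := hR0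
    nlinarith
  have := measure_eq_zero_iff_ae_notMem.2 h3
  simp at this

theorem unitSphereMeasure_inner_neg {v : E3} (hv : v ≠ 0) :
    unitSphereMeasure.real {θ | ⟪v, θ⟫ < 0} = 2 * Real.pi := by
  have hm : MeasurableSet {θ : E3 | ⟪v, θ⟫ < 0} := measurableSet_lt (by fun_prop) (by fun_prop)
  have hm' : MeasurableSet {θ : E3 | 0 < ⟪v, θ⟫} := measurableSet_lt (by fun_prop) (by fun_prop)
  have hneg : MeasurePreserving (fun y : E3 => -y) unitSphereMeasure unitSphereMeasure := by
    have h1 := ((IsometryEquiv.neg E3).measurePreserving_euclideanHausdorffMeasure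
      2).restrict_preimage (isClosed_sphere (x := (0 : E3)) (ε := 1)).measurableSet
    have h2 : (IsometryEquiv.neg E3) ⁻¹' sphere 0 1 = sphere 0 1 := by
      ext y
      simp
    rw [h2] at h1
    exact h1
  have h1 : unitSphereMeasure {θ | 0 < ⟪v, θ⟫} = unitSphereMeasure {θ | ⟪v, θ⟫ < 0} := by
    rw [← hneg.measure_preimage hm'.nullMeasurableSet]
    congr 1
    ext θ
    simp
  have h2 : unitSphereMeasure univ =
      unitSphereMeasure {θ | ⟪v, θ⟫ < 0} + unitSphereMeasure {θ | 0 < ⟪v, θ⟫} := by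
    rw [← measure_union _ hm']
    · refine measure_congr (ae_eq_set.2 ⟨measure_mono_null ?_ (unitSphereMeasure_inner_eq_zero hv),
        by simp⟩)
      rintro θ ⟨-, hθ⟩
      simp only [mem_union, mem_ofPred_eq, not_or, not_lt] at hθ ⊢
      exact le_antisymm hθ.2 hθ.1
    · rw [Set.disjoint_left]
      intro θ h1 h2
      exact lt_asymm (show ⟪v, θ⟫ < 0 from h1) h2
  have h3 := unitSphereMeasure_real_univ
  rw [measureReal_def, h2, h1, ENNReal.toReal_add (measure_ne_top _ _) (measure_ne_top _ _)] at h3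
  rw [measureReal_def]
  linarith

namespace IsLyapunovDomain

variable {Ω : Set E3}

/-- Here v is the conormal at x: the height has slope ⟨v, θ⟩ along the ray in direction θ, and its
sign decides on which side the ray starts. -/
theorem ae_eventually_charS_eq (hΩ : IsLyapunovDomain Ω) {x : E3} (hx : x ∈ frontier Ω) :
    ∃ v : E3, v ≠ 0 ∧ ∀ θ, ⟪v, θ⟫ ≠ 0 → ∀ᶠ R in 𝓝[>] (0 : ℝ),
      charS Ω (x + R • θ) = {θ | ⟪v, θ⟫ < 0}.indicator 1 θ := by
  obtain ⟨e, g, C, α, ε, -, -, hε, h⟩ := hΩ.exists_isLocalSubgraph hx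
  refine ⟨graphConormal e g x, ?_, fun θ hθ => ?_⟩
  · rw [← norm_ne_zero_iff, norm_graphConormal]
    exact (graphJacobian_pos _ _).ne'
  have h0 := (h.mem_frontier_iff (mem_ball_self hε)).1 hx
  have hlim : Tendsto (fun R : ℝ => x + R • θ) (𝓝[>] 0) (𝓝 x) := by
    have : Tendsto (fun R : ℝ => x + R • θ) (𝓝 0) (𝓝 (x + (0 : ℝ) • θ)) :=
      Continuous.tendsto (by fun_prop) 0
    rw [zero_smul, add_zero] at this
    exact this.mono_left nhdsWithin_le_nhds
  have hd : HasDerivAt (fun R : ℝ => graphHeight e g (x + R • θ)) ⟪graphConormal e g x, θ⟫ 0 := by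
    have h1 : HasDerivAt (fun R : ℝ => x + R • θ) θ 0 := by
      simpa using ((hasDerivAt_id (0 : ℝ)).smul_const θ).const_add x
    have h2 := (hasFDerivAt_graphHeight (e := e) h.contDiff (x + (0 : ℝ) • θ)).comp_hasDerivAt 0 h1
    rw [innerSL_apply_apply, zero_smul, add_zero] at h2
    exact h2
  have hslope := hd.tendsto_slope_zero_right
  simp only [zero_add, zero_smul, add_zero, h0, sub_zero, smul_eq_mul] at hslope
  rcases lt_or_gt_of_ne hθ with hneg | hpos
  · filter_upwards [hlim (ball_mem_nhds x hε), hslope.eventually (gt_mem_nhds hneg),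
      self_mem_nhdsWithin] with R hR hRs hR0
    have hR0 : 0 < R := hR0
    rw [indicator_of_mem (show θ ∈ {θ | ⟪graphConormal e g x, θ⟫ < 0} from hneg), Pi.one_apply]
    refine charS_of_mem ((h.mem_iff_graphHeight hR).2 ?_)
    by_contra! hc
    exact absurd hRs (not_lt.2 (mul_nonneg (inv_nonneg.2 hR0.le) hc))
  · filter_upwards [hlim (ball_mem_nhds x hε), hslope.eventually (lt_mem_nhds hpos),
      self_mem_nhdsWithin] with R hR hRs hR0
    have hR0 : 0 < R := hR0
    rw [indicator_of_notMem (show θ ∉ {θ | ⟪graphConormal e g x, θ⟫ < 0} from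
      fun h' => lt_asymm hpos h')]
    refine charS_of_notMem_closure (h.notMem_closure hR ?_)
    by_contra! hc
    exact absurd hRs (not_lt.2 (mul_nonpos_of_nonneg_of_nonpos (inv_nonneg.2 hR0.le) hc))

/-- Dominated convergence over directions. On the boundary the limit is the measure 2π of a
half-sphere, which is where the value 1/2 of `charS` comes from. -/
theorem tendsto_sphereIntegral_zero (hΩ : IsLyapunovDomain Ω) (x : E3) :
    Tendsto (sphereIntegral Ω x) (𝓝[>] 0) (𝓝 (4 * Real.pi * charS Ω x)) := by
  have hdom : ∀ f : E3 → ℝ, (∀ᵐ θ ∂unitSphereMeasure,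
      Tendsto (fun R : ℝ => charS Ω (x + R • θ)) (𝓝[>] 0) (𝓝 (f θ))) →
      Tendsto (sphereIntegral Ω x) (𝓝[>] 0) (𝓝 (∫ θ, f θ ∂unitSphereMeasure)) := fun f hf =>
    tendsto_integral_filter_of_dominated_convergence (fun _ => 1)
      (Eventually.of_forall fun R =>
        (integrable_charS_unitSphere hΩ.isOpen x R).aestronglyMeasurable)
      (Eventually.of_forall fun R => ae_of_all _ fun θ => norm_charS_le Ω _)
      (integrable_const _) hf
  by_cases hx : x ∈ frontier Ω
  · obtain ⟨v, hv, hev⟩ := hΩ.ae_eventually_charS_eq hx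
    have h1 := hdom ({θ | ⟪v, θ⟫ < 0}.indicator 1) ?_
    · rw [integral_indicator_one (measurableSet_lt (by fun_prop) (by fun_prop)),
        unitSphereMeasure_inner_neg hv] at h1
      rw [charS_of_mem_frontier hΩ.isOpen hx]
      convert h1 using 2
      ring
    · have : ∀ᵐ θ ∂unitSphereMeasure, θ ∉ {θ | ⟪v, θ⟫ = 0} :=
        measure_eq_zero_iff_ae_notMem.1 (unitSphereMeasure_inner_eq_zero hv)
      filter_upwards [this] with θ hθ
      exact tendsto_const_nhds.congr' ((hev θ hθ).mono fun R hR => hR.symm)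
  · have h1 := hdom (fun _ => charS Ω x) (ae_of_all _ fun θ => ?_)
    · rwa [integral_const, unitSphereMeasure_real_univ, smul_eq_mul] at h1
    · have hlim : Tendsto (fun R : ℝ => x + R • θ) (𝓝[>] 0) (𝓝 x) := by
        have : Tendsto (fun R : ℝ => x + R • θ) (𝓝 0) (𝓝 (x + (0 : ℝ) • θ)) :=
          Continuous.tendsto (by fun_prop) 0
        rw [zero_smul, add_zero] at this
        exact this.mono_left nhdsWithin_le_nhds
      exact tendsto_const_nhds.congr'
        ((hlim.eventually (eventually_charS_eq hΩ.isOpen hx)).mono fun R hR => hR.symm)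

/-- **Gauss formula** for the part of the domain in almost every ball about `x`. -/
theorem ae_sphereIntegral_add_kernelIntegral (hΩ : IsLyapunovDomain Ω) (x : E3) :
    ∀ᵐ R : ℝ, R ∈ Ioi 0 →
      sphereIntegral Ω x R + kernelIntegral Ω x R = 4 * Real.pi * charS Ω x := by
  obtain ⟨C, hC⟩ := exists_ae_eq_const_of_integral_deriv_mul_eq_zero
    ((hΩ.locallyIntegrable_sphereIntegral x).add (hΩ.locallyIntegrable_kernelIntegral x))
    fun ξ h1 h2 h3 => hΩ.integral_deriv_mul_eq_zero x h1 h2 h3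
  have hlim := (hΩ.tendsto_sphereIntegral_zero x).add (hΩ.tendsto_kernelIntegral_zero x)
  rw [add_zero] at hlim
  -- Constancy holds only almost everywhere, but a set of full measure meets every interval (0, δ),
  -- and this is enough to compare with the limit at 0.
  have hfreq : ∃ᶠ R in 𝓝[>] (0 : ℝ), sphereIntegral Ω x R + kernelIntegral Ω x R = C := by
    intro hev
    obtain ⟨δ, hδ, hsub⟩ := mem_nhdsGT_iff_exists_Ioo_subset.1 hev
    have h1 : ∀ᵐ R : ℝ, R ∉ Ioo 0 δ := by
      filter_upwards [hC] with R hR hRI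
      exact hsub hRI (hR hRI.1)
    have h2 := measure_eq_zero_iff_ae_notMem.2 h1
    have hδ : 0 < δ := hδ
    simp [Real.volume_Ioo, not_le.2 hδ] at h2
  have hCeq : 4 * Real.pi * charS Ω x = C :=
    tendsto_nhds_unique_of_frequently_eq hlim tendsto_const_nhds hfreq
  rw [hCeq]
  exact hC

end IsLyapunovDomain

/-! ### Atoms of a finite measure on the line. -/

/-- The atoms of a finite measure on the line are small near almost every point. -/
theorem ae_isLittleO_measureReal_singleton (ν : Measure ℝ) [IsFiniteMeasure ν] :
    ∀ᵐ t : ℝ, (fun s => ν.real {s}) =o[𝓝 t] fun s => s - t := by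
  set A : Set ℝ := {s | 0 < ν {s}} with hA
  have hAc : A.Countable := Measure.countable_meas_pos_of_disjoint_iUnion
    (fun s => measurableSet_singleton s) fun s t hst => by simpa using hst
  have : Countable A := hAc.to_subtype
  have hsum : ∑' s : A, ν {s.1} ≠ ⊤ := by
    refine ne_top_of_le_ne_top (measure_ne_top ν univ) ?_
    refine tsum_measure_le_measure_univ (fun s => (measurableSet_singleton s.1).nullMeasurableSet)
      fun s t hst => ?_
    refine Disjoint.aedisjoint ?_
    simpa using fun h => hst (Subtype.ext h)
  -- Borel-Cantelli: the intervals of radius n ν{s} about the atoms have total length at most 2n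
  -- ν(ℝ), so almost every t lies in only finitely many of them.
  have hfin : ∀ n : ℕ, ∀ᵐ t : ℝ, {s : A | t ∈ closedBall s.1 (n * ν.real {s.1})}.Finite := by
    intro n
    refine ae_finite_setOfPred_mem ?_
    have h1 : ∀ s : A, volume (closedBall s.1 (n * ν.real {s.1})) =
        ENNReal.ofReal (2 * n) * ν {s.1} := by
      intro s
      rw [Real.volume_closedBall, ← mul_assoc, ENNReal.ofReal_mul (by positivity), ofReal_measureReal]
    simp_rw [h1]
    rw [ENNReal.tsum_mul_left]
    exact ENNReal.mul_ne_top ENNReal.ofReal_ne_top hsum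
  have hAn : ∀ᵐ t : ℝ, t ∉ A := measure_eq_zero_iff_ae_notMem.1 (hAc.measure_zero volume)
  filter_upwards [ae_all_iff.2 hfin, hAn] with t ht htA
  rw [isLittleO_iff]
  intro ε hε
  obtain ⟨n, hn⟩ := exists_nat_gt ε⁻¹
  have hfs := (ht n).image Subtype.val
  have htn : t ∉ Subtype.val '' {s : A | t ∈ closedBall s.1 (n * ν.real {s.1})} := by
    rintro ⟨s, -, rfl⟩
    exact htA s.2
  -- A neighbourhood of t avoids the finitely many atoms whose interval contains t. At every other
  -- atom n ν{s} < |s - t|, with n > 1/ε.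
  filter_upwards [hfs.isClosed.isOpen_compl.mem_nhds htn] with s hs
  rw [Real.norm_of_nonneg measureReal_nonneg, Real.norm_eq_abs]
  by_cases hsA : s ∈ A
  · have h1 : ¬ t ∈ closedBall s (n * ν.real {s}) := fun h => hs ⟨⟨s, hsA⟩, h, rfl⟩
    rw [mem_closedBall, Real.dist_eq, abs_sub_comm, not_le] at h1
    have h2 : ε * (n * ν.real {s}) ≤ ε * |s - t| := by gcongr
    have h3 : 1 ≤ ε * n := by
      rw [← mul_inv_cancel₀ hε.ne']
      gcongr
    have h4 : 0 ≤ ν.real {s} := measureReal_nonneg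
    nlinarith
  · have h1 : ν {s} = 0 := by
      by_contra h
      exact hsA (pos_iff_ne_zero.2 h)
    rw [measureReal_def, h1, ENNReal.toReal_zero]
    positivity

/-! ### The surface integrals as functions of the radius. -/

/-- The integral of `∂(ln r)/∂n` over the part of the boundary in the ball of radius `R`. -/
noncomputable def logIntegral (Ω : Set E3) (x : E3) (R : ℝ) : ℝ :=
  ∫ y in frontier Ω, (ball x R).indicator (fun y => ‖y - x‖ * gaussKernel Ω x y) y ∂μHE[2]

/-- The defect in the Gauss formula for the part of the domain in the ball of radius `R`. -/
noncomputable def gaussDefect (Ω : Set E3) (x : E3) (R : ℝ) : ℝ :=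
  sphereIntegral Ω x R + kernelIntegral Ω x R - 4 * Real.pi * charS Ω x

/-- The derivative in `R` of the front term. -/
noncomputable def frontDensity (Ω : Set E3) (x : E3) : ℝ → ℝ :=
  (Ioi (0 : ℝ)).indicator fun R => 4 * Real.pi * charS Ω x - kernelIntegral Ω x R

theorem kernelIntegral_of_nonpos (Ω : Set E3) (x : E3) {R : ℝ} (hR : R ≤ 0) :
    kernelIntegral Ω x R = 0 := by
  rw [kernelIntegral, ball_eq_empty.2 hR]
  simp

theorem surfacePart_eq (Ω : Set E3) (c : ℝ) (x : E3) (t : ℝ) :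
    surfacePart Ω c x t = frontier Ω ∩ ball x (c * t) := by
  ext y
  rw [mem_inter_iff, mem_ball, dist_eq_norm, norm_sub_rev]
  rfl

theorem setIntegral_surfacePart (Ω : Set E3) (c : ℝ) (x : E3) (t : ℝ) {f k : E3 → ℝ}
    (hfk : f =ᵐ[μHE[2].restrict (frontier Ω)] k) :
    ∫ y in surfacePart Ω c x t, f y ∂μHE[2] =
      ∫ y in frontier Ω, (ball x (c * t)).indicator k y ∂μHE[2] := by
  rw [surfacePart_eq, setIntegral_indicator measurableSet_ball]
  exact integral_congr_ae (ae_mono (Measure.restrict_mono inter_subset_left le_rfl) hfk)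

theorem doubleLayer_eq (Ω : Set E3) (c : ℝ) (x : E3) (t : ℝ) :
    doubleLayer Ω c x t = -kernelIntegral Ω x (c * t) := by
  rw [doubleLayer, setIntegral_surfacePart Ω c x t (normalDerivInv_ae_eq Ω x), kernelIntegral,
    ← integral_neg]
  refine integral_congr_ae (ae_of_all _ fun y => ?_)
  by_cases h : y ∈ ball x (c * t)
  · simp [indicator_of_mem h]
  · simp [indicator_of_notMem h]

/-- On the sphere of radius R the factor 1/r is constant, and scaling to the unit sphere gives R²,
leaving one factor R. -/
theorem frontTerm_eq_of_pos (Ω : Set E3) (c : ℝ) (x : E3) {t : ℝ} (ht : 0 < c * t) :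
    frontTerm Ω c x t = c * t * sphereIntegral Ω x (c * t) + logIntegral Ω x (c * t) := by
  rw [frontTerm, setIntegral_surfacePart Ω c x t (normalDerivLog_ae_eq Ω x), logIntegral]
  congr 1
  have h1 : ∫ y in sphere x (c * t), charS Ω y / ‖x - y‖ ∂μHE[2] =
      ∫ y in sphere x (c * t), charS Ω y * (c * t)⁻¹ ∂μHE[2] := by
    refine setIntegral_congr_fun isClosed_sphere.measurableSet fun y hy => ?_
    rw [mem_sphere_iff_norm, norm_sub_rev] at hy
    rw [hy, div_eq_mul_inv]
  rw [h1, integral_mul_const, setIntegral_sphere x ht, sphereIntegral]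
  field_simp

theorem frontTerm_of_nonpos (Ω : Set E3) {c : ℝ} (x : E3) {t : ℝ} (ht : c * t ≤ 0) :
    frontTerm Ω c x t = 0 := by
  have h1 : μHE[2] (sphere x (c * t)) = 0 := by
    refine measure_mono_null (fun y hy => ?_) (euclideanHausdorffMeasure_two_singleton x)
    rw [mem_sphere] at hy
    exact dist_le_zero.1 (hy ▸ ht)
  rw [frontTerm, surfacePart_eq, ball_eq_empty.2 ht, Measure.restrict_eq_zero.2 h1]
  simp

namespace IsLyapunovDomain

variable {Ω : Set E3}

/-- By Fubini a boundary point at distance r < R is counted for s in (r, R], so it carries the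
weight R - r; r times the kernel is the logarithmic derivative. -/
theorem integral_kernelIntegral (hΩ : IsLyapunovDomain Ω) (x : E3) {R : ℝ} (hR : 0 ≤ R) :
    ∫ s in (0 : ℝ)..R, kernelIntegral Ω x s = R * kernelIntegral Ω x R - logIntegral Ω x R := by
  have := hΩ.isFiniteMeasure_restrict
  have h1 := integral_integral_swap
    (f := fun s y => (1 : ℝ) * (ball x s).indicator (gaussKernel Ω x) y)
    (hΩ.integrable_mul_indicator_prod x (μ := volume.restrict (Ioc 0 R)) (integrable_const 1)
      (hΩ.integrableOn_gaussKernel x))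
  simp only [one_mul] at h1
  rw [intervalIntegral.integral_of_le hR]
  refine h1.trans ?_
  rw [kernelIntegral, logIntegral, ← integral_const_mul, ← integral_sub]
  · refine integral_congr_ae (ae_of_all _ fun y => ?_)
    have h2 : ∀ s, (ball x s).indicator (gaussKernel Ω x) y =
        (Ioi ‖y - x‖).indicator (fun _ => gaussKernel Ω x y) s := by
      intro s
      by_cases h : ‖y - x‖ < s
      · rw [indicator_of_mem (mem_ball_iff_norm.2 h), indicator_of_mem (mem_Ioi.2 h)]
      · rw [indicator_of_notMem fun h' => h (mem_ball_iff_norm.1 h'),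
          indicator_of_notMem (show s ∉ Ioi ‖y - x‖ from h)]
    simp_rw [h2]
    rw [setIntegral_indicator measurableSet_Ioi, setIntegral_const, Ioc_inter_Ioi,
      sup_of_le_right (norm_nonneg _), Real.volume_real_Ioc]
    by_cases h : y ∈ ball x R
    · have h' := mem_ball_iff_norm.1 h
      rw [max_eq_left (by linarith), indicator_of_mem (show R ∈ Ioi ‖y - x‖ from h'),
        indicator_of_mem h]
      simp only [smul_eq_mul]
      ring
    · have h' : R ≤ ‖y - x‖ := not_lt.1 fun hh => h (mem_ball_iff_norm.2 hh)
      rw [max_eq_right (by linarith), indicator_of_notMem (show R ∉ Ioi ‖y - x‖ from not_lt.2 h'),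
        indicator_of_notMem h]
      simp
  · exact ((hΩ.integrableOn_gaussKernel x).indicator measurableSet_ball).const_mul R
  · exact (hΩ.integrableOn_norm_mul_gaussKernel x).indicator measurableSet_ball

/-- Continuity from the left holds at every radius because the balls are open. -/
theorem tendsto_kernelIntegral_left (hΩ : IsLyapunovDomain Ω) (x : E3) (R : ℝ) :
    Tendsto (kernelIntegral Ω x) (𝓝[<] R) (𝓝 (kernelIntegral Ω x R)) := by
  refine tendsto_integral_filter_of_dominated_convergence
    (F := fun R => (ball x R).indicator (gaussKernel Ω x)) (fun y => ‖gaussKernel Ω x y‖)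
    (Eventually.of_forall fun R =>
      (hΩ.integrableOn_gaussKernel x).aestronglyMeasurable.indicator measurableSet_ball)
    (Eventually.of_forall fun R => ae_of_all _ fun y => norm_indicator_le_norm_self _ _)
    (hΩ.integrableOn_gaussKernel x).norm (ae_of_all _ fun y => ?_)
  refine tendsto_const_nhds.congr' ?_
  by_cases h : y ∈ ball x R
  · filter_upwards [nhdsWithin_le_nhds (Ioi_mem_nhds (mem_ball.1 h))] with s hs
    rw [indicator_of_mem h, indicator_of_mem (mem_ball.2 hs)]
  · filter_upwards [self_mem_nhdsWithin] with s hs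
    have hs : s < R := hs
    rw [indicator_of_notMem h, indicator_of_notMem fun h' => h (ball_subset_ball hs.le h')]

theorem continuousAt_kernelIntegral (hΩ : IsLyapunovDomain Ω) (x : E3) {R : ℝ}
    (hR : μHE[2] (frontier Ω ∩ sphere x R) = 0) : ContinuousAt (kernelIntegral Ω x) R := by
  refine tendsto_integral_filter_of_dominated_convergence
    (F := fun R => (ball x R).indicator (gaussKernel Ω x)) (fun y => ‖gaussKernel Ω x y‖)
    (Eventually.of_forall fun R =>
      (hΩ.integrableOn_gaussKernel x).aestronglyMeasurable.indicator measurableSet_ball)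
    (Eventually.of_forall fun R => ae_of_all _ fun y => norm_indicator_le_norm_self _ _)
    (hΩ.integrableOn_gaussKernel x).norm ?_
  have hae : ∀ᵐ y ∂(μHE[2].restrict (frontier Ω)), y ∉ sphere x R := by
    rw [← measure_eq_zero_iff_ae_notMem, Measure.restrict_apply isClosed_sphere.measurableSet,
      inter_comm, hR]
  filter_upwards [hae] with y hy
  refine tendsto_const_nhds.congr' ?_
  rcases lt_or_gt_of_ne (show dist y x ≠ R from hy) with h | h
  · filter_upwards [Ioi_mem_nhds h] with s hs
    rw [indicator_of_mem (mem_ball.2 h), indicator_of_mem (mem_ball.2 hs)]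
  · filter_upwards [Iio_mem_nhds h] with s hs
    have hs : s < dist y x := hs
    rw [indicator_of_notMem fun h' => lt_asymm h (mem_ball.1 h'),
      indicator_of_notMem fun h' => lt_asymm hs (mem_ball.1 h')]

/-- The defect vanishes at radii s arbitrarily close to R from below. As s increases to R, K is
continuous, and so is `charS` along every direction that does not hit S at distance R. Only the
directions hitting S survive in the limit, where two values of `charS` differ by at most 1. -/
theorem abs_gaussDefect_le (hΩ : IsLyapunovDomain Ω) (x : E3) {R : ℝ} (hR : 0 < R) :
    |gaussDefect Ω x R| ≤
      unitSphereMeasure.real ((fun θ => x + R • θ) ⁻¹' frontier Ω) := by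
  set B : Set E3 := (fun θ => x + R • θ) ⁻¹' frontier Ω with hB
  have hBm : MeasurableSet B :=
    (isClosed_frontier (s := Ω)).measurableSet.preimage (by fun_prop)
  have hi := integrable_charS_unitSphere hΩ.isOpen x
  have hgood : Tendsto (fun s : ℝ => ∫ θ in Bᶜ, charS Ω (x + s • θ) ∂unitSphereMeasure) (𝓝[<] R)
      (𝓝 (∫ θ in Bᶜ, charS Ω (x + R • θ) ∂unitSphereMeasure)) := by
    refine tendsto_integral_filter_of_dominated_convergence (fun _ => 1)
      (Eventually.of_forall fun s => (hi s).aestronglyMeasurable.restrict)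
      (Eventually.of_forall fun s => ae_of_all _ fun θ => norm_charS_le Ω _)
      (integrable_const _) ?_
    filter_upwards [ae_restrict_mem hBm.compl] with θ hθ
    have hlim : Tendsto (fun s : ℝ => x + s • θ) (𝓝[<] R) (𝓝 (x + R • θ)) :=
      (Continuous.tendsto (by fun_prop) R).mono_left nhdsWithin_le_nhds
    exact tendsto_const_nhds.congr'
      ((hlim.eventually (eventually_charS_eq hΩ.isOpen hθ)).mono fun s hs => hs.symm)
  have hbad : ∀ s : ℝ, |∫ θ in B, (charS Ω (x + R • θ) - charS Ω (x + s • θ)) ∂unitSphereMeasure| ≤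
      unitSphereMeasure.real B := by
    intro s
    have h1 := norm_integral_le_of_norm_le_const (μ := unitSphereMeasure.restrict B) (C := 1)
      (f := fun θ => charS Ω (x + R • θ) - charS Ω (x + s • θ))
      (ae_of_all _ fun θ => by
        rw [Real.norm_eq_abs, abs_le]
        constructor <;> linarith [charS_nonneg Ω (x + R • θ), charS_nonneg Ω (x + s • θ),
          charS_le_one Ω (x + R • θ), charS_le_one Ω (x + s • θ)])
    rwa [one_mul, measureReal_restrict_apply MeasurableSet.univ, univ_inter] at h1
  have hsplit : ∀ s : ℝ, gaussDefect Ω x s = 0 → |gaussDefect Ω x R| ≤ unitSphereMeasure.real B +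
      |(∫ θ in Bᶜ, charS Ω (x + R • θ) ∂unitSphereMeasure) -
        ∫ θ in Bᶜ, charS Ω (x + s • θ) ∂unitSphereMeasure| +
      |kernelIntegral Ω x R - kernelIntegral Ω x s| := by
    intro s hs
    have h1 : gaussDefect Ω x R =
        (∫ θ in B, (charS Ω (x + R • θ) - charS Ω (x + s • θ)) ∂unitSphereMeasure) +
        ((∫ θ in Bᶜ, charS Ω (x + R • θ) ∂unitSphereMeasure) -
          ∫ θ in Bᶜ, charS Ω (x + s • θ) ∂unitSphereMeasure) +
        (kernelIntegral Ω x R - kernelIntegral Ω x s) := by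
      rw [integral_sub (hi R).integrableOn (hi s).integrableOn]
      have e1 := integral_add_compl hBm (hi R)
      have e2 := integral_add_compl hBm (hi s)
      rw [gaussDefect, sphereIntegral] at hs ⊢
      linarith
    rw [h1]
    refine (abs_add_three _ _ _).trans ?_
    gcongr
    exact hbad s
  have hlim : Tendsto (fun s : ℝ => unitSphereMeasure.real B +
      |(∫ θ in Bᶜ, charS Ω (x + R • θ) ∂unitSphereMeasure) -
        ∫ θ in Bᶜ, charS Ω (x + s • θ) ∂unitSphereMeasure| +
      |kernelIntegral Ω x R - kernelIntegral Ω x s|) (𝓝[<] R)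
      (𝓝 (unitSphereMeasure.real B + |(0 : ℝ)| + |(0 : ℝ)|)) := by
    refine (tendsto_const_nhds.add (Tendsto.abs ?_)).add (Tendsto.abs ?_)
    · simpa using (tendsto_const_nhds (x := ∫ θ in Bᶜ, charS Ω (x + R • θ)
        ∂unitSphereMeasure)).sub hgood
    · simpa using (tendsto_const_nhds (x := kernelIntegral Ω x R)).sub
        (hΩ.tendsto_kernelIntegral_left x R)
  rw [abs_zero, add_zero, add_zero] at hlim
  have hfreq : ∃ᶠ s in 𝓝[<] R, gaussDefect Ω x s = 0 := by
    intro hev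
    obtain ⟨δ, hδ, hsub⟩ := mem_nhdsLT_iff_exists_Ioo_subset.1 hev
    have hδ : δ < R := hδ
    -- The maximum with 0 keeps s positive, where the almost everywhere identity applies.
    have h1 : ∀ᵐ s : ℝ, s ∉ Ioo (max δ 0) R := by
      filter_upwards [hΩ.ae_sphereIntegral_add_kernelIntegral x] with s hs hsI
      refine hsub ⟨(le_max_left _ _).trans_lt hsI.1, hsI.2⟩ ?_
      change gaussDefect Ω x s = 0
      rw [gaussDefect, hs ((le_max_right _ _).trans_lt hsI.1), sub_self]
    have h2 := measure_eq_zero_iff_ae_notMem.2 h1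
    rw [Real.volume_Ioo, ENNReal.ofReal_eq_zero] at h2
    have : max δ 0 < R := max_lt hδ hR
    linarith
  refine ge_of_tendsto_of_frequently hlim (hfreq.mono hsplit)

theorem mul_abs_gaussDefect_le (hΩ : IsLyapunovDomain Ω) (x : E3) {R : ℝ} (hR : 0 < R) :
    R * |gaussDefect Ω x R| ≤ R⁻¹ * μHE[2].real (frontier Ω ∩ sphere x R) := by
  have h1 := euclideanHausdorffMeasure_inter_sphere x hR
    (isClosed_frontier (s := Ω)).measurableSet
  have h2 : μHE[2].real (frontier Ω ∩ sphere x R) =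
      R ^ 2 * unitSphereMeasure.real ((fun θ => x + R • θ) ⁻¹' frontier Ω) := by
    rw [measureReal_def, h1, ENNReal.toReal_mul, ENNReal.toReal_ofReal (sq_nonneg R),
      measureReal_def]
  rw [h2]
  have h3 := hΩ.abs_gaussDefect_le x hR
  have h4 : R⁻¹ * (R ^ 2 * unitSphereMeasure.real ((fun θ => x + R • θ) ⁻¹' frontier Ω)) =
      R * unitSphereMeasure.real ((fun θ => x + R • θ) ⁻¹' frontier Ω) := by field_simp
  rw [h4]
  gcongr

end IsLyapunovDomain

theorem ae_comp_mul_left {c : ℝ} (hc : c ≠ 0) {p : ℝ → Prop} (h : ∀ᵐ R : ℝ, p R) :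
    ∀ᵐ t : ℝ, p (c * t) := by
  refine ae_of_ae_map (f := fun t => c * t) (by fun_prop) ?_
  rw [Real.map_volume_mul_left hc]
  exact Measure.ae_smul_measure h _

/-! ### The front term as a primitive plus a defect, and its derivatives. -/

/-- The primitive of `frontDensity`. -/
noncomputable def frontPrimitive (Ω : Set E3) (x : E3) (R : ℝ) : ℝ :=
  ∫ s in (0 : ℝ)..R, frontDensity Ω x s

/-- The difference between the front term and the primitive of its density. It vanishes unless the
sphere of radius `R` meets the boundary in a set of positive area. -/
noncomputable def frontDefect (Ω : Set E3) (x : E3) : ℝ → ℝ :=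
  (Ioi (0 : ℝ)).indicator fun R => R * gaussDefect Ω x R

/-- The distribution of the distance to `x` of the points of the boundary. -/
noncomputable def radialMeasure (Ω : Set E3) (x : E3) : Measure ℝ :=
  Measure.map (fun y => dist y x) (μHE[2].restrict (frontier Ω))

theorem radialMeasure_singleton (Ω : Set E3) (x : E3) (R : ℝ) :
    radialMeasure Ω x {R} = μHE[2] (frontier Ω ∩ sphere x R) := by
  rw [radialMeasure, Measure.map_apply (by fun_prop) (measurableSet_singleton R), inter_comm]
  exact Measure.restrict_apply (isClosed_sphere (x := x) (ε := R)).measurableSet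

theorem frontDefect_of_nonpos (Ω : Set E3) (x : E3) {R : ℝ} (hR : R ≤ 0) :
    frontDefect Ω x R = 0 := indicator_of_notMem (not_lt.2 hR) _

theorem frontDensity_of_nonpos (Ω : Set E3) (x : E3) {R : ℝ} (hR : R ≤ 0) :
    frontDensity Ω x R = 0 := indicator_of_notMem (not_lt.2 hR) _

theorem frontDensity_of_pos (Ω : Set E3) (x : E3) {R : ℝ} (hR : 0 < R) :
    frontDensity Ω x R = 4 * Real.pi * charS Ω x - kernelIntegral Ω x R :=
  indicator_of_mem (show R ∈ Ioi 0 from hR) _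

theorem frontPrimitive_of_nonpos (Ω : Set E3) (x : E3) {R : ℝ} (hR : R ≤ 0) :
    frontPrimitive Ω x R = 0 := by
  refine intervalIntegral.integral_zero_ae (ae_of_all _ fun s hs => ?_)
  rw [uIoc_of_ge hR] at hs
  exact frontDensity_of_nonpos Ω x hs.2

/-- At t = 0 the left side is 0, whereas `heaviside` is 1/2 there, so t = 0 has to be excluded. -/
theorem neg_doubleLayer_add (Ω : Set E3) {c : ℝ} (hc : 0 < c) (x : E3) {t : ℝ} (ht : t ≠ 0) :
    -doubleLayer Ω c x t + 1 / c * (c * frontDensity Ω x (c * t)) =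
      4 * Real.pi * charS Ω x * heaviside t := by
  rw [doubleLayer_eq, ← mul_assoc, one_div_mul_cancel hc.ne', one_mul, neg_neg, heaviside]
  rcases lt_or_gt_of_ne ht with h | h
  · have h' := (mul_neg_of_pos_of_neg hc h).le
    rw [kernelIntegral_of_nonpos Ω x h', frontDensity_of_nonpos Ω x h', if_neg h.not_gt, if_neg ht]
    ring
  · rw [frontDensity_of_pos Ω x (mul_pos hc h), if_pos h]
    ring

theorem setIntegrable_charS_div_norm {Ω : Set E3} (hΩ : IsOpen Ω) (x : E3) (R : ℝ) :
    IntegrableOn (fun y => charS Ω y / ‖x - y‖) (sphere x R) μHE[2] := by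
  rcases le_or_gt R 0 with hR | hR
  · have h1 : μHE[2] (sphere x R) = 0 := by
      refine measure_mono_null (fun y hy => ?_) (euclideanHausdorffMeasure_two_singleton x)
      rw [mem_sphere] at hy
      exact dist_le_zero.1 (hy ▸ hR)
    rw [IntegrableOn, Measure.restrict_eq_zero.2 h1]
    exact integrable_zero_measure
  · have h1 : μHE[2] (sphere x R) ≠ ⊤ := by
      have := euclideanHausdorffMeasure_inter_sphere x hR MeasurableSet.univ
      rw [univ_inter] at this
      rw [this]
      exact ENNReal.mul_ne_top ENNReal.ofReal_ne_top (measure_ne_top _ _)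
    refine IntegrableOn.congr_fun (f := fun y => charS Ω y * R⁻¹) ?_ (fun y hy => ?_)
      isClosed_sphere.measurableSet
    · refine Integrable.mul_const ?_ _
      exact Measure.integrableOn_of_bounded (M := 1) h1 (measurable_charS hΩ).aestronglyMeasurable
        (ae_of_all _ (norm_charS_le Ω))
    · rw [mem_sphere_iff_norm, norm_sub_rev] at hy
      rw [hy, div_eq_mul_inv]

namespace IsLyapunovDomain

variable {Ω : Set E3}

theorem isFiniteMeasure_radialMeasure (hΩ : IsLyapunovDomain Ω) (x : E3) :
    IsFiniteMeasure (radialMeasure Ω x) := by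
  have := hΩ.isFiniteMeasure_restrict
  unfold radialMeasure
  infer_instance

/-- These radii are the atoms of the finite measure `radialMeasure`. -/
theorem countable_area_sphere_ne_zero (hΩ : IsLyapunovDomain Ω) (x : E3) :
    {R | μHE[2] (frontier Ω ∩ sphere x R) ≠ 0}.Countable := by
  have := hΩ.isFiniteMeasure_radialMeasure x
  have h := Measure.countable_meas_pos_of_disjoint_iUnion (μ := radialMeasure Ω x)
    (As := fun R : ℝ => {R}) (fun s => measurableSet_singleton s)
    fun s t hst => by simpa using hst
  simpa only [radialMeasure_singleton, pos_iff_ne_zero] using h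

theorem ae_area_sphere_eq_zero (hΩ : IsLyapunovDomain Ω) (x : E3) :
    ∀ᵐ R : ℝ, μHE[2] (frontier Ω ∩ sphere x R) = 0 := by
  filter_upwards [measure_eq_zero_iff_ae_notMem.1
    ((hΩ.countable_area_sphere_ne_zero x).measure_zero volume)] with R hR
  exact not_not.1 hR

theorem locallyIntegrable_frontDensity (hΩ : IsLyapunovDomain Ω) (x : E3) :
    LocallyIntegrable (frontDensity Ω x) :=
  ((locallyIntegrable_const _).sub (hΩ.locallyIntegrable_kernelIntegral x)).indicator
    measurableSet_Ioi

theorem frontPrimitive_of_nonneg (hΩ : IsLyapunovDomain Ω) (x : E3) {R : ℝ} (hR : 0 ≤ R) :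
    frontPrimitive Ω x R =
      R * (4 * Real.pi * charS Ω x) - (R * kernelIntegral Ω x R - logIntegral Ω x R) := by
  have h1 : frontPrimitive Ω x R =
      ∫ s in (0 : ℝ)..R, (4 * Real.pi * charS Ω x - kernelIntegral Ω x s) := by
    refine intervalIntegral.integral_congr_ae (ae_of_all _ fun s hs => ?_)
    rw [uIoc_of_le hR] at hs
    exact frontDensity_of_pos Ω x hs.1
  rw [h1, intervalIntegral.integral_sub intervalIntegrable_const
    ((hΩ.locallyIntegrable_kernelIntegral x).integrableOn_isCompact isCompact_uIcc).intervalIntegrable, hΩ.integral_kernelIntegral x hR,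
    intervalIntegral.integral_const, sub_zero, smul_eq_mul]

theorem frontTerm_eq (hΩ : IsLyapunovDomain Ω) (c : ℝ) (x : E3) (t : ℝ) :
    frontTerm Ω c x t = frontPrimitive Ω x (c * t) + frontDefect Ω x (c * t) := by
  rcases le_or_gt (c * t) 0 with h | h
  · rw [frontTerm_of_nonpos Ω x h, frontPrimitive_of_nonpos Ω x h, frontDefect_of_nonpos Ω x h,
      add_zero]
  · rw [frontTerm_eq_of_pos Ω c x h, hΩ.frontPrimitive_of_nonneg x h.le, frontDefect,
      indicator_of_mem (show c * t ∈ Ioi 0 from h), gaussDefect]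
    ring

theorem continuous_frontPrimitive (hΩ : IsLyapunovDomain Ω) (x : E3) :
    Continuous (frontPrimitive Ω x) :=
  intervalIntegral.continuous_primitive
    (fun _ _ => ((hΩ.locallyIntegrable_frontDensity x).integrableOn_isCompact isCompact_uIcc).intervalIntegrable) 0

theorem continuousAt_frontDensity (hΩ : IsLyapunovDomain Ω) (x : E3) {R : ℝ} (hR : R ≠ 0)
    (hRS : μHE[2] (frontier Ω ∩ sphere x R) = 0) : ContinuousAt (frontDensity Ω x) R := by
  rcases lt_or_gt_of_ne hR with h | h
  · refine (continuousAt_const (y := (0 : ℝ))).congr ?_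
    filter_upwards [Iio_mem_nhds h] with s hs
    exact (frontDensity_of_nonpos Ω x (le_of_lt hs)).symm
  · refine ((continuousAt_const (y := 4 * Real.pi * charS Ω x)).sub (hΩ.continuousAt_kernelIntegral x hRS)).congr ?_
    filter_upwards [Ioi_mem_nhds h] with s hs
    exact (frontDensity_of_pos Ω x hs).symm

theorem hasDerivAt_frontPrimitive (hΩ : IsLyapunovDomain Ω) (x : E3) {R : ℝ} (hR : R ≠ 0)
    (hRS : μHE[2] (frontier Ω ∩ sphere x R) = 0) :
    HasDerivAt (frontPrimitive Ω x) (frontDensity Ω x R) R :=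
  intervalIntegral.integral_hasDerivAt_right
    ((hΩ.locallyIntegrable_frontDensity x).integrableOn_isCompact isCompact_uIcc).intervalIntegrable
    ((hΩ.locallyIntegrable_frontDensity x).aestronglyMeasurable.stronglyMeasurableAtFilter)
    (hΩ.continuousAt_frontDensity x hR hRS)

theorem frontDefect_eq_zero (hΩ : IsLyapunovDomain Ω) (x : E3) {R : ℝ}
    (hRS : μHE[2] (frontier Ω ∩ sphere x R) = 0) : frontDefect Ω x R = 0 := by
  rcases le_or_gt R 0 with h | h
  · exact frontDefect_of_nonpos Ω x h
  · have h1 := hΩ.mul_abs_gaussDefect_le x h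
    rw [measureReal_def, hRS, ENNReal.toReal_zero, mul_zero] at h1
    rw [frontDefect, indicator_of_mem (show R ∈ Ioi 0 from h), ← abs_nonpos_iff, abs_mul,
      abs_of_pos h]
    exact h1

/-- Vanishing almost everywhere would not give a derivative. What does is that the defect at s is at
most s⁻¹ times the atom of `radialMeasure` at s, and these atoms are o(s - R) for almost every R. -/
theorem hasDerivAt_frontDefect (hΩ : IsLyapunovDomain Ω) (x : E3) :
    ∀ᵐ R : ℝ, HasDerivAt (frontDefect Ω x) 0 R := by
  have := hΩ.isFiniteMeasure_radialMeasure x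
  have hzero : ∀ᵐ R : ℝ, R ≠ 0 := Measure.ae_ne volume 0
  filter_upwards [hΩ.ae_area_sphere_eq_zero x, hzero, ae_isLittleO_measureReal_singleton (radialMeasure Ω x)]
    with R hR hR0 hlittle
  rw [hasDerivAt_iff_isLittleO]
  simp only [smul_zero, sub_zero, hΩ.frontDefect_eq_zero x hR]
  rcases lt_or_gt_of_ne hR0 with h | h
  · refine (isLittleO_zero (fun s : ℝ => s - R) (𝓝 R)).congr' ?_ EventuallyEq.rfl
    filter_upwards [Iio_mem_nhds h] with s hs
    exact (frontDefect_of_nonpos Ω x (le_of_lt hs)).symm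
  · refine IsBigO.trans_isLittleO (IsBigO.of_bound (R / 2)⁻¹ ?_) hlittle
    -- Staying above R / 2 bounds s⁻¹ by a constant.
    filter_upwards [Ioi_mem_nhds (half_lt_self h)] with s hs
    have hs : R / 2 < s := hs
    have hs0 : 0 < s := (half_pos h).trans hs
    rw [frontDefect, indicator_of_mem (show s ∈ Ioi 0 from hs0), norm_mul, Real.norm_eq_abs,
      Real.norm_eq_abs, abs_of_pos hs0, Real.norm_of_nonneg measureReal_nonneg, measureReal_def,
      radialMeasure_singleton]
    refine (hΩ.mul_abs_gaussDefect_le x hs0).trans ?_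
    rw [measureReal_def]
    gcongr

theorem hasDerivAt_frontTerm (hΩ : IsLyapunovDomain Ω) (c : ℝ) (x : E3) {t : ℝ}
    (ht : c * t ≠ 0) (htS : μHE[2] (frontier Ω ∩ sphere x (c * t)) = 0)
    (hd : HasDerivAt (frontDefect Ω x) 0 (c * t)) :
    HasDerivAt (frontTerm Ω c x) (c * frontDensity Ω x (c * t)) t := by
  have h1 := ((hΩ.hasDerivAt_frontPrimitive x ht htS).add hd).comp t
    ((hasDerivAt_id t).const_mul c)
  rw [add_zero, mul_one, mul_comm] at h1
  exact h1.congr_of_eventuallyEq (Eventually.of_forall (hΩ.frontTerm_eq c x))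

theorem hasDerivAt_frontTerm_of_eventually (hΩ : IsLyapunovDomain Ω) {c : ℝ} (hc : 0 < c) (x : E3)
    {t : ℝ} (ht : t ≠ 0) (h : ∀ᶠ s in 𝓝 t, μHE[2] (frontier Ω ∩ sphere x (c * s)) = 0) :
    HasDerivAt (frontTerm Ω c x) (c * frontDensity Ω x (c * t)) t := by
  refine hΩ.hasDerivAt_frontTerm c x (mul_ne_zero hc.ne' ht) h.self_of_nhds ?_
  refine (hasDerivAt_const (c * t) (0 : ℝ)).congr_of_eventuallyEq ?_
  have hlim : Tendsto (fun R => R / c) (𝓝 (c * t)) (𝓝 t) := by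
    have := (continuous_id.div_const c).tendsto (c * t)
    rwa [id, mul_div_cancel_left₀ t hc.ne'] at this
  filter_upwards [hlim.eventually h] with R hR
  rw [mul_div_cancel₀ R hc.ne'] at hR
  exact hΩ.frontDefect_eq_zero x hR

theorem ae_hasDerivAt_frontTerm (hΩ : IsLyapunovDomain Ω) {c : ℝ} (hc : 0 < c) (x : E3) :
    ∀ᵐ t : ℝ, HasDerivAt (frontTerm Ω c x) (c * frontDensity Ω x (c * t)) t := by
  filter_upwards [ae_comp_mul_left hc.ne' (hΩ.ae_area_sphere_eq_zero x), Measure.ae_ne volume (0 : ℝ),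
    ae_comp_mul_left hc.ne' (hΩ.hasDerivAt_frontDefect x)] with t h1 h2 h3
  exact hΩ.hasDerivAt_frontTerm c x (mul_ne_zero hc.ne' h2) h1 h3

theorem locallyIntegrable_doubleLayer (hΩ : IsLyapunovDomain Ω) (c : ℝ) (x : E3) :
    LocallyIntegrable (doubleLayer Ω c x) := by
  have h1 : doubleLayer Ω c x = fun t => -kernelIntegral Ω x (c * t) :=
    funext (doubleLayer_eq Ω c x)
  rw [h1]
  refine (locallyIntegrable_const (∫ y in frontier Ω, ‖gaussKernel Ω x y‖ ∂μHE[2])).mono ?_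
    (ae_of_all _ fun t => ?_)
  · exact ((hΩ.stronglyMeasurable_kernelIntegral x).comp_measurable
      (by fun_prop : Measurable fun t : ℝ => c * t)).neg.aestronglyMeasurable
  · rw [norm_neg]
    exact (hΩ.norm_kernelIntegral_le x _).trans (Real.le_norm_self _)

theorem frontTerm_ae_eq (hΩ : IsLyapunovDomain Ω) {c : ℝ} (hc : 0 < c) (x : E3) :
    frontTerm Ω c x =ᵐ[volume] fun t => frontPrimitive Ω x (c * t) := by
  filter_upwards [ae_comp_mul_left hc.ne' (hΩ.ae_area_sphere_eq_zero x)] with t ht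
  rw [hΩ.frontTerm_eq, hΩ.frontDefect_eq_zero x ht, add_zero]

theorem locallyIntegrable_frontTerm (hΩ : IsLyapunovDomain Ω) {c : ℝ} (hc : 0 < c) (x : E3) :
    LocallyIntegrable (frontTerm Ω c x) := by
  have h1 : Continuous fun t => frontPrimitive Ω x (c * t) :=
    (hΩ.continuous_frontPrimitive x).comp (by fun_prop)
  exact h1.locallyIntegrable.congr (hΩ.frontTerm_ae_eq hc x).symm

theorem locallyIntegrable_frontDensity_comp (hΩ : IsLyapunovDomain Ω) {c : ℝ} (hc : 0 < c)
    (x : E3) : LocallyIntegrable fun t => c * frontDensity Ω x (c * t) := by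
  have h1 : LocallyIntegrable fun t =>
      c * ((Ioi (0 : ℝ)).indicator (fun _ => 4 * Real.pi * charS Ω x) t + doubleLayer Ω c x t) :=
    (((locallyIntegrable_const _).indicator measurableSet_Ioi).add
      (hΩ.locallyIntegrable_doubleLayer c x)).smul c
  refine h1.congr (ae_of_all _ fun t => ?_)
  change c * (_ + doubleLayer Ω c x t) = c * frontDensity Ω x (c * t)
  rw [doubleLayer_eq]
  rcases le_or_gt t 0 with h | h
  · have h' := mul_nonpos_of_nonneg_of_nonpos hc.le h
    rw [indicator_of_notMem (show t ∉ Ioi (0 : ℝ) from not_lt.2 h), kernelIntegral_of_nonpos Ω x h',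
      frontDensity_of_nonpos Ω x h', neg_zero, add_zero]
  · rw [indicator_of_mem (show t ∈ Ioi 0 from h), frontDensity_of_pos Ω x (mul_pos hc h),
      sub_eq_add_neg]

/-- Almost everywhere the front term equals its primitive part, which is continuous, so integration
by parts is legitimate although the density may jump. -/
theorem integral_frontTerm_mul_deriv (hΩ : IsLyapunovDomain Ω) {c : ℝ} (hc : 0 < c) (x : E3)
    {φ : ℝ → ℝ} (hφ : ContDiff ℝ 1 φ) (hφs : HasCompactSupport φ) :
    ∫ t, frontTerm Ω c x t * deriv φ t = -∫ t, c * frontDensity Ω x (c * t) * φ t := by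
  have hprim : Continuous fun t => frontPrimitive Ω x (c * t) :=
    (hΩ.continuous_frontPrimitive x).comp (by fun_prop)
  have hi1 : Integrable fun t => c * frontDensity Ω x (c * t) * φ t :=
    (hΩ.locallyIntegrable_frontDensity_comp hc x).integrable_smul_right_of_hasCompactSupport
      hφ.continuous hφs
  have hi2 : Integrable fun t => frontPrimitive Ω x (c * t) * deriv φ t :=
    hprim.locallyIntegrable.integrable_smul_right_of_hasCompactSupport
      (hφ.continuous_deriv le_rfl) hφs.deriv
  have h1 : ∫ t, frontTerm Ω c x t * deriv φ t = ∫ t, frontPrimitive Ω x (c * t) * deriv φ t :=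
    integral_congr_ae ((hΩ.frontTerm_ae_eq hc x).mul EventuallyEq.rfl)
  rw [h1, eq_neg_iff_add_eq_zero, ← integral_add hi2 hi1]
  obtain ⟨A, hA⟩ := hφs.isBounded.subset_closedBall 0
  have hzero : ∀ t, t ∉ closedBall (0 : ℝ) A → φ t = 0 ∧ deriv φ t = 0 := fun t ht =>
    ⟨image_eq_zero_of_notMem_tsupport fun h => ht (hA h), by
      by_contra h
      exact ht (hA (support_deriv_subset h))⟩
  set B : ℝ := |A| + 1 with hB
  have hBA : A < B := (le_abs_self A).trans_lt (lt_add_one _)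
  have hB0 : 0 < B := by positivity
  have hsupp : Function.support (fun t => frontPrimitive Ω x (c * t) * deriv φ t +
      c * frontDensity Ω x (c * t) * φ t) ⊆ Ioc (-B) B := by
    intro t ht
    have h2 : t ∈ closedBall (0 : ℝ) A := by
      by_contra h
      obtain ⟨e1, e2⟩ := hzero t h
      refine ht ?_
      change _ * _ + _ * _ = (0 : ℝ)
      rw [e1, e2, mul_zero, mul_zero, add_zero]
    rw [mem_closedBall_zero_iff, Real.norm_eq_abs, abs_le] at h2
    exact ⟨by linarith [h2.1], by linarith [h2.2]⟩
  rw [← intervalIntegral.integral_eq_integral_of_support_subset hsupp]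
  -- For a continuous function the fundamental theorem tolerates countably many exceptional points:
  -- here 0 and the times at which the sphere carries positive area of S.
  have hcount : ({0} ∪ (fun t => c * t) ⁻¹'
      {R | μHE[2] (frontier Ω ∩ sphere x R) ≠ 0}).Countable :=
    (countable_singleton 0).union ((hΩ.countable_area_sphere_ne_zero x).preimage
      (mul_right_injective₀ hc.ne'))
  refine (integral_eq_of_hasDerivAt_off_countable
    (fun t => frontPrimitive Ω x (c * t) * φ t) _ hcount
    (hprim.mul hφ.continuous).continuousOn ?_ (hi2.add hi1).intervalIntegrable).trans ?_
  · intro t ht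
    have h0 : t ≠ 0 := fun h => ht.2 (Or.inl h)
    have hS : μHE[2] (frontier Ω ∩ sphere x (c * t)) = 0 := not_not.1 fun h => ht.2 (Or.inr h)
    have h2 := (hΩ.hasDerivAt_frontPrimitive x (mul_ne_zero hc.ne' h0) hS).comp t
      ((hasDerivAt_id t).const_mul c)
    have h3 := h2.mul ((hφ.differentiable one_ne_zero).differentiableAt (x := t)).hasDerivAt
    rw [mul_one, mul_comm (frontDensity Ω x (c * t)), add_comm] at h3
    exact h3
  · have e1 : φ B = 0 := (hzero B (by
      rw [mem_closedBall_zero_iff, Real.norm_of_nonneg hB0.le]; exact not_le.2 hBA)).1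
    have e2 : φ (-B) = 0 := (hzero (-B) (by
      rw [mem_closedBall_zero_iff, norm_neg, Real.norm_of_nonneg hB0.le]; exact not_le.2 hBA)).1
    rw [e1, e2, mul_zero, mul_zero, sub_zero]

/-- For a radius so large that the ball contains the closure of Ω, the sphere misses it and K is the
full integral. Such a radius can be taken from the dense set where the formula holds. -/
theorem integral_frontier_gaussKernel (hΩ : IsLyapunovDomain Ω) (x : E3) :
    ∫ y in frontier Ω, gaussKernel Ω x y ∂μHE[2] = 4 * Real.pi * charS Ω x := by
  obtain ⟨M, hM⟩ := (hΩ.isBounded.closure).subset_closedBall x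
  obtain ⟨R, hR, hMR⟩ := (Measure.dense_of_ae
    (hΩ.ae_sphereIntegral_add_kernelIntegral x)).exists_gt (max M 0)
  have hR0 : 0 < R := (le_max_right _ _).trans_lt hMR
  have hMR : M < R := (le_max_left _ _).trans_lt hMR
  have h1 : sphereIntegral Ω x R = 0 := by
    refine integral_eq_zero_of_ae ?_
    filter_upwards [ae_restrict_mem (isClosed_sphere (x := (0 : E3)) (ε := 1)).measurableSet]
      with θ hθ
    refine charS_of_notMem_closure fun h => ?_
    have h2 := hM h
    rw [mem_closedBall_iff_norm, add_sub_cancel_left, norm_smul, mem_sphere_zero_iff_norm.1 hθ,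
      mul_one, Real.norm_of_nonneg hR0.le] at h2
    linarith
  have h2 : kernelIntegral Ω x R = ∫ y in frontier Ω, gaussKernel Ω x y ∂μHE[2] := by
    refine setIntegral_congr_fun isClosed_frontier.measurableSet fun y hy => ?_
    exact indicator_of_mem (closedBall_subset_ball hMR (hM (frontier_subset_closure hy))) _
  rw [← h2, ← hR hR0, h1, zero_add]

end IsLyapunovDomain

/-! ### Late times and the final statement. -/

theorem norm_sub_lt_of_arrivalTime_lt {Ω : Set E3} (hS : IsCompact (frontier Ω)) {c : ℝ}
    (hc : 0 < c) {x : E3} {t : ℝ} (ht : arrivalTime Ω c x < t) {y : E3} (hy : y ∈ frontier Ω) :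
    ‖x - y‖ < c * t := by
  have hcont : Continuous fun y => ‖x - y‖ / c := by fun_prop
  have h1 : ‖x - y‖ / c ≤ arrivalTime Ω c x :=
    le_csSup (hS.image hcont).bddAbove (mem_image_of_mem _ hy)
  rw [mul_comm, ← div_lt_iff₀ hc]
  exact h1.trans_lt ht

theorem arrivalTime_nonneg (Ω : Set E3) {c : ℝ} (hc : 0 < c) (x : E3) : 0 ≤ arrivalTime Ω c x := by
  refine Real.sSup_nonneg ?_
  rintro _ ⟨y, -, rfl⟩
  positivity

namespace IsLyapunovDomain

variable {Ω : Set E3}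

/-- After the arrival time the spheres no longer meet S, and K has reached its final value 4π `charS
Ω x`, so the density is zero. -/
theorem hasDerivAt_frontTerm_of_arrivalTime_lt (hΩ : IsLyapunovDomain Ω) {c : ℝ} (hc : 0 < c)
    {x : E3} {t : ℝ} (ht : arrivalTime Ω c x < t) : HasDerivAt (frontTerm Ω c x) 0 t := by
  have ht0 : 0 < t := (arrivalTime_nonneg Ω hc x).trans_lt ht
  have h1 := hΩ.hasDerivAt_frontTerm_of_eventually hc x ht0.ne' (by
    filter_upwards [Ioi_mem_nhds ht] with s hs
    have h2 : frontier Ω ∩ sphere x (c * s) = ∅ := by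
      refine eq_empty_of_forall_notMem fun y hy => ?_
      have h3 := norm_sub_lt_of_arrivalTime_lt hΩ.isCompact_frontier hc hs hy.1
      rw [norm_sub_rev, mem_sphere_iff_norm.1 hy.2] at h3
      exact lt_irrefl _ h3
    rw [h2, measure_empty])
  have h2 : kernelIntegral Ω x (c * t) = 4 * Real.pi * charS Ω x := by
    rw [← hΩ.integral_frontier_gaussKernel x]
    refine setIntegral_congr_fun isClosed_frontier.measurableSet fun y hy => ?_
    refine indicator_of_mem (mem_ball_iff_norm.2 ?_) _
    rw [norm_sub_rev]
    exact norm_sub_lt_of_arrivalTime_lt hΩ.isCompact_frontier hc ht hy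
  rwa [frontDensity_of_pos Ω x (mul_pos hc ht0), h2, sub_self, mul_zero] at h1

theorem integral_neg_doubleLayer_mul_sub (hΩ : IsLyapunovDomain Ω) {c : ℝ} (hc : 0 < c) (x : E3)
    {φ : ℝ → ℝ} (hφ : ContDiff ℝ 1 φ) (hφs : HasCompactSupport φ) :
    (∫ t, -doubleLayer Ω c x t * φ t) - (1 / c) * (∫ t, frontTerm Ω c x t * deriv φ t) =
      ∫ t, 4 * Real.pi * charS Ω x * heaviside t * φ t := by
  have hi1 : Integrable fun t => c * frontDensity Ω x (c * t) * φ t :=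
    (hΩ.locallyIntegrable_frontDensity_comp hc x).integrable_smul_right_of_hasCompactSupport
      hφ.continuous hφs
  have hi2 : Integrable fun t => -doubleLayer Ω c x t * φ t :=
    (hΩ.locallyIntegrable_doubleLayer c x).neg.integrable_smul_right_of_hasCompactSupport
      hφ.continuous hφs
  rw [hΩ.integral_frontTerm_mul_deriv hc x hφ hφs, mul_neg, sub_neg_eq_add, ← integral_const_mul,
    ← integral_add hi2 (hi1.const_mul _)]
  refine integral_congr_ae ?_
  filter_upwards [Measure.ae_ne volume (0 : ℝ)] with t ht
  rw [← neg_doubleLayer_add Ω hc x ht]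
  ring

end IsLyapunovDomain

theorem lemma6p1 (c : ℝ) (hc : 0 < c) (Ω : Set E3) (hΩ : IsLyapunovDomain Ω) (x : E3) :
    -- all surface integrals converge absolutely
    IntegrableOn (normalDerivInv Ω x) (frontier Ω) μHE[2] ∧
    IntegrableOn (normalDerivLog Ω x) (frontier Ω) μHE[2] ∧
    (∀ t : ℝ, IntegrableOn (fun y => charS Ω y / ‖x - y‖) (sphere x (c * t)) μHE[2]) ∧
    -- the identity in the sense of distributions in `t`
    LocallyIntegrable (doubleLayer Ω c x) ∧
    LocallyIntegrable (frontTerm Ω c x) ∧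
    (∀ φ : ℝ → ℝ, ContDiff ℝ ∞ φ → HasCompactSupport φ →
      (∫ t, -doubleLayer Ω c x t * φ t) - (1 / c) * (∫ t, frontTerm Ω c x t * deriv φ t) =
        ∫ t, 4 * Real.pi * charS Ω x * heaviside t * φ t) ∧
    -- the identity with a classical derivative, for almost every `t`
    (∀ᵐ t : ℝ, DifferentiableAt ℝ (frontTerm Ω c x) t ∧
      -doubleLayer Ω c x t + (1 / c) * deriv (frontTerm Ω c x) t =
        4 * Real.pi * charS Ω x * heaviside t) ∧
    -- and at every `t ≠ 0` near which the spheres `r = cs` meet `S` in sets of zero area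
    (∀ t : ℝ, t ≠ 0 → (∀ᶠ s in 𝓝 t, μHE[2] (frontier Ω ∩ sphere x (c * s)) = 0) →
      DifferentiableAt ℝ (frontTerm Ω c x) t ∧
      -doubleLayer Ω c x t + (1 / c) * deriv (frontTerm Ω c x) t =
        4 * Real.pi * charS Ω x * heaviside t) ∧
    -- for `t > t*(x)` it reduces to the classical Gauss formula
    (∀ t : ℝ, arrivalTime Ω c x < t →
      surfacePart Ω c x t = frontier Ω ∧
      HasDerivAt (frontTerm Ω c x) 0 t ∧
      -(∫ y in frontier Ω, normalDerivInv Ω x y ∂μHE[2]) = 4 * Real.pi * charS Ω x) := by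
  refine ⟨hΩ.integrableOn_normalDerivInv x, hΩ.integrableOn_normalDerivLog x,
    fun t => setIntegrable_charS_div_norm hΩ.isOpen x (c * t), hΩ.locallyIntegrable_doubleLayer c x,
    hΩ.locallyIntegrable_frontTerm hc x,
    fun φ hφ hφs => hΩ.integral_neg_doubleLayer_mul_sub hc x (hφ.of_le (by norm_cast))
      hφs,
    ?_, fun t ht hS => ?_, fun t ht => ⟨?_, hΩ.hasDerivAt_frontTerm_of_arrivalTime_lt hc ht, ?_⟩⟩
  · filter_upwards [hΩ.ae_hasDerivAt_frontTerm hc x, Measure.ae_ne volume (0 : ℝ)] with t h h0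
    refine ⟨h.differentiableAt, ?_⟩
    rw [h.deriv, neg_doubleLayer_add Ω hc x h0]
  · have h := hΩ.hasDerivAt_frontTerm_of_eventually hc x ht hS
    refine ⟨h.differentiableAt, ?_⟩
    rw [h.deriv, neg_doubleLayer_add Ω hc x ht]
  · exact sep_eq_self_iff_mem_true.2 fun y hy =>
      norm_sub_lt_of_arrivalTime_lt hΩ.isCompact_frontier hc ht hy
  · rw [← hΩ.integral_frontier_gaussKernel x, ← integral_neg]
    refine integral_congr_ae ((normalDerivInv_ae_eq Ω x).mono fun y hy => ?_)
    simp only [hy, neg_neg]
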